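/- Notation. Let $\phi$ be Euler's function and $\sigma$ the sum-of-divisors function; $\log_k$ is the $k$-th iterate of the natural logarithm. For $f\in\{\phi,\sigma\}$ let $V_f(x)$ be the number of integers in $[1,x]$ of the form $f(n)$, $n\ge 1$. $P^+(n)$ is the largest prime factor of $n$ ($P^+(1)=1$), $\Omega(n)$ is the number of prime factors of $n$ with multiplicity, and $\Omega(n,U,T)$ is the number of those prime factors $p$ with $U<p\le T$, with multiplicity. Write $n=p_0(n)p_1(n)p_2(n)\cdots$ with primes $p_0(n)\ge p_1(n)\ge\cdots$, and put $x_i(n;x)=\log_2 p_i(n)/\log_2 x$ if $i<\Omega(n)$ and $p_i(n)>2$, and $x_i(n;x)=0$ otherwise. An integer $m\geq 1$ is squarefull if $p^2\mid m$ for every prime $p\mid m$; $d\parallel n$ means $d\mid n$ and $\gcd(d,n/d)=1$. Let $a_n=(n+1)\log(n+1)-n\log n-1$ for $n\ge1$ (where $a_n > 0$), let $\rho$ be the unique number in $(0,1)$ with $\sum_{n\ge1}a_n\rho^n=1$, and let $C=1/(2|\log\rho|)$. Put $$L_0=\lfloor 2C(\log_3x-\log_4x)\rfloor,\quad L=\lfloor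 L_0-2\sqrt{\log_3x}\rfloor,\quad \xi_i=1+\frac1{10(L_0-i)^3}\ (0\le i\le L-2),$$ $$S=\exp((\log_2x)^{36}),\qquad \omega=(\log_2x)^{-1/2+\epsilon/2}.$$ Let $\mathscr S_L(\boldsymbol\xi)$ be the set of $(z_1,\dots,z_L)\in\mathbb R^L$ with $0\le z_L\le\dots\le z_1\le1$, $\sum_{j=1}^{L}a_jz_j\le\xi_0$, and $\sum_{j=1}^{L-i}a_jz_{i+j}\le\xi_iz_i$ for $1\le i\le L-2$. A prime $p$ is $S$-normal if for each $f\in\{\phi,\sigma\}$ one has $\Omega(f(p),1,S)\le2\log_2S$ and, for all real $S\le U<T\le f(p)$, $|\Omega(f(p),U,T)-(\log_2T-\log_2U)|<\sqrt{\log_2S\,\log_2T}$. For $f\in\{\phi,\sigma\}$, $\epsilon>0$ and $x$ large, let $\mathscr A_f=\mathscr A_f(x,\epsilon)$ be the set of positive integers $n$ with $f(n)\le x$ such that, writing $p_i=p_i(n)$ and $x_i=x_i(n;x)$: (0) $n\ge x/\log x$; (1) every squarefull divisor $m$ of $n$ or of $f(n)$ satisfies $m\le(\log x)^2$; (2) every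 prime dividing $n$ is $S$-normal; (3) $\Omega(f(n))\le10\log_2x$ and $\Omega(n)\le10\log_2x$; (4) if $d\parallel n$ and $d\ge\exp((\log_2x)^{1/2})$, then $\Omega(f(d))\le10\log_2f(d)$; (5) $(x_1,\dots,x_L)\in\mathscr S_L(\boldsymbol\xi)$; (6) $n$ has at least $L+1$ odd prime divisors, counted with multiplicity; (7) $P^+(f(p_0))\ge x^{1/\log_2x}$ and $p_1<x^{1/(100\log_2x)}$; (8) $a_1x_1+\dots+a_Lx_L\le1-\omega$. Let $N_\epsilon(x)$ be the number of distinct values $\phi(a)$ arising from solutions of $\phi(a)=\sigma(a')$ with $(a,a')\in\mathscr A_\phi\times\mathscr A_\sigma$. Proposition. (i) For all $\epsilon>0$ and $A>0$ there is $x_0(\epsilon,A)$ such that for all real $x\ge x_0(\epsilon,A)$, $$N_\epsilon(x)<\frac{V_\phi(x)+V_\sigma(x)}{(\log_2x)^A}.$$ (ii) There is an absolute constant $K>0$ such that for every $\epsilon>0$ there is $x_0(\epsilon)$ such that for all real $x\ge x_0(\epsilon)$, $$N_\epsilon(x)\le K\,\frac{x}{\log x}\exp\left(-\tfrac14(\log_2x)^{1/2+\epsilon/2}\right).$$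 -/

import Mathlib

open Filter

namespace CommonValues

noncomputable section

/-- The `k`-th iterate `log_k` of the natural logarithm. -/
def iterLog (k : ℕ) (x : ℝ) : ℝ := Real.log^[k] x

/-- Euler's totient function `φ`. -/
def phi (n : ℕ) : ℕ := Nat.totient n

/-- The sum-of-divisors function `σ`. -/
def sigma (n : ℕ) : ℕ := ArithmeticFunction.sigma 1 n

/-- `V_f(x)`: the number of values of `f` (on the positive integers) lying in `[1, x]`. -/
def valueCount (f : ℕ → ℕ) (x : ℝ) : ℕ :=
  Set.ncard {v : ℕ | (∃ n : ℕ, 0 < n ∧ f n = v) ∧ 1 ≤ v ∧ (v : ℝ) ≤ x}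

/-! ### The constants `a_n`, `ρ`, `C` -/

/-- `a_n = (n+1) log (n+1) - n log n - 1`. -/
def coeffA (n : ℕ) : ℝ := ((n : ℝ) + 1) * Real.log ((n : ℝ) + 1) - (n : ℝ) * Real.log n - 1

/-- `F(z) = ∑_{n ≥ 1} a_n z^n` (the sum starts at `n = 1`, whence the shift). -/
def seriesF (z : ℝ) : ℝ := ∑' n : ℕ, coeffA (n + 1) * z ^ (n + 1)

theorem coeffA_succ_bounds (n : ℕ) :
    (0.19 : ℝ) ≤ coeffA (n + 1) ∧ coeffA (n + 1) ≤ ((n + 1 : ℕ) : ℝ) := by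
  set m : ℝ := ((n + 1 : ℕ) : ℝ) with hm
  have hm1 : (1 : ℝ) ≤ m := by rw [hm]; exact_mod_cast Nat.succ_le_succ (Nat.zero_le n)
  have hm0 : 0 < m := by linarith
  have hc : coeffA (n + 1) = m * (Real.log (m + 1) - Real.log m) + Real.log (m + 1) - 1 := by
    simp only [coeffA, ← hm]; ring
  have hq : Real.log (m + 1) - Real.log m = Real.log ((m + 1) / m) :=
    (Real.log_div (by linarith) (by linarith)).symm
  have hpos : 0 < (m + 1) / m := by positivity
  have h1 : Real.log ((m + 1) / m) ≤ (m + 1) / m - 1 := Real.log_le_sub_one_of_pos hpos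
  have h2 : 1 - ((m + 1) / m)⁻¹ ≤ Real.log ((m + 1) / m) := Real.one_sub_inv_le_log_of_pos hpos
  have h3 : Real.log (m + 1) ≤ m := by
    have := Real.log_le_sub_one_of_pos (show 0 < m + 1 by linarith)
    linarith
  have h4 : Real.log 2 ≤ Real.log (m + 1) := Real.log_le_log (by norm_num) (by linarith)
  have h5 := Real.log_two_gt_d9
  have e1 : m * ((m + 1) / m - 1) = 1 := by field_simp; ring
  have e2 : m * (1 - ((m + 1) / m)⁻¹) = 1 - 1 / (m + 1) := by field_simp; ring
  have h6 : 1 / (m + 1) ≤ 1 / 2 := by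
    apply one_div_le_one_div_of_le <;> linarith
  have g1 := mul_le_mul_of_nonneg_left h1 hm0.le
  have g2 := mul_le_mul_of_nonneg_left h2 hm0.le
  rw [e1] at g1
  rw [e2] at g2
  rw [hc, hq]
  constructor
  · norm_num at *; linarith
  · linarith

theorem seriesF_bound_summable {r : ℝ} (h0 : 0 ≤ r) (h1 : r < 1) :
    Summable fun n : ℕ => ((n + 1 : ℕ) : ℝ) * r ^ (n + 1) := by
  have h := summable_pow_mul_geometric_of_norm_lt_one (R := ℝ) 1
    (r := r) (by rw [Real.norm_eq_abs, abs_of_nonneg h0]; exact h1)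
  simp only [pow_one] at h
  exact (summable_nat_add_iff 1).2 h

theorem seriesF_summable {r : ℝ} (h0 : 0 ≤ r) (h1 : r < 1) :
    Summable fun n : ℕ => coeffA (n + 1) * r ^ (n + 1) := by
  refine Summable.of_nonneg_of_le (fun n => ?_) (fun n => ?_) (seriesF_bound_summable h0 h1)
  · have := (coeffA_succ_bounds n).1
    exact mul_nonneg (by linarith) (by positivity)
  · exact mul_le_mul_of_nonneg_right (coeffA_succ_bounds n).2 (by positivity)

theorem seriesF_strictMonoOn : StrictMonoOn seriesF (Set.Ico 0 1) := by
  intro s hs t ht hst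
  refine Summable.tsum_lt_tsum (i := 0) (fun n => ?_) ?_
    (seriesF_summable hs.1 hs.2) (seriesF_summable ht.1 ht.2)
  · have := (coeffA_succ_bounds n).1
    exact mul_le_mul_of_nonneg_left (pow_le_pow_left₀ hs.1 hst.le _) (by linarith)
  · have := (coeffA_succ_bounds 0).1
    exact mul_lt_mul_of_pos_left (by simpa using hst) (by linarith)

theorem existsUnique_rho : ∃! r : ℝ, (0 < r ∧ r < 1) ∧ seriesF r = 1 := by
  have hcont : ContinuousOn seriesF (Set.Icc 0 0.9) := by
    refine continuousOn_tsum (u := fun n : ℕ => ((n + 1 : ℕ) : ℝ) * (0.9 : ℝ) ^ (n + 1))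
      (fun n => by fun_prop) (seriesF_bound_summable (by norm_num) (by norm_num)) ?_
    intro n z hz
    have hb := coeffA_succ_bounds n
    rw [Real.norm_eq_abs, abs_of_nonneg
      (mul_nonneg (by linarith [hb.1]) (pow_nonneg hz.1 _))]
    exact mul_le_mul hb.2 (pow_le_pow_left₀ hz.1 hz.2 _) (pow_nonneg hz.1 _) (by positivity)
  have hF0 : seriesF 0 = 0 := by simp [seriesF]
  have hF9 : 1 ≤ seriesF 0.9 := by
    have hs : HasSum (fun n : ℕ => (0.19 : ℝ) * (0.9 : ℝ) ^ (n + 1)) (0.19 * 9) := by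
      have h := (hasSum_geometric_of_lt_one (r := (0.9 : ℝ)) (by norm_num)
        (by norm_num)).mul_left (0.19 * 0.9)
      have e1 : (fun n : ℕ => (0.19 : ℝ) * (0.9 : ℝ) ^ (n + 1)) =
          fun n : ℕ => 0.19 * 0.9 * (0.9 : ℝ) ^ n := by
        funext n; rw [pow_succ]; ring
      have e2 : (0.19 * 9 : ℝ) = 0.19 * 0.9 * (1 - 0.9)⁻¹ := by norm_num
      rw [e1, e2]
      exact h
    have hle : (0.19 * 9 : ℝ) ≤ seriesF 0.9 := by
      rw [← hs.tsum_eq]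
      refine Summable.tsum_le_tsum (fun n => ?_) hs.summable
        (seriesF_summable (by norm_num) (by norm_num))
      exact mul_le_mul_of_nonneg_right (coeffA_succ_bounds n).1 (by positivity)
    norm_num at hle ⊢
    linarith
  obtain ⟨r, hr, hr1⟩ := intermediate_value_Icc (show (0 : ℝ) ≤ 0.9 by norm_num) hcont
    (show (1 : ℝ) ∈ Set.Icc (seriesF 0) (seriesF 0.9) from ⟨by rw [hF0]; norm_num, hF9⟩)
  have hrpos : 0 < r := by
    rcases hr.1.lt_or_eq with h | h
    · exact h
    · rw [← h, hF0] at hr1; norm_num at hr1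
  have hrlt : r < 1 := lt_of_le_of_lt hr.2 (by norm_num)
  refine ⟨r, ⟨⟨hrpos, hrlt⟩, hr1⟩, ?_⟩
  rintro s ⟨⟨hs0, hs1⟩, hs⟩
  exact seriesF_strictMonoOn.injOn ⟨hs0.le, hs1⟩ ⟨hrpos.le, hrlt⟩ (hs.trans hr1.symm)

/-- `ρ`: the unique number in `(0, 1)` with `F(ρ) = 1`. -/
def rho : ℝ := existsUnique_rho.choose

/-- `C = 1 / (2 |log ρ|)`. -/
def constC : ℝ := 1 / (2 * |Real.log rho|)

/-! ### Parameters depending on `x` -/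

/-- `L_0(x) = ⌊2C(log_3 x - log_4 x)⌋`. -/
def L0 (x : ℝ) : ℤ := ⌊2 * constC * (iterLog 3 x - iterLog 4 x)⌋

/-- `L = ⌊L_0(x) - 2 √(log_3 x)⌋`; this is positive for large `x`, the only case of interest. -/
def paramL (x : ℝ) : ℕ := ⌊(L0 x : ℝ) - 2 * Real.sqrt (iterLog 3 x)⌋₊

/-- `ξ_i = 1 + 1 / (10 (L_0 - i)^3)`. -/
def xi (x : ℝ) (i : ℕ) : ℝ := 1 + 1 / (10 * ((L0 x : ℝ) - (i : ℝ)) ^ 3)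

/-- `S = exp((log_2 x)^36)`. -/
def paramS (x : ℝ) : ℝ := Real.exp (iterLog 2 x ^ 36)

/-- `ω = (log_2 x)^(-1/2 + ε/2)`. -/
def omega (ε x : ℝ) : ℝ := iterLog 2 x ^ (-(1 / 2 : ℝ) + ε / 2)

/-! ### Prime factors -/

/-- `P⁺(n)`: the largest prime factor of `n`, with `P⁺(1) = 1`. -/
def largestPrime (n : ℕ) : ℕ := max 1 (n.primeFactors.sup id)

/-- `Ω(n)`: the number of prime factors of `n` counted with multiplicity. -/
def bigOmega (n : ℕ) : ℕ := n.primeFactorsList.length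

open Classical in
/-- `Ω(n, U, T)`: the number of prime factors `p` of `n` with `U < p ≤ T`, with multiplicity. -/
def bigOmegaBetween (n : ℕ) (U T : ℝ) : ℕ :=
  ∑ p ∈ n.primeFactors.filter (fun p : ℕ => U < (p : ℝ) ∧ (p : ℝ) ≤ T), n.factorization p

/-- `p_i(n)`, where `n = p_0(n) p_1(n) p_2(n) ⋯` with `p_0(n) ≥ p_1(n) ≥ p_2(n) ≥ ⋯` primes.
The value for `i ≥ Ω(n)` is set to `1` (an empty factor). -/
def primeAt (n i : ℕ) : ℕ := n.primeFactorsList.reverse.getD i 1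

/-- `x_i(n; x)`: equal to `log_2 p_i(n) / log_2 x` if `i < Ω(n)` and `p_i(n) > 2`, else `0`. -/
def xCoord (x : ℝ) (n i : ℕ) : ℝ :=
  if i < bigOmega n ∧ 2 < primeAt n i then iterLog 2 (primeAt n i : ℝ) / iterLog 2 x else 0

/-- `m` is squarefull: every prime dividing `m` divides it at least twice. -/
def Squarefull (m : ℕ) : Prop := ∀ p : ℕ, p.Prime → p ∣ m → p ^ 2 ∣ m

/-- `d ∥ n`: `d` is a unitary divisor of `n`. -/
def UnitaryDvd (d n : ℕ) : Prop := d ∣ n ∧ Nat.Coprime d (n / d)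

/-- The prime `p` is `S`-normal. -/
def SNormal (S : ℝ) (p : ℕ) : Prop :=
  ∀ f : ℕ → ℕ, f = phi ∨ f = sigma →
    (bigOmegaBetween (f p) 1 S : ℝ) ≤ 2 * iterLog 2 S ∧
    ∀ U T : ℝ, S ≤ U → U < T → T ≤ (f p : ℝ) →
      |(bigOmegaBetween (f p) U T : ℝ) - (iterLog 2 T - iterLog 2 U)| <
        Real.sqrt (iterLog 2 S * iterLog 2 T)

/-- `(z_1, …, z_L) ∈ 𝒮_L(ξ)`. Only the coordinates `z_1, …, z_L` of the sequence `z` and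
`ξ_0, …, ξ_{L-2}` of `ξ` matter. -/
structure InSimplex (L : ℕ) (ξ z : ℕ → ℝ) : Prop where
  last_nonneg : 0 ≤ z L
  antitone : ∀ i : ℕ, 1 ≤ i → i < L → z (i + 1) ≤ z i
  first_le_one : z 1 ≤ 1
  ineq_zero : ∑ j ∈ Finset.Icc 1 L, coeffA j * z j ≤ ξ 0
  ineq : ∀ i : ℕ, 1 ≤ i → i + 2 ≤ L →
    ∑ j ∈ Finset.Icc 1 (L - i), coeffA j * z (i + j) ≤ ξ i * z i

/-- Membership of the positive integer `n` in the set `𝒜_f` (for given `ε` and `x`):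
`f(n) ≤ x` together with the conditions (0)–(8). -/
structure IsGood (f : ℕ → ℕ) (ε x : ℝ) (n : ℕ) : Prop where
  pos : 0 < n
  value_le : (f n : ℝ) ≤ x
  cond0 : x / Real.log x ≤ (n : ℝ)
  cond1 : ∀ m : ℕ, Squarefull m → m ∣ n ∨ m ∣ f n → (m : ℝ) ≤ Real.log x ^ 2
  cond2 : ∀ p : ℕ, p.Prime → p ∣ n → SNormal (paramS x) p
  cond3 : (bigOmega (f n) : ℝ) ≤ 10 * iterLog 2 x ∧ (bigOmega n : ℝ) ≤ 10 * iterLog 2 x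
  cond4 : ∀ d : ℕ, UnitaryDvd d n → Real.exp (iterLog 2 x ^ (1 / 2 : ℝ)) ≤ (d : ℝ) →
    (bigOmega (f d) : ℝ) ≤ 10 * iterLog 2 (f d : ℝ)
  cond5 : InSimplex (paramL x) (xi x) (xCoord x n)
  /-- At least `L + 1` odd prime divisors, counted with multiplicity. -/
  cond6 : paramL x + 1 ≤ (n.primeFactorsList.filter (fun p => p ≠ 2)).length
  cond7 : x ^ (1 / iterLog 2 x) ≤ (largestPrime (f (primeAt n 0)) : ℝ) ∧
    (primeAt n 1 : ℝ) < x ^ (1 / (100 * iterLog 2 x))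
  cond8 : ∑ i ∈ Finset.Icc 1 (paramL x), coeffA i * xCoord x n i ≤ 1 - omega ε x

/-- The set `𝒜_f` attached to `ε` and `x`. -/
def setA (f : ℕ → ℕ) (ε x : ℝ) : Set ℕ := {n : ℕ | IsGood f ε x n}

/-- The number of distinct values `φ(a)` with `φ(a) = σ(a')`, `(a, a') ∈ 𝒜_φ × 𝒜_σ`. -/
def commonCount (ε x : ℝ) : ℕ :=
  Set.ncard {v : ℕ | ∃ a ∈ setA phi ε x, ∃ a' ∈ setA sigma ε x, phi a = sigma a' ∧ v = phi a}

end

end CommonValues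

namespace CommonValues

open Finset

/-! ### Mertens-type estimates -/

/-! Put X = log_2 x, Y = √X and w = exp exp Y. A common value v = φ(a) = σ(a') is factored twice:
into the numbers F_i = p_i(a) - 1 (the rows) and into the numbers G_j = p_j(a') + 1 (the columns),
i, j < L, each time up to a factor all of whose primes are at most w. Indeed condition (5) forces
log_2 p_L < Y, so later primes give only values at most w, and repeated primes are tiny by (1). Also
by (1), no square of a prime above w divides v. Hence every prime r > w dividing v lies in exactly
one row and one column, and v is encoded by a matrix of sets of primes together with its w-smooth
part. By normality and (4) the smooth part has O(Y log² X) prime factors, so its distribution among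
rows and columns costs only exp(O(Y log³ X)).

The sizes of the F_i and G_j are recorded on a coarse scale: F_i has level ℓ_i when log_2 F_i lies
in (ℓ_i Y, (ℓ_i + 1)Y]. There are at most (Y + 1)^(2L) = exp(O(log² X)) pairs of level vectors, so
one pair may be fixed. The primes above w are then summed over in three groups.

(a) The largest prime r_0 of v sits in row 0 and column 0. With its cofactors fixed, r_0, A r_0 + 1
and B r_0 - 1 are all prime, and Brun's pure sieve saves e^(-3X) up to a power of X.

(b) The tops: the largest primes of the other rows and columns of level at least 2. They are chosen
in increasing order, so that the cofactor is already known when a top is chosen; primality of A r +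
1 or B r - 1 then saves exp(ℓ_i Y) or exp(ℓ'_j Y), or both if r is the top of a row and of a column.

(c) The bulk. A prime r can be placed in AB positions, where A rows and B columns reach r, and the
unrestricted sum exp(∑ AB/r) would be too large. But normality limits the number of primes of each
row below each level, and summation by parts gives ∑_r log A(r) ≤ Y ∑ ℓ_k (a_k + 1) + error; the
constants a_k appear because a_k + 1 is the increment of k log k. Rankin's trick with exponent 1/2
therefore replaces AB by √(AB) ≤ (A + B)/2, and ∑_r A(r)/r is Y ∑ ℓ_i + O(L) by Mertens.

With s = Y ∑_{i ≥ 1} ℓ_i, the exponent contributed by one side is -s + (s + Y ∑ a_i ℓ_i)/2 + (ℓ_0 Y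
+ s)/2. The quantity s cancels, and (8) bounds the rest by X - Xω/2 up to errors. Two sides together
with e^(-3X) give x exp(-X - Xω + O(Y log³ X)). Since Xω = Y X^(ε/2), the error is absorbed, which
proves (ii); (i) follows because V_φ(x) is at least the number of primes up to x.

The argument is carried by `sieve_count` and `sieve_harmonic` (sieve), `sum_log_reach_le`
(normality), `exists_decomposition` (the encoding), `sum_bulk_le`, `sum_tops_le` and `card_topOK_le`
(the three groups), `eventually_last_le` (the simplex) and `level_exponent_le` (the cancellation).
-/

theorem sum_log_div_prime_le {N : ℕ} (hN : 1 ≤ N) :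
    ∑ p ∈ (N + 1).primesBelow, Real.log p / p ≤ Real.log N + Real.log 4 := by
  have hN0 : (0 : ℝ) < N := by exact_mod_cast hN
  have h1 : Real.log (N.factorial : ℝ) ≤ N * Real.log N := by
    rw [← Real.log_pow]
    refine Real.log_le_log (by exact_mod_cast N.factorial_pos) ?_
    exact_mod_cast N.factorial_le_pow
  have h2 : ∑ p ∈ (N + 1).primesBelow, ((N / p : ℕ) : ℝ) * Real.log p
      ≤ Real.log (N.factorial : ℝ) := by
    rw [Real.log_nat_eq_sum_factorization, Finsupp.sum]
    refine le_trans (Finset.sum_le_sum (fun p hp => ?_))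
      (Finset.sum_le_sum_of_subset_of_nonneg (f := fun p : ℕ =>
        ((N.factorial.factorization p : ℕ) : ℝ) * Real.log p) ?_ ?_)
    · have hpp := Nat.prime_of_mem_primesBelow hp
      refine mul_le_mul_of_nonneg_right ?_ (Real.log_natCast_nonneg p)
      rw [Nat.factorization_factorial hpp (b := Nat.log p N + 1) (Nat.lt_succ_self _)]
      have hle : p ≤ N := Nat.lt_succ_iff.1 (Nat.lt_of_mem_primesBelow hp)
      have hlog : 1 ≤ Nat.log p N := Nat.log_pos hpp.one_lt hle
      have := Finset.single_le_sum (f := fun i => N / p ^ i) (fun i _ => Nat.zero_le _)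
        (show 1 ∈ Finset.Ico 1 (Nat.log p N + 1) from Finset.mem_Ico.2 ⟨le_rfl, by omega⟩)
      simp only [pow_one] at this
      exact_mod_cast this
    · intro p hp
      have hpp := Nat.prime_of_mem_primesBelow hp
      rw [Nat.support_factorization, Nat.mem_primeFactors]
      exact ⟨hpp, (hpp.dvd_factorial).2 (Nat.lt_succ_iff.1 (Nat.lt_of_mem_primesBelow hp)),
        N.factorial_ne_zero⟩
    · intro p _ _
      exact mul_nonneg (Nat.cast_nonneg _) (Real.log_natCast_nonneg p)
  have h3 : ∑ p ∈ (N + 1).primesBelow, Real.log p ≤ Real.log 4 * N := by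
    have := Chebyshev.theta_le_log4_mul_x (x := N) hN0.le
    rw [Chebyshev.theta_eq_sum_primesLE_log] at this
    exact this
  -- Replacing ⌊N/p⌋ by N/p costs at most 1 per prime, hence the Chebyshev sum θ(N) ≤ N log 4 in
  -- total.
  have h4 : N * ∑ p ∈ (N + 1).primesBelow, Real.log p / p
      ≤ ∑ p ∈ (N + 1).primesBelow, ((N / p : ℕ) : ℝ) * Real.log p
        + ∑ p ∈ (N + 1).primesBelow, Real.log p := by
    rw [Finset.mul_sum, ← Finset.sum_add_distrib]
    refine Finset.sum_le_sum fun p hp => ?_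
    have hpp := Nat.prime_of_mem_primesBelow hp
    have h5 : (N : ℝ) / p ≤ ((N / p : ℕ) : ℝ) + 1 := by
      have := Nat.lt_floor_add_one ((N : ℝ) / p)
      rw [Nat.floor_div_eq_div] at this
      exact this.le
    have h6 := Real.log_natCast_nonneg p
    calc (N : ℝ) * (Real.log p / p) = (N / p) * Real.log p := by ring
      _ ≤ (((N / p : ℕ) : ℝ) + 1) * Real.log p := mul_le_mul_of_nonneg_right h5 h6
      _ = _ := by ring
  have h7 : N * ∑ p ∈ (N + 1).primesBelow, Real.log p / p
      ≤ N * (Real.log N + Real.log 4) := by nlinarith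
  exact le_of_mul_le_mul_left h7 hN0

theorem primesBelow_succ_sum (f : ℕ → ℝ) (N : ℕ) :
    ∑ p ∈ (N + 1).primesBelow, f p
      = ∑ p ∈ N.primesBelow, f p + if N.Prime then f N else 0 := by
  rw [Nat.primesBelow_succ]
  split_ifs with h
  · rw [Finset.sum_insert (Nat.notMem_primesBelow N), add_comm]
  · simp

theorem log_log_succ_sub {n : ℕ} (hn : 2 ≤ n) :
    Real.log n * (1 / Real.log n - 1 / Real.log ((n + 1 : ℕ) : ℝ))
      ≤ Real.log (Real.log ((n + 1 : ℕ) : ℝ)) - Real.log (Real.log n) := by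
  have h1 : 0 < Real.log n := Real.log_pos (by exact_mod_cast hn)
  have h2 : 0 < Real.log ((n + 1 : ℕ) : ℝ) := Real.log_pos (by exact_mod_cast (by omega : 1 < n + 1))
  rw [← Real.log_div h2.ne' h1.ne']
  have := Real.one_sub_inv_le_log_of_pos (div_pos h2 h1)
  refine le_trans (le_of_eq ?_) this
  field_simp

/-- Partial summation in the form of an induction. A new prime n + 1 cancels between the two terms
on the left, so a step only changes the factor 1 / log N; the bound for ∑ log p / p then splits into
a part controlled by `log_log_succ_sub` and a telescoping one. -/
theorem sum_inv_prime_sub_le (N : ℕ) (hN : 2 ≤ N) :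
    ∑ p ∈ (N + 1).primesBelow, (1 : ℝ) / p
      - (∑ p ∈ (N + 1).primesBelow, Real.log p / p) / Real.log N
      ≤ Real.log (Real.log N) - Real.log (Real.log 2)
        + Real.log 4 * (1 / Real.log 2 - 1 / Real.log N) := by
  induction N, hN using Nat.le_induction with
  | base =>
    have h2 : (2 + 1).primesBelow = {2} := by decide
    have := Real.log_pos (show (1 : ℝ) < 2 by norm_num)
    rw [h2]
    simp
    field_simp
    linarith
  | succ n hn ih =>
    have h1 : 0 < Real.log n := Real.log_pos (by exact_mod_cast hn)
    have h2 : 0 < Real.log ((n + 1 : ℕ) : ℝ) :=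
      Real.log_pos (by exact_mod_cast (by omega : 1 < n + 1))
    have h12 : Real.log n ≤ Real.log ((n + 1 : ℕ) : ℝ) :=
      Real.log_le_log (by exact_mod_cast (by omega : 0 < n)) (by exact_mod_cast n.le_succ)
    have hS := sum_log_div_prime_le (show 1 ≤ n by omega)
    have hd : 0 ≤ 1 / Real.log n - 1 / Real.log ((n + 1 : ℕ) : ℝ) :=
      sub_nonneg.2 (one_div_le_one_div_of_le h1 h12)
    have hm := mul_le_mul_of_nonneg_right hS hd
    have hl := log_log_succ_sub hn
    have hstep : ∑ p ∈ (n + 1 + 1).primesBelow, (1 : ℝ) / p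
      - (∑ p ∈ (n + 1 + 1).primesBelow, Real.log p / p) / Real.log ((n + 1 : ℕ) : ℝ)
      = ∑ p ∈ (n + 1).primesBelow, (1 : ℝ) / p
      - (∑ p ∈ (n + 1).primesBelow, Real.log p / p) / Real.log ((n + 1 : ℕ) : ℝ) := by
      rw [primesBelow_succ_sum (fun p => (1 : ℝ) / p), primesBelow_succ_sum (fun p => Real.log p / p)]
      split_ifs with h
      · field_simp
        ring
      · simp
    rw [hstep]
    have e1 : ∀ s : ℝ, s / Real.log n - s / Real.log ((n + 1 : ℕ) : ℝ)
      = s * (1 / Real.log n - 1 / Real.log ((n + 1 : ℕ) : ℝ)) := fun s => by ring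
    have e2 := e1 (∑ p ∈ (n + 1).primesBelow, Real.log p / p)
    have e3 : (Real.log n + Real.log 4) * (1 / Real.log n - 1 / Real.log ((n + 1 : ℕ) : ℝ))
      = Real.log n * (1 / Real.log n - 1 / Real.log ((n + 1 : ℕ) : ℝ))
        + Real.log 4 * (1 / Real.log n - 1 / Real.log ((n + 1 : ℕ) : ℝ)) := by ring
    have e4 : Real.log 4 * (1 / Real.log 2 - 1 / Real.log ((n + 1 : ℕ) : ℝ))
      = Real.log 4 * (1 / Real.log 2 - 1 / Real.log n)
        + Real.log 4 * (1 / Real.log n - 1 / Real.log ((n + 1 : ℕ) : ℝ)) := by ring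
    linarith

theorem sum_inv_prime_le {N : ℕ} (hN : 2 ≤ N) :
    ∑ p ∈ (N + 1).primesBelow, (1 : ℝ) / p ≤ Real.log (Real.log N) + 6 := by
  have h := sum_inv_prime_sub_le N hN
  have hl2 := Real.log_two_gt_d9
  have hl2' := Real.log_two_lt_d9
  have hN2 : (2 : ℝ) ≤ N := by exact_mod_cast hN
  have hlog : Real.log 2 ≤ Real.log N := Real.log_le_log (by norm_num) hN2
  have hpos : 0 < Real.log N := by linarith
  have h4 : Real.log 4 = 2 * Real.log 2 := by
    rw [show (4 : ℝ) = 2 ^ 2 by norm_num, Real.log_pow]; norm_num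
  have hS := sum_log_div_prime_le (show 1 ≤ N by omega)
  have hS' : (∑ p ∈ (N + 1).primesBelow, Real.log p / p) / Real.log N
      ≤ 1 + Real.log 4 / Real.log N := by
    rw [div_le_iff₀ hpos]
    have : (1 + Real.log 4 / Real.log N) * Real.log N = Real.log N + Real.log 4 := by
      field_simp
    linarith
  have h5 : -Real.log (Real.log 2) ≤ 1 := by
    have := Real.one_sub_inv_le_log_of_pos (show 0 < Real.log 2 by linarith)
    have h6 : (Real.log 2)⁻¹ ≤ 2 := by
      rw [inv_le_comm₀ (by linarith) (by norm_num)]; norm_num; linarith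
    linarith
  have e : Real.log 4 * (1 / Real.log 2 - 1 / Real.log N) = 2 - Real.log 4 / Real.log N := by
    rw [h4]
    have : Real.log 2 ≠ 0 := by linarith
    field_simp
  linarith

theorem neg_log_one_sub_inv_le {p : ℕ} (hp : 2 ≤ p) :
    (1 - (p : ℝ)⁻¹)⁻¹ ≤ Real.exp (1 / p + 1 / ((p : ℝ) * (p - 1))) := by
  have hp' : (2 : ℝ) ≤ p := by exact_mod_cast hp
  have h1 : (1 - (p : ℝ)⁻¹)⁻¹ = 1 + 1 / ((p : ℝ) - 1) := by
    have : (p : ℝ) - 1 ≠ 0 := by linarith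
    field_simp
    ring
  have h2 : (1 : ℝ) / p + 1 / ((p : ℝ) * (p - 1)) = 1 / ((p : ℝ) - 1) := by
    have : (p : ℝ) - 1 ≠ 0 := by linarith
    field_simp
    ring
  rw [h1, h2, add_comm]
  exact Real.add_one_le_exp _

theorem sum_inv_mul_pred_le (N : ℕ) :
    ∑ p ∈ (N + 1).primesBelow, (1 : ℝ) / ((p : ℝ) * (p - 1)) ≤ 1 := by
  have h : ∀ N : ℕ, ∑ p ∈ (N + 2).primesBelow, (1 : ℝ) / ((p : ℝ) * (p - 1))
      ≤ 1 - 1 / ((N : ℝ) + 1) := by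
    intro N
    induction N with
    | zero =>
      have : (0 + 2).primesBelow = ∅ := by decide
      rw [this]; simp
    | succ n ih =>
      rw [primesBelow_succ_sum (fun p : ℕ => (1 : ℝ) / ((p : ℝ) * (p - 1)))]
      have e : (1 : ℝ) / (((n + 2 : ℕ) : ℝ) * (((n + 2 : ℕ) : ℝ) - 1))
          = 1 / ((n : ℝ) + 1) - 1 / ((n : ℝ) + 2) := by
        push_cast
        have : (n : ℝ) + 2 - 1 = n + 1 := by ring
        rw [this]
        field_simp
        ring
      have e' : (1 : ℝ) / ((n : ℝ) + 2) ≤ 1 / ((n : ℝ) + 1) :=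
        one_div_le_one_div_of_le (by positivity) (by linarith)
      have hc : ((n + 1 : ℕ) : ℝ) + 1 = n + 2 := by push_cast; ring
      rw [hc]
      have hi : (if (n + 2).Prime then (1 : ℝ) / (((n + 2 : ℕ) : ℝ) * (((n + 2 : ℕ) : ℝ) - 1)) else 0)
          ≤ 1 / ((n : ℝ) + 1) - 1 / ((n : ℝ) + 2) := by
        split_ifs
        · exact e.le
        · linarith
      linarith
  rcases N with _ | n
  · have : (0 + 1).primesBelow = ∅ := by decide
    rw [this]; simp
  · have := h n
    have h0 : (0 : ℝ) < 1 / ((n : ℝ) + 1) := by positivity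
    linarith

theorem prod_one_sub_inv_inv_le (N : ℕ) :
    ∏ p ∈ (N + 1).primesBelow, (1 - (p : ℝ)⁻¹)⁻¹
      ≤ Real.exp (∑ p ∈ (N + 1).primesBelow, (1 : ℝ) / p + 1) := by
  have h : ∏ p ∈ (N + 1).primesBelow, (1 - (p : ℝ)⁻¹)⁻¹
      ≤ ∏ p ∈ (N + 1).primesBelow, Real.exp (1 / p + 1 / ((p : ℝ) * (p - 1))) := by
    refine Finset.prod_le_prod (fun p hp => ?_) fun p hp => ?_
    · have hp' : (2 : ℝ) ≤ p := by exact_mod_cast (Nat.prime_of_mem_primesBelow hp).two_le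
      have : (p : ℝ)⁻¹ ≤ 1 := inv_le_one_of_one_le₀ (by linarith)
      exact inv_nonneg.2 (by linarith)
    · exact neg_log_one_sub_inv_le (Nat.prime_of_mem_primesBelow hp).two_le
  refine h.trans ?_
  rw [← Real.exp_sum, Finset.sum_add_distrib]
  exact Real.exp_le_exp.2 (by linarith [sum_inv_mul_pred_le N])

/-- The completely multiplicative function `n ↦ 1 / n`. -/
noncomputable def invHom : ℕ →* ℝ where
  toFun n := (n : ℝ)⁻¹
  map_one' := by simp
  map_mul' m n := by simp [mul_comm]

/-- Euler product over the primes up to N. It serves twice: for the lower Mertens bound and for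
summing over the smooth parts of common values. -/
theorem sum_smooth_inv_le (N : ℕ) (s : Finset ℕ) (hs : ∀ n ∈ s, n ∈ (N + 1).smoothNumbers) :
    ∑ n ∈ s, (1 : ℝ) / n ≤ Real.exp (∑ p ∈ (N + 1).primesBelow, (1 : ℝ) / p + 1) := by
  have h := EulerProduct.summable_and_hasSum_smoothNumbers_prod_primesBelow_geometric
    (f := invHom) (fun {p} hp => by
      have : (1 : ℝ) < p := by exact_mod_cast hp.one_lt
      show ‖(p : ℝ)⁻¹‖ < 1
      rw [norm_inv, Real.norm_natCast]
      exact inv_lt_one_of_one_lt₀ this) (N + 1)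
  refine le_trans ?_ (prod_one_sub_inv_inv_le N)
  have h2 := sum_le_hasSum (s.subtype (· ∈ (N + 1).smoothNumbers))
    (fun i _ => (by show (0 : ℝ) ≤ ((i : ℕ) : ℝ)⁻¹; positivity)) h.2
  refine le_trans (le_of_eq ?_) h2
  rw [Finset.sum_subtype_of_mem (f := fun n => invHom n) hs]
  simp [invHom]

/-- Every n ≤ N is N-smooth, so log N is at most the harmonic sum and hence at most the Euler
product. -/
theorem le_sum_inv_prime {N : ℕ} (hN : 1 ≤ N) :
    Real.log (Real.log N) - 1 ≤ ∑ p ∈ (N + 1).primesBelow, (1 : ℝ) / p := by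
  have h := sum_smooth_inv_le N (Finset.Icc 1 N) (fun n hn => by
    rw [Finset.mem_Icc] at hn
    exact Nat.mem_smoothNumbers_of_lt (by omega) (by omega))
  have h2 : Real.log N ≤ ∑ n ∈ Finset.Icc 1 N, (1 : ℝ) / n := by
    have h3 := log_add_one_le_harmonic N
    have h4 : Real.log N ≤ Real.log ((N : ℝ) + 1) :=
      Real.log_le_log (by exact_mod_cast hN) (by linarith)
    refine h4.trans ?_
    rw [harmonic_eq_sum_Icc] at h3
    push_cast at h3
    simpa using h3
  rcases (Real.log_natCast_nonneg N).eq_or_lt with h0 | h0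
  · rw [← h0, Real.log_zero]
    have : 0 ≤ ∑ p ∈ (N + 1).primesBelow, (1 : ℝ) / p := Finset.sum_nonneg fun p _ => by positivity
    linarith
  · have := Real.log_le_log h0 (h2.trans h)
    rw [Real.log_exp] at this
    linarith

end CommonValues


namespace CommonValues

open Finset

/-! ### Brun's pure sieve -/

/-- Bonferroni's inequality: for nonempty B the alternating sum of binomial coefficients stopped at
an even index equals C(|B| - 1, 2m), which is nonnegative. -/
theorem one_le_truncated_alternating_sum (B : Finset ℕ) (m : ℕ) :
    (if B = ∅ then (1 : ℝ) else 0)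
      ≤ ∑ d ∈ B.powerset with d.card ≤ 2 * m, (-1 : ℝ) ^ d.card := by
  have h1 : ∑ d ∈ B.powerset with d.card ≤ 2 * m, (-1 : ℝ) ^ d.card
      = ∑ j ∈ range (2 * m + 1), (-1 : ℝ) ^ j * (B.card.choose j : ℝ) := by
    rw [← Finset.sum_fiberwise_of_maps_to (s := B.powerset.filter (fun d => d.card ≤ 2 * m))
      (t := range (2 * m + 1)) (g := Finset.card)
      (fun d hd => by rw [Finset.mem_filter] at hd; exact Finset.mem_range.2 (by omega))]
    refine Finset.sum_congr rfl fun j hj => ?_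
    rw [Finset.mem_range] at hj
    have e : (B.powerset.filter (fun d => d.card ≤ 2 * m)).filter (fun d => d.card = j)
        = B.powersetCard j := by
      ext d
      simp only [Finset.mem_filter, Finset.mem_powerset, Finset.mem_powersetCard]
      constructor
      · rintro ⟨⟨a, _⟩, c⟩; exact ⟨a, c⟩
      · rintro ⟨a, c⟩; exact ⟨⟨a, by omega⟩, c⟩
    rw [e, Finset.sum_congr rfl (g := fun _ => (-1 : ℝ) ^ j)
      (fun d hd => by rw [(Finset.mem_powersetCard.1 hd).2]), Finset.sum_const,
      Finset.card_powersetCard, nsmul_eq_mul, mul_comm]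
  rw [h1]
  rcases Nat.eq_zero_or_pos B.card with h0 | h0
  · rw [h0, Finset.sum_range_succ']
    simp
    split_ifs <;> norm_num
  · have hB : B ≠ ∅ := by rintro rfl; simp at h0
    rw [if_neg hB]
    obtain ⟨n, hn⟩ := Nat.exists_eq_succ_of_ne_zero h0.ne'
    have := Int.alternating_sum_range_choose_eq_choose (n := n) (m := 2 * m)
    rw [hn]
    have h2 : ∑ j ∈ range (2 * m + 1), (-1 : ℝ) ^ j * ((n + 1).choose j : ℝ)
        = (-1) ^ (2 * m) * (n.choose (2 * m) : ℝ) := by exact_mod_cast this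
    rw [Nat.succ_eq_add_one, h2, pow_mul]
    simp

theorem sum_pow_card_le (P : Finset ℕ) (κ M : ℕ) :
    ∑ d ∈ P.powerset with d.card ≤ M, (κ : ℝ) ^ d.card ≤ (κ * P.card + 1 : ℝ) ^ M := by
  have h1 : ∑ d ∈ P.powerset with d.card ≤ M, (κ : ℝ) ^ d.card
      = ∑ j ∈ range (M + 1), (P.card.choose j : ℝ) * (κ : ℝ) ^ j := by
    rw [← Finset.sum_fiberwise_of_maps_to (s := P.powerset.filter (fun d => d.card ≤ M))
      (t := range (M + 1)) (g := Finset.card)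
      (fun d hd => by rw [Finset.mem_filter] at hd; exact Finset.mem_range.2 (by omega))]
    refine Finset.sum_congr rfl fun j hj => ?_
    rw [Finset.mem_range] at hj
    have e : (P.powerset.filter (fun d => d.card ≤ M)).filter (fun d => d.card = j)
        = P.powersetCard j := by
      ext d
      simp only [Finset.mem_filter, Finset.mem_powerset, Finset.mem_powersetCard]
      constructor
      · rintro ⟨⟨a, _⟩, c⟩; exact ⟨a, c⟩
      · rintro ⟨a, c⟩; exact ⟨⟨a, by omega⟩, c⟩
    rw [e, Finset.sum_congr rfl (g := fun _ => (κ : ℝ) ^ j)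
      (fun d hd => by rw [(Finset.mem_powersetCard.1 hd).2]), Finset.sum_const,
      Finset.card_powersetCard, nsmul_eq_mul]
  rw [h1, add_pow]
  refine Finset.sum_le_sum fun j hj => ?_
  rw [Finset.mem_range] at hj
  have h2 : (P.card.choose j : ℝ) ≤ (P.card : ℝ) ^ j := by exact_mod_cast Nat.choose_le_pow _ _
  have h3 : (1 : ℝ) ≤ (M.choose j : ℝ) := by
    exact_mod_cast Nat.choose_pos (by omega)
  rw [one_pow, mul_one, mul_pow]
  have h4 : (0 : ℝ) ≤ (κ : ℝ) ^ j := by positivity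
  have h5 : (0 : ℝ) ≤ (P.card : ℝ) ^ j := by positivity
  calc (P.card.choose j : ℝ) * (κ : ℝ) ^ j ≤ (P.card : ℝ) ^ j * (κ : ℝ) ^ j :=
        mul_le_mul_of_nonneg_right h2 h4
    _ = (κ : ℝ) ^ j * (P.card : ℝ) ^ j * 1 := by ring
    _ ≤ _ := mul_le_mul_of_nonneg_left h3 (by positivity)

/-- The complete alternating sum is ∏ (1 - g p), which gives the first exponential. The discarded
sets have more than 2m elements, and inserting the factor exp(|d| - 2m) ≥ 1 turns their sum into a
product, which gives the second. -/
theorem truncated_main_le (P : Finset ℕ) (g : ℕ → ℝ) (h0 : ∀ p ∈ P, 0 ≤ g p)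
    (h1 : ∀ p ∈ P, g p ≤ 1) (m : ℕ) :
    ∑ d ∈ P.powerset with d.card ≤ 2 * m, (-1 : ℝ) ^ d.card * ∏ p ∈ d, g p
      ≤ Real.exp (-∑ p ∈ P, g p) + Real.exp (Real.exp 1 * ∑ p ∈ P, g p - 2 * m) := by
  have hg : ∀ d ∈ P.powerset, 0 ≤ ∏ p ∈ d, g p := fun d hd =>
    Finset.prod_nonneg fun p hp => h0 p (Finset.mem_powerset.1 hd hp)
  have hfull : ∑ d ∈ P.powerset, (-1 : ℝ) ^ d.card * ∏ p ∈ d, g p = ∏ p ∈ P, (1 - g p) := by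
    have := Finset.prod_one_add (f := fun p => -g p) P
    simp only [← sub_eq_add_neg] at this
    rw [this]
    refine Finset.sum_congr rfl fun d _ => ?_
    rw [Finset.prod_neg]
  have hprod : ∏ p ∈ P, (1 - g p) ≤ Real.exp (-∑ p ∈ P, g p) := by
    rw [← Finset.sum_neg_distrib, Real.exp_sum]
    refine Finset.prod_le_prod (fun p hp => by linarith [h1 p hp]) fun p hp => ?_
    have := Real.add_one_le_exp (-g p)
    linarith
  have hsplit := Finset.sum_filter_add_sum_filter_not P.powerset (fun d => d.card ≤ 2 * m)
    (fun d => (-1 : ℝ) ^ d.card * ∏ p ∈ d, g p)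
  have htail : -∑ d ∈ P.powerset with ¬ d.card ≤ 2 * m, (-1 : ℝ) ^ d.card * ∏ p ∈ d, g p
      ≤ Real.exp (Real.exp 1 * ∑ p ∈ P, g p - 2 * m) := by
    have h2 : -∑ d ∈ P.powerset with ¬ d.card ≤ 2 * m, (-1 : ℝ) ^ d.card * ∏ p ∈ d, g p
        ≤ ∑ d ∈ P.powerset, Real.exp (-(2 * m : ℝ)) * ∏ p ∈ d, (Real.exp 1 * g p) := by
      rw [← Finset.sum_neg_distrib]
      refine le_trans (Finset.sum_le_sum (g := fun d =>
        Real.exp (-(2 * m : ℝ)) * ∏ p ∈ d, (Real.exp 1 * g p)) fun d hd => ?_)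
        (Finset.sum_le_sum_of_subset_of_nonneg (Finset.filter_subset _ _) fun d hd _ => ?_)
      · rw [Finset.mem_filter] at hd
        have hgd := hg d hd.1
        have ha : -((-1 : ℝ) ^ d.card * ∏ p ∈ d, g p) ≤ ∏ p ∈ d, g p := by
          rcases neg_one_pow_eq_or ℝ d.card with h | h <;> rw [h] <;> linarith
        refine ha.trans ?_
        rw [Finset.prod_mul_distrib, Finset.prod_const, ← Real.exp_nat_mul, ← mul_assoc,
          ← Real.exp_add]
        refine le_mul_of_one_le_left hgd (Real.one_le_exp ?_)
        have : (2 * m : ℝ) ≤ (d.card : ℝ) := by exact_mod_cast (not_le.1 hd.2).le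
        linarith
      · have := hg d hd
        rw [Finset.prod_mul_distrib, Finset.prod_const]
        positivity
    refine h2.trans ?_
    rw [← Finset.mul_sum, ← Finset.prod_one_add]
    rw [sub_eq_neg_add, Real.exp_add, Finset.mul_sum, Real.exp_sum]
    refine mul_le_mul_of_nonneg_left (Finset.prod_le_prod (fun p hp => ?_) fun p _ => ?_)
      (Real.exp_pos _).le
    · have := h0 p hp
      positivity
    · rw [add_comm]
      exact Real.add_one_le_exp _
  linarith

theorem brun_pure_sieve (I P : Finset ℕ) (bad : ℕ → ℕ → Prop) [∀ p n, Decidable (bad p n)]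
    (g : ℕ → ℝ) (N : ℝ) (hN : 0 ≤ N) (κ m : ℕ) (h0 : ∀ p ∈ P, 0 ≤ g p) (h1 : ∀ p ∈ P, g p ≤ 1)
    (hcount : ∀ d ⊆ P, |((I.filter fun n => ∀ p ∈ d, bad p n).card : ℝ) - N * ∏ p ∈ d, g p|
      ≤ (κ : ℝ) ^ d.card) :
    ((I.filter fun n => ∀ p ∈ P, ¬ bad p n).card : ℝ)
      ≤ N * (Real.exp (-∑ p ∈ P, g p) + Real.exp (Real.exp 1 * ∑ p ∈ P, g p - 2 * m))
        + (κ * P.card + 1 : ℝ) ^ (2 * m) := by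
  have hstep : ((I.filter fun n => ∀ p ∈ P, ¬ bad p n).card : ℝ)
      ≤ ∑ d ∈ P.powerset with d.card ≤ 2 * m,
          (-1 : ℝ) ^ d.card * ((I.filter fun n => ∀ p ∈ d, bad p n).card : ℝ) := by
    have e1 : ((I.filter fun n => ∀ p ∈ P, ¬ bad p n).card : ℝ)
        = ∑ n ∈ I, if P.filter (bad · n) = ∅ then (1 : ℝ) else 0 := by
      rw [Finset.card_filter]
      push_cast
      refine Finset.sum_congr rfl fun n _ => ?_
      simp only [Finset.filter_eq_empty_iff]
    have e2 : ∀ d ∈ P.powerset.filter (fun d => d.card ≤ 2 * m),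
        (-1 : ℝ) ^ d.card * ((I.filter fun n => ∀ p ∈ d, bad p n).card : ℝ)
        = ∑ n ∈ I, if ∀ p ∈ d, bad p n then (-1 : ℝ) ^ d.card else 0 := by
      intro d _
      rw [Finset.card_filter]
      push_cast
      rw [Finset.mul_sum]
      refine Finset.sum_congr rfl fun n _ => ?_
      split_ifs <;> simp
    rw [e1, Finset.sum_congr rfl e2, Finset.sum_comm]
    refine Finset.sum_le_sum fun n _ => ?_
    refine (one_le_truncated_alternating_sum _ m).trans (le_of_eq ?_)
    rw [← Finset.sum_filter]
    refine Finset.sum_congr ?_ fun _ _ => rfl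
    ext d
    simp only [Finset.mem_filter, Finset.mem_powerset, Finset.subset_iff]
    constructor
    · rintro ⟨h, hc⟩
      exact ⟨⟨fun p hp => (h hp).1, hc⟩, fun p hp => (h hp).2⟩
    · rintro ⟨⟨h, hc⟩, hb⟩
      exact ⟨fun p hp => ⟨h hp, hb p hp⟩, hc⟩
  refine hstep.trans ?_
  have h2 : ∀ d ∈ P.powerset.filter (fun d => d.card ≤ 2 * m),
      (-1 : ℝ) ^ d.card * ((I.filter fun n => ∀ p ∈ d, bad p n).card : ℝ)
      ≤ N * ((-1 : ℝ) ^ d.card * ∏ p ∈ d, g p) + (κ : ℝ) ^ d.card := by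
    intro d hd
    have := abs_le.1 (hcount d (Finset.mem_powerset.1 (Finset.mem_filter.1 hd).1))
    rcases neg_one_pow_eq_or ℝ d.card with h | h <;> rw [h] <;> linarith [this.1, this.2]
  refine (Finset.sum_le_sum h2).trans ?_
  rw [Finset.sum_add_distrib, ← Finset.mul_sum]
  exact add_le_add (mul_le_mul_of_nonneg_left (truncated_main_le P g h0 h1 m) hN)
    (sum_pow_card_le P κ (2 * m))

/-! ### Residue classes avoided by linear forms -/

theorem abs_count_modEq_sub_le (N q r : ℕ) (hq : 0 < q) :
    |(((range N).filter fun n => n ≡ r [MOD q]).card : ℝ) - N / q| ≤ 1 := by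
  have h := Nat.count_modEq_card N hq r
  rw [Nat.count_eq_card_filter_range] at h
  rw [h]
  have hq' : (0 : ℝ) < q := by exact_mod_cast hq
  have h2 : (N : ℝ) / q = ((N / q : ℕ) : ℝ) + ((N % q : ℕ) : ℝ) / q := by
    rw [div_eq_iff hq'.ne', add_mul, div_mul_cancel₀ _ hq'.ne']
    have := Nat.div_add_mod N q
    rw [mul_comm] at this
    exact_mod_cast this.symm
  have h3 : ((N % q : ℕ) : ℝ) / q < 1 := by
    rw [div_lt_one hq']; exact_mod_cast Nat.mod_lt N hq
  have h4 : 0 ≤ ((N % q : ℕ) : ℝ) / q := by positivity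
  rw [h2, abs_le]
  push_cast
  split_ifs with hc
  · constructor <;> linarith
  · constructor <;> linarith

theorem exists_root_mod {p : ℕ} (hp : p.Prime) {a : ℤ} (b : ℤ) (ha : ¬ (p : ℤ) ∣ a) :
    ∃ c : ℕ, ∀ n : ℕ, (p : ℤ) ∣ a * n + b ↔ n ≡ c [MOD p] := by
  have := Fact.mk hp
  have ha' : (a : ZMod p) ≠ 0 := fun h => ha ((ZMod.intCast_zmod_eq_zero_iff_dvd a p).1 h)
  refine ⟨((-(b : ZMod p)) / a).val, fun n => ?_⟩
  rw [← ZMod.intCast_zmod_eq_zero_iff_dvd, ← ZMod.natCast_eq_natCast_iff, ZMod.natCast_val,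
    ZMod.cast_id', id, eq_div_iff ha']
  push_cast
  rw [mul_comm, ← eq_neg_iff_add_eq_zero]

/-- `p` divides one of the values `a_s n + b_s`. -/
def HitsForm {ι : Type} (a b : ι → ℤ) (p n : ℕ) : Prop := ∃ s, (p : ℤ) ∣ a s * n + b s

-- Induction on d with a residue class mod q carried along. Hitting p splits the class, by the
-- Chinese remainder theorem, into one class mod qp for each form; these are disjoint because p does
-- not divide a_s b_t - a_t b_s. Each final class is counted with error at most 1, and there are
-- κ^|d| of them, κ being the number of forms.
open Classical in
theorem abs_count_hitsForm_sub_le {ι : Type} [Fintype ι] (a b : ι → ℤ) (N : ℕ)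
    (d : Finset ℕ) (hprime : ∀ p ∈ d, p.Prime) (ha : ∀ p ∈ d, ∀ s, ¬ (p : ℤ) ∣ a s)
    (hab : ∀ p ∈ d, ∀ s t, s ≠ t → ¬ (p : ℤ) ∣ a s * b t - a t * b s)
    (q r : ℕ) (hq : 0 < q) (hcop : ∀ p ∈ d, q.Coprime p) :
    |(((range N).filter fun n => n ≡ r [MOD q] ∧ ∀ p ∈ d, HitsForm a b p n).card : ℝ)
      - N / q * ∏ p ∈ d, (Fintype.card ι : ℝ) / p| ≤ (Fintype.card ι : ℝ) ^ d.card := by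
  induction d using Finset.induction_on generalizing q r with
  | empty => simpa using abs_count_modEq_sub_le N q r hq
  | insert p d hpd ih =>
    have hp : p.Prime := hprime p (Finset.mem_insert_self _ _)
    choose c hc using fun s => exists_root_mod hp (b s) (ha p (Finset.mem_insert_self _ _) s)
    have hqp : q.Coprime p := hcop p (Finset.mem_insert_self _ _)
    have ih' := fun s => ih (fun p' h => hprime p' (Finset.mem_insert_of_mem h))
      (fun p' h => ha p' (Finset.mem_insert_of_mem h))
      (fun p' h => hab p' (Finset.mem_insert_of_mem h)) (q * p)
      (Nat.chineseRemainder hqp r (c s)) (Nat.mul_pos hq hp.pos)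
      (fun p' h => Nat.Coprime.mul_left (hcop p' (Finset.mem_insert_of_mem h))
        ((Nat.coprime_primes hp (hprime p' (Finset.mem_insert_of_mem h))).2
          (fun e => hpd (e ▸ h))))
    have hsplit : ((range N).filter fun n => n ≡ r [MOD q] ∧ ∀ p' ∈ insert p d, HitsForm a b p' n)
        = Finset.univ.biUnion fun s : ι => (range N).filter fun n =>
          n ≡ (Nat.chineseRemainder hqp r (c s) : ℕ) [MOD (q * p)] ∧ ∀ p' ∈ d, HitsForm a b p' n := by
      ext n
      have key : ∀ s, n ≡ (Nat.chineseRemainder hqp r (c s) : ℕ) [MOD (q * p)] ↔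
          n ≡ r [MOD q] ∧ (p : ℤ) ∣ a s * n + b s := by
        intro s
        have h2 := (Nat.chineseRemainder hqp r (c s)).2
        rw [← Nat.modEq_and_modEq_iff_modEq_mul hqp, hc s]
        exact ⟨fun h => ⟨h.1.trans h2.1, h.2.trans h2.2⟩,
          fun h => ⟨h.1.trans h2.1.symm, h.2.trans h2.2.symm⟩⟩
      simp only [Finset.mem_filter, Finset.mem_biUnion, Finset.mem_univ, true_and,
        Finset.forall_mem_insert, key]
      constructor
      · rintro ⟨hn, h1, ⟨s, hs⟩, h3⟩
        exact ⟨s, hn, ⟨h1, hs⟩, h3⟩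
      · rintro ⟨s, hn, ⟨h1, hs⟩, h3⟩
        exact ⟨hn, h1, ⟨s, hs⟩, h3⟩
    have hdisj : (↑(Finset.univ : Finset ι) : Set ι).PairwiseDisjoint fun s : ι =>
        (range N).filter fun n => n ≡ (Nat.chineseRemainder hqp r (c s) : ℕ) [MOD (q * p)] ∧
          ∀ p' ∈ d, HitsForm a b p' n := by
      intro s _ t _ hst
      refine Finset.disjoint_left.2 fun n hs ht => ?_
      have h1 := (Finset.mem_filter.1 hs).2.1
      have h2 := (Finset.mem_filter.1 ht).2.1
      have key : ∀ s, n ≡ (Nat.chineseRemainder hqp r (c s) : ℕ) [MOD (q * p)] →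
          (p : ℤ) ∣ a s * n + b s := by
        intro s h
        rw [hc s]
        exact ((Nat.modEq_and_modEq_iff_modEq_mul hqp).2 h).2.trans
          (Nat.chineseRemainder hqp r (c s)).2.2
      refine hab p (Finset.mem_insert_self _ _) s t hst ?_
      have e : a s * b t - a t * b s = a s * (a t * n + b t) - a t * (a s * n + b s) := by ring
      rw [e]
      exact dvd_sub ((key t h2).mul_left _) ((key s h1).mul_left _)
    rw [hsplit, Finset.card_biUnion hdisj, Finset.prod_insert hpd, Finset.card_insert_of_notMem hpd]
    push_cast
    have e : (N : ℝ) / q * ((Fintype.card ι : ℝ) / p * ∏ p ∈ d, (Fintype.card ι : ℝ) / p)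
        = ∑ _s : ι, (N : ℝ) / ((q * p : ℕ) : ℝ) * ∏ p ∈ d, (Fintype.card ι : ℝ) / p := by
      rw [Finset.sum_const, Finset.card_univ, nsmul_eq_mul]
      push_cast
      have : (p : ℝ) ≠ 0 := by exact_mod_cast hp.ne_zero
      have : (q : ℝ) ≠ 0 := by exact_mod_cast hq.ne'
      field_simp
    rw [e, ← Finset.sum_sub_distrib]
    refine (Finset.abs_sum_le_sum_abs _ _).trans ((Finset.sum_le_sum fun s _ => ih' s).trans ?_)
    rw [Finset.sum_const, Finset.card_univ, nsmul_eq_mul, pow_succ, mul_comm]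

end CommonValues


/-! ### The sieve bound for linear forms with very large coefficients -/

namespace CommonValues

open Finset

/-- Primes up to Z are bounded by Mertens, whatever E is. For p > Z one has 1/p ≤ 2 log p / Z, and
the logarithms of the prime factors of E add up to at most log E. -/
theorem sum_inv_primeFactors_le {E Z : ℕ} (hE : E ≠ 0) (hZ : 2 ≤ Z) :
    ∑ p ∈ E.primeFactors, (1 : ℝ) / p
      ≤ Real.log (Real.log Z) + 6 + 2 * Real.log E / Z := by
  have hZ0 : (0 : ℝ) < Z := by exact_mod_cast (by omega : 0 < Z)
  rw [← Finset.sum_filter_add_sum_filter_not E.primeFactors (fun p => p ≤ Z)]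
  refine add_le_add ?_ ?_
  · refine le_trans (Finset.sum_le_sum_of_subset_of_nonneg (fun p hp => ?_)
      fun p _ _ => by positivity) (sum_inv_prime_le hZ)
    rw [Finset.mem_filter] at hp
    exact Nat.mem_primesBelow.2 ⟨by omega, Nat.prime_of_mem_primeFactors hp.1⟩
  · have h1 : ∑ p ∈ E.primeFactors with ¬ p ≤ Z, (1 : ℝ) / p
        ≤ ∑ p ∈ E.primeFactors, 2 * Real.log p / Z := by
      refine le_trans (Finset.sum_le_sum (g := fun p : ℕ => 2 * Real.log p / Z) fun p hp => ?_)
        (Finset.sum_le_sum_of_subset_of_nonneg (Finset.filter_subset _ _) fun p _ _ => ?_)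
      · rw [Finset.mem_filter] at hp
        have hpp := Nat.prime_of_mem_primeFactors hp.1
        have hl : Real.log 2 ≤ Real.log p :=
          Real.log_le_log (by norm_num) (by exact_mod_cast hpp.two_le)
        have := Real.log_two_gt_d9
        have hZp : (Z : ℝ) ≤ p := by exact_mod_cast (not_le.1 hp.2).le
        exact div_le_div₀ (by linarith) (by linarith) hZ0 hZp
      · have := Real.log_natCast_nonneg p
        positivity
    refine h1.trans ?_
    rw [← Finset.sum_div, ← Finset.mul_sum]
    refine div_le_div_of_nonneg_right (mul_le_mul_of_nonneg_left ?_ (by norm_num)) hZ0.le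
    rw [← Real.log_prod (fun p hp => by
      exact_mod_cast (Nat.prime_of_mem_primeFactors hp).ne_zero)]
    refine Real.log_le_log ?_ ?_
    · exact Finset.prod_pos fun p hp => by
        exact_mod_cast (Nat.prime_of_mem_primeFactors hp).pos
    · rw [← Nat.cast_prod]
      exact_mod_cast Nat.le_of_dvd (Nat.pos_of_ne_zero hE) (Nat.prod_primeFactors_dvd E)

/-- A nonzero integer divisible by the primes for which the forms `a_s n + b_s` do not have
`κ` distinct roots. -/
def formDiscr {κ : ℕ} (a b : Fin κ → ℤ) : ℕ :=
  6 * ((∏ s, (a s).natAbs) *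
    ∏ s, ∏ t, if s = t then 1 else (a s * b t - a t * b s).natAbs)

theorem formDiscr_ne_zero {κ : ℕ} {a b : Fin κ → ℤ} (ha : ∀ s, a s ≠ 0)
    (hab : ∀ s t, s ≠ t → a s * b t - a t * b s ≠ 0) : formDiscr a b ≠ 0 := by
  refine mul_ne_zero (by norm_num) (mul_ne_zero (Finset.prod_ne_zero_iff.2 fun s _ => ?_)
    (Finset.prod_ne_zero_iff.2 fun s _ => Finset.prod_ne_zero_iff.2 fun t _ => ?_))
  · exact Int.natAbs_ne_zero.2 (ha s)
  · split_ifs with h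
    · exact one_ne_zero
    · exact Int.natAbs_ne_zero.2 (hab s t h)

theorem log_formDiscr_le {κ : ℕ} (hκ : κ ≤ 3) {a b : Fin κ → ℤ} {U : ℝ} (hU : 1 ≤ U)
    (ha : ∀ s, a s ≠ 0) (hab : ∀ s t, s ≠ t → a s * b t - a t * b s ≠ 0)
    (ha' : ∀ s, |(a s : ℝ)| ≤ Real.exp U) (hb' : ∀ s, |(b s : ℝ)| ≤ Real.exp U) :
    Real.log (formDiscr a b) ≤ 35 * U := by
  have hκ' : (κ : ℝ) ≤ 3 := by exact_mod_cast hκ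
  have h0 : formDiscr a b ≠ 0 := formDiscr_ne_zero ha hab
  have hl6 : Real.log 6 ≤ 5 := by
    have := Real.log_le_sub_one_of_pos (show (0 : ℝ) < 6 by norm_num)
    linarith
  have hA : ∀ s, Real.log ((a s).natAbs : ℝ) ≤ U := by
    intro s
    rw [Nat.cast_natAbs, Int.cast_abs]
    refine (Real.log_le_log (abs_pos.2 (by exact_mod_cast ha s)) (ha' s)).trans ?_
    rw [Real.log_exp]
  have hD : ∀ s t, Real.log (((if s = t then 1 else (a s * b t - a t * b s).natAbs : ℕ)) : ℝ)
      ≤ 3 * U := by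
    intro s t
    split_ifs with h
    · simp; linarith
    · rw [Nat.cast_natAbs, Int.cast_abs]
      have h1 : |((a s * b t - a t * b s : ℤ) : ℝ)| ≤ Real.exp (3 * U) := by
        push_cast
        have e : Real.exp (3 * U) = Real.exp U * (Real.exp U * Real.exp U) := by
          rw [← Real.exp_add, ← Real.exp_add]; ring_nf
        have hE2 : 2 ≤ Real.exp U := by linarith [Real.add_one_le_exp U]
        have h2 := mul_le_mul (ha' s) (hb' t) (abs_nonneg _) (Real.exp_pos U).le
        have h3 := mul_le_mul (ha' t) (hb' s) (abs_nonneg _) (Real.exp_pos U).le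
        rw [← abs_mul] at h2 h3
        have h4 := abs_sub (a s * b t : ℝ) (a t * b s)
        have h5 := mul_le_mul_of_nonneg_right hE2
          (mul_nonneg (Real.exp_pos U).le (Real.exp_pos U).le)
        rw [e]
        linarith
      refine (Real.log_le_log (abs_pos.2 (by exact_mod_cast hab s t h)) h1).trans ?_
      rw [Real.log_exp]
  have hprod0 : ∀ s, (a s).natAbs ≠ 0 := fun s => Int.natAbs_ne_zero.2 (ha s)
  have hpair0 : ∀ s t, (if s = t then 1 else (a s * b t - a t * b s).natAbs) ≠ 0 := by
    intro s t
    split_ifs with h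
    · exact one_ne_zero
    · exact Int.natAbs_ne_zero.2 (hab s t h)
  have e1 : Real.log (formDiscr a b) = Real.log 6 + (∑ s, Real.log ((a s).natAbs : ℝ)
      + ∑ s, ∑ t, Real.log (((if s = t then 1 else (a s * b t - a t * b s).natAbs : ℕ)) : ℝ)) := by
    have hp1 : ((∏ s, (a s).natAbs : ℕ) : ℝ) ≠ 0 := by
      exact_mod_cast Finset.prod_ne_zero_iff.2 fun s _ => hprod0 s
    have hp2 : ((∏ s, ∏ t, (if s = t then 1 else (a s * b t - a t * b s).natAbs) : ℕ) : ℝ) ≠ 0 := by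
      exact_mod_cast Finset.prod_ne_zero_iff.2 fun s _ =>
        Finset.prod_ne_zero_iff.2 fun t _ => hpair0 s t
    rw [formDiscr, Nat.cast_mul, Nat.cast_mul, Real.log_mul (by norm_num) (mul_ne_zero hp1 hp2),
      Real.log_mul hp1 hp2, Nat.cast_prod, Nat.cast_prod, Real.log_prod, Real.log_prod]
    · congr 2
      refine Finset.sum_congr rfl fun s _ => ?_
      rw [Nat.cast_prod, Real.log_prod]
      exact fun t _ => by exact_mod_cast hpair0 s t
    · exact fun s _ => by
        exact_mod_cast Finset.prod_ne_zero_iff.2 fun t _ => hpair0 s t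
    · exact fun s _ => by exact_mod_cast hprod0 s
  have h1 : ∑ s, Real.log ((a s).natAbs : ℝ) ≤ κ * U := by
    refine (Finset.sum_le_sum fun s _ => hA s).trans ?_
    simp
  have h2 : ∑ s, ∑ t, Real.log (((if s = t then 1 else (a s * b t - a t * b s).natAbs : ℕ)) : ℝ)
      ≤ κ * (κ * (3 * U)) := by
    refine (Finset.sum_le_sum fun s _ => Finset.sum_le_sum fun t _ => hD s t).trans ?_
    simp
  have h3 : (κ : ℝ) * U ≤ 3 * U := mul_le_mul_of_nonneg_right hκ' (by linarith)
  have h4 : (κ : ℝ) * (κ * (3 * U)) ≤ 3 * (3 * (3 * U)) := by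
    have : (0:ℝ) ≤ κ := Nat.cast_nonneg _
    gcongr
  rw [e1]
  linarith

/-- The size conditions on the parameter `X = log log x` under which the sieve bounds hold. -/
structure SieveRange (X : ℝ) : Prop where
  large : 101 ≤ X
  exp_le : Real.exp 77 * 400 ≤ X
  exp_sqrt : 1000 * X ≤ Real.exp (Real.sqrt X)

theorem eventually_sieveRange : ∀ᶠ X : ℝ in atTop, SieveRange X := by
  have h1 : Tendsto (fun X : ℝ => Real.exp (Real.sqrt X) / Real.sqrt X ^ 2) atTop atTop :=
    (Real.tendsto_exp_div_pow_atTop 2).comp Real.tendsto_sqrt_atTop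
  filter_upwards [eventually_ge_atTop 101, eventually_ge_atTop (Real.exp 77 * 400),
    h1.eventually_ge_atTop 1000] with X h2 h2' h3
  refine ⟨h2, h2', ?_⟩
  have hX : 0 < X := by linarith
  rwa [Real.sq_sqrt hX.le, le_div_iff₀ hX] at h3

/-- The primes excluded from the sieve cost only a factor O(X), although the coefficients may be as
large as exp(exp X): the choice Z = ⌈exp X⌉ makes log E / Z bounded and log log Z about log X. -/
theorem one_div_discr_sum_le {X : ℝ} (hX : SieveRange X) {κ : ℕ} (hκ : κ ≤ 3) {a b : Fin κ → ℤ}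
    (ha : ∀ s, a s ≠ 0) (hab : ∀ s t, s ≠ t → a s * b t - a t * b s ≠ 0)
    (ha' : ∀ s, |(a s : ℝ)| ≤ Real.exp (Real.exp X))
    (hb' : ∀ s, |(b s : ℝ)| ≤ Real.exp (Real.exp X)) :
    ∑ p ∈ (formDiscr a b).primeFactors, (1 : ℝ) / p ≤ Real.log (X + 1) + 76 := by
  have h100 : (101 : ℝ) ≤ X := hX.large
  have hU : 1 ≤ Real.exp X := Real.one_le_exp (by linarith)
  have hexp : 102 ≤ Real.exp X := by linarith [Real.add_one_le_exp X]
  have hlog := log_formDiscr_le hκ hU ha hab ha' hb'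
  set Z : ℕ := ⌈Real.exp X⌉₊ with hZ
  have hZ1 : Real.exp X ≤ Z := Nat.le_ceil _
  have hZ2 : (Z : ℝ) < Real.exp X + 1 := Nat.ceil_lt_add_one (Real.exp_pos X).le
  have hZ2' : 2 ≤ Z := by
    have : (2 : ℝ) ≤ Z := by linarith
    exact_mod_cast this
  have h := sum_inv_primeFactors_le (formDiscr_ne_zero ha hab) hZ2'
  have h1 : 2 * Real.log (formDiscr a b) / Z ≤ 70 := by
    rw [div_le_iff₀ (by linarith)]
    linarith
  have h2 : Real.log (Real.log Z) ≤ Real.log (X + 1) := by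
    have h3 : (Z : ℝ) ≤ Real.exp (X + 1) := by
      rw [Real.exp_add]
      nlinarith [Real.add_one_le_exp 1]
    have h4 : Real.log Z ≤ X + 1 := by
      rw [← Real.log_exp (X + 1)]
      exact Real.log_le_log (by linarith) h3
    refine Real.log_le_log (Real.log_pos (by linarith)) h4
  linarith

/-- The constant 77 is the 76 lost to the excluded primes plus the 1 lost in the lower Mertens
bound; t / (100 X) is the logarithm of the sifting level. The power X^4 absorbs all these losses. -/
theorem log_level_le {X t : ℝ} (hX : SieveRange X) (ht : 0 < t) :
    Real.log (t / X ^ 4) ≤ Real.log (t / (100 * X) / 2) - Real.log (X + 1) - 77 := by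
  have hX1 := hX.large
  have hX0 : 0 < X := by linarith
  have hX2 := hX.exp_le
  have h0 : Real.log (Real.exp 77) = 77 := Real.log_exp 77
  have hc : 0 < Real.exp 77 := Real.exp_pos 77
  generalize Real.exp 77 = c at *
  have e : Real.log (t / (100 * X) / 2) - Real.log (X + 1) - 77
      = Real.log (t / (100 * X) / 2 / (X + 1) / c) := by
    rw [Real.log_div (x := t / (100 * X) / 2 / (X + 1)) (by positivity) (by positivity), h0,
      Real.log_div (x := t / (100 * X) / 2) (by positivity) (by positivity)]
  rw [e]
  refine Real.log_le_log (by positivity) ?_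
  rw [div_div, div_div, div_div]
  refine div_le_div_of_nonneg_left ht.le (by positivity) ?_
  calc 100 * X * (2 * ((X + 1) * c)) = (c * 200) * (X * (X + 1)) := by ring
    _ ≤ (c * 200) * (X * (2 * X)) := by gcongr; linarith
    _ = (c * 400) * (X * X) := by ring
    _ ≤ X * (X * X) := mul_le_mul_of_nonneg_right hX2 (by positivity)
    _ = X ^ 3 * 1 := by ring
    _ ≤ X ^ 3 * X := mul_le_mul_of_nonneg_left (by linarith) (by positivity)
    _ = X ^ 4 := by ring

theorem four_le_exp_two : (4 : ℝ) ≤ Real.exp 2 := by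
  have : Real.exp 2 = Real.exp 1 * Real.exp 1 := by rw [← Real.exp_add]; norm_num
  rw [this]
  nlinarith [Real.exp_one_gt_d9]

-- Brun's pure sieve with sifting level z = exp(log R / (100 X)) and sets of at most 2m ≈ 20X
-- primes. The remainder is at most about z^(2m) ≈ R^(1/5), which is negligible, and the small z
-- loses only a power of X against the expected order y / (log R)^κ. The + 1 in the size condition
-- accommodates the form B r - 1.
set_option maxHeartbeats 1000000 in
theorem sieve_count {X : ℝ} (hX : SieveRange X) {κ : ℕ} (hκ : κ ≤ 3) {a b : Fin κ → ℤ}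
    (ha : ∀ s, a s ≠ 0) (hab : ∀ s t, s ≠ t → a s * b t - a t * b s ≠ 0)
    (ha' : ∀ s, |(a s : ℝ)| ≤ Real.exp (Real.exp X))
    (hb' : ∀ s, |(b s : ℝ)| ≤ Real.exp (Real.exp X)) {R y : ℝ}
    (hR : Real.exp (Real.exp (Real.sqrt X)) ≤ R) (hR' : R ≤ Real.exp (Real.exp X)) (hy : R ≤ y)
    (s : Finset ℕ) (hs : ∀ n ∈ s, (n : ℝ) ≤ y ∧ ∀ i, (a i * n + b i).natAbs.Prime ∧
      R ≤ ((a i * n + b i).natAbs : ℝ) + 1) :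
    (s.card : ℝ) ≤ y * X ^ 13 / Real.log R ^ κ := by
  classical
  have hX1 : (101 : ℝ) ≤ X := hX.large
  have hX0 : 0 < X := by linarith
  have hRpos : 0 < R := lt_of_lt_of_le (Real.exp_pos _) hR
  have hκ' : (κ : ℝ) ≤ 3 := by exact_mod_cast hκ
  have hκ0 : (0 : ℝ) ≤ κ := Nat.cast_nonneg _
  set t : ℝ := Real.log R with ht
  have ht1 : Real.exp (Real.sqrt X) ≤ t := by
    rw [ht, Real.le_log_iff_exp_le hRpos]; exact hR
  have ht2 : 1000 * X ≤ t := hX.exp_sqrt.trans ht1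
  have ht3 : t ≤ Real.exp X := by
    rw [ht, Real.log_le_iff_le_exp hRpos]; exact hR'
  have ht0 : 0 < t := by linarith
  have htR : Real.exp t = R := Real.exp_log hRpos
  -- the sifting level
  set τ : ℝ := t / (100 * X) with hτ
  have hτX : τ * (100 * X) = t := div_mul_cancel₀ _ (by positivity)
  have hτ10 : 10 ≤ τ := by
    rw [hτ, le_div_iff₀ (by positivity)]; linarith
  have hτt : τ * 100 ≤ t := by
    rw [← hτX]
    exact mul_le_mul_of_nonneg_left (by linarith) (by linarith)
  set z : ℝ := Real.exp τ with hz
  set n : ℕ := ⌊z⌋₊ with hn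
  have hz11 : 11 ≤ z := by linarith [Real.add_one_le_exp τ]
  have hnz : (n : ℝ) ≤ z := Nat.floor_le (by linarith)
  have hnz' : z < n + 1 := Nat.lt_floor_add_one z
  have hn10 : (10 : ℝ) ≤ n := by linarith
  have hn2 : 2 ≤ n := by
    have : (2 : ℝ) ≤ n := by linarith
    exact_mod_cast this
  have hlogn : τ / 2 ≤ Real.log n := by
    rw [Real.le_log_iff_exp_le (by linarith)]
    have e : Real.exp (τ / 2) * Real.exp (τ / 2) = z := by
      rw [← Real.exp_add]; ring_nf; rfl
    have h6 : τ / 2 + 1 ≤ Real.exp (τ / 2) := Real.add_one_le_exp _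
    have h7 := mul_le_mul_of_nonneg_right (show 2 ≤ Real.exp (τ / 2) by linarith)
      (Real.exp_pos (τ / 2)).le
    linarith
  have hlogn' : Real.log n ≤ τ := by
    rw [Real.log_le_iff_le_exp (by linarith)]; exact hnz
  set E : ℕ := formDiscr a b with hE
  have hE0 : E ≠ 0 := formDiscr_ne_zero ha hab
  set P : Finset ℕ := (n + 1).primesBelow.filter (fun p => ¬ p ∣ E) with hP
  have hPprime : ∀ p ∈ P, p.Prime := fun p hp =>
    Nat.prime_of_mem_primesBelow (Finset.mem_filter.1 hp).1
  have hPle : ∀ p ∈ P, p ≤ n := fun p hp =>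
    Nat.lt_succ_iff.1 (Nat.lt_of_mem_primesBelow (Finset.mem_filter.1 hp).1)
  have hPE : ∀ p ∈ P, ¬ p ∣ E := fun p hp => (Finset.mem_filter.1 hp).2
  -- The factor 6 in `formDiscr` removes 2 and 3 from the sieve, so that the density κ / p is at
  -- most 1 for κ ≤ 3.
  have hP5 : ∀ p ∈ P, 3 < p := by
    intro p hp
    have h1 := (hPprime p hp).two_le
    by_contra hcon
    have h2 : p = 2 ∨ p = 3 := by omega
    refine hPE p hp (Dvd.dvd.mul_right ?_ _)
    rcases h2 with h2 | h2 <;> rw [h2] <;> norm_num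
  have hPa : ∀ p ∈ P, ∀ s, ¬ (p : ℤ) ∣ a s := by
    intro p hp s hdvd
    refine hPE p hp (Dvd.dvd.mul_left (Dvd.dvd.mul_right ?_ _) _)
    exact (Int.natCast_dvd.1 hdvd).trans (Finset.dvd_prod_of_mem (fun s => (a s).natAbs)
      (Finset.mem_univ s))
  have hPab : ∀ p ∈ P, ∀ s t, s ≠ t → ¬ (p : ℤ) ∣ a s * b t - a t * b s := by
    intro p hp s t hst hdvd
    refine hPE p hp (Dvd.dvd.mul_left (Dvd.dvd.mul_left ?_ _) _)
    refine Dvd.dvd.trans ?_ (Finset.dvd_prod_of_mem (fun s => ∏ t, if s = t then 1 else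
      (a s * b t - a t * b s).natAbs) (Finset.mem_univ s))
    refine Dvd.dvd.trans ?_ (Finset.dvd_prod_of_mem (fun t => if s = t then 1 else
      (a s * b t - a t * b s).natAbs) (Finset.mem_univ t))
    rw [if_neg hst]
    exact Int.natCast_dvd.1 hdvd
  -- the sieve
  set m : ℕ := ⌈10 * X⌉₊ with hm
  have hm1 : 10 * X ≤ m := Nat.le_ceil _
  have hm2 : (m : ℝ) < 10 * X + 1 := Nat.ceil_lt_add_one (by linarith)
  set N : ℕ := ⌊y⌋₊ + 1 with hN
  have hR1 : 1 ≤ R := by rw [← htR]; exact Real.one_le_exp ht0.le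
  have hy1 : 1 ≤ y := hR1.trans hy
  have hNy : (N : ℝ) ≤ 2 * y := by
    rw [hN]; push_cast
    linarith [Nat.floor_le (show 0 ≤ y by linarith)]
  have hcount := brun_pure_sieve (range N) P (HitsForm a b) (fun p => (κ : ℝ) / p) N
    (Nat.cast_nonneg _) κ m (fun p _ => by positivity) (fun p hp => by
      have h3 : (3 : ℝ) < p := by exact_mod_cast hP5 p hp
      rw [div_le_one (by linarith)]; linarith) (fun d hd => by
      have := abs_count_hitsForm_sub_le a b N d (fun p hp => hPprime p (hd hp))
        (fun p hp => hPa p (hd hp)) (fun p hp => hPab p (hd hp)) 1 0 one_pos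
        (fun p _ => Nat.coprime_one_left p)
      simpa [Nat.modEq_one] using this)
  have hsub : s ⊆ (range N).filter fun n => ∀ p ∈ P, ¬ HitsForm a b p n := by
    intro k hk
    obtain ⟨hk1, hk2⟩ := hs k hk
    rw [Finset.mem_filter, Finset.mem_range, hN, Nat.lt_succ_iff]
    refine ⟨Nat.le_floor hk1, ?_⟩
    rintro p hp ⟨i, hi⟩
    obtain ⟨h1, h2⟩ := hk2 i
    have h3 := (Nat.prime_dvd_prime_iff_eq (hPprime p hp) h1).1 (Int.natCast_dvd.1 hi)
    rw [← h3] at h2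
    have h4 : (p : ℝ) ≤ n := by exact_mod_cast hPle p hp
    -- A prime value divisible by p equals p ≤ z, whereas the values are at least R - 1 ≥ z² - 1 >
    -- z.
    have h5 : z * z ≤ R := by
      rw [← htR, hz, ← Real.exp_add]
      exact Real.exp_le_exp.2 (by linarith)
    have h6 := mul_le_mul_of_nonneg_right hz11 (show 0 ≤ z by linarith)
    linarith
  have hcard : (s.card : ℝ) ≤ _ := (Nat.cast_le.2 (Finset.card_le_card hsub)).trans hcount
  -- estimates
  set σ : ℝ := ∑ p ∈ P, (κ : ℝ) / p with hσ
  have hσe : σ = κ * ∑ p ∈ P, (1 : ℝ) / p := by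
    rw [hσ, Finset.mul_sum]
    exact Finset.sum_congr rfl fun p _ => by ring
  have hσ1 : σ ≤ 4 * X := by
    have h1 : ∑ p ∈ P, (1 : ℝ) / p ≤ X + 6 := by
      refine (Finset.sum_le_sum_of_subset_of_nonneg (Finset.filter_subset _ _)
        fun p _ _ => by positivity).trans ((sum_inv_prime_le hn2).trans ?_)
      have h2 : Real.log (Real.log n) ≤ X := by
        rw [Real.log_le_iff_le_exp (by linarith)]
        linarith
      linarith
    have h3 : (κ : ℝ) * ∑ p ∈ P, (1 : ℝ) / p ≤ 3 * (X + 6) := by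
      have h4 : 0 ≤ ∑ p ∈ P, (1 : ℝ) / p := Finset.sum_nonneg fun p _ => by positivity
      exact mul_le_mul hκ' h1 h4 (by norm_num)
    rw [hσe]; linarith
  have hσ2 : Real.log (t / (X ^ 4)) ≤ ∑ p ∈ P, (1 : ℝ) / p := by
    have h1 : ∑ p ∈ (n + 1).primesBelow, (1 : ℝ) / p ≤ ∑ p ∈ P, (1 : ℝ) / p
        + ∑ p ∈ E.primeFactors, (1 : ℝ) / p := by
      rw [← Finset.sum_filter_add_sum_filter_not (n + 1).primesBelow (fun p => ¬ p ∣ E)]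
      refine add_le_add le_rfl (Finset.sum_le_sum_of_subset_of_nonneg (fun p hp => ?_)
        fun p _ _ => by positivity)
      rw [Finset.mem_filter, not_not] at hp
      exact Nat.mem_primeFactors.2 ⟨Nat.prime_of_mem_primesBelow hp.1, hp.2, hE0⟩
    have h2 := one_div_discr_sum_le hX hκ ha hab ha' hb'
    have h3 := le_sum_inv_prime (show 1 ≤ n by omega)
    have h4 : Real.log (τ / 2) ≤ Real.log (Real.log n) := Real.log_le_log (by linarith) hlogn
    have h5 := log_level_le hX ht0
    linarith
  have hexp1 : Real.exp (-σ) ≤ X ^ 12 / t ^ κ := by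
    have h1 : t / X ^ 4 ≤ Real.exp (∑ p ∈ P, (1 : ℝ) / p) :=
      (Real.log_le_iff_le_exp (by positivity)).1 hσ2
    have h2 : (t / X ^ 4) ^ κ ≤ Real.exp σ := by
      rw [hσe, Real.exp_nat_mul]
      exact pow_le_pow_left₀ (by positivity) h1 κ
    rw [Real.exp_neg]
    refine (inv_anti₀ (by positivity) h2).trans ?_
    rw [div_pow, inv_div]
    refine div_le_div_of_nonneg_right ?_ (by positivity)
    rw [← pow_mul]
    exact pow_le_pow_right₀ (by linarith) (by omega)
  have htκ : t ^ κ ≤ t ^ 3 := pow_le_pow_right₀ (by linarith) hκ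
  have hexp2 : Real.exp (Real.exp 1 * σ - 2 * m) ≤ 1 / t ^ κ := by
    have h1 : Real.exp 1 * σ - 2 * m ≤ -(3 * X) := by
      have h2 : 0 ≤ σ := Finset.sum_nonneg fun p _ => by positivity
      have h2' : Real.exp 1 * σ ≤ 3 * σ :=
        mul_le_mul_of_nonneg_right (by linarith [Real.exp_one_lt_d9]) h2
      linarith
    have h3 : t ^ 3 ≤ Real.exp (3 * X) := by
      have := pow_le_pow_left₀ ht0.le ht3 3
      rw [← Real.exp_nat_mul] at this
      exact_mod_cast this
    refine (Real.exp_le_exp.2 h1).trans ?_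
    rw [Real.exp_neg, ← one_div]
    exact one_div_le_one_div_of_le (by positivity) (htκ.trans h3)
  have herr : ((κ : ℝ) * P.card + 1) ^ (2 * m) ≤ y / t ^ κ := by
    have h1 : (P.card : ℝ) ≤ n := by
      have : P ⊆ Finset.Icc 1 n := fun p hp =>
        Finset.mem_Icc.2 ⟨(hPprime p hp).one_le, hPle p hp⟩
      have := Finset.card_le_card this
      rw [Nat.card_Icc] at this
      exact_mod_cast this
    have h2 : (κ : ℝ) * P.card + 1 ≤ Real.exp (2 + τ) := by
      have h3 : (κ : ℝ) * P.card ≤ 3 * z :=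
        mul_le_mul hκ' (h1.trans hnz) (Nat.cast_nonneg _) (by norm_num)
      have h4 := four_le_exp_two
      rw [Real.exp_add]
      have : 4 * z ≤ Real.exp 2 * z := mul_le_mul_of_nonneg_right h4 (by linarith)
      linarith
    have h5 : ((κ : ℝ) * P.card + 1) ^ (2 * m) ≤ Real.exp (t / 2) := by
      refine (pow_le_pow_left₀ (by positivity) h2 _).trans ?_
      rw [← Real.exp_nat_mul]
      refine Real.exp_le_exp.2 ?_
      push_cast
      have h6 : 2 * (m : ℝ) ≤ 20 * X + 2 := by linarith
      have h7 := mul_le_mul_of_nonneg_right h6 (show 0 ≤ 2 + τ by linarith)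
      have h8 : (20 * X + 2) * (2 + τ) = 40 * X + 4 + τ * (100 * X) / 5 + 2 * τ := by ring
      rw [h8, hτX] at h7
      linarith
    refine h5.trans ?_
    rw [le_div_iff₀ (by positivity)]
    have h8 : t ^ 3 ≤ Real.exp (t / 2) := by
      have h9 := Real.pow_div_factorial_le_exp (t / 2) (by positivity) 4
      refine le_trans ?_ h9
      have : (Nat.factorial 4 : ℝ) = 24 := by norm_num [Nat.factorial]
      rw [this, le_div_iff₀ (by norm_num)]
      have : 384 ≤ t := by linarith
      have h10 : (t / 2) ^ 4 = t ^ 3 * (t / 16) := by ring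
      rw [h10]
      exact mul_le_mul_of_nonneg_left (by linarith) (by positivity)
    calc Real.exp (t / 2) * t ^ κ ≤ Real.exp (t / 2) * Real.exp (t / 2) :=
          mul_le_mul_of_nonneg_left (htκ.trans h8) (Real.exp_pos _).le
      _ = R := by rw [← Real.exp_add, ← htR]; ring_nf
      _ ≤ y := hy
  have hX13 : 2 * (X ^ 12 + 1) + 1 ≤ X ^ 13 := by
    have h1 : (1 : ℝ) ≤ X ^ 12 := one_le_pow₀ (by linarith)
    have h2 : X ^ 13 = X * X ^ 12 := by ring
    have h3 := mul_le_mul_of_nonneg_right hX1 (show 0 ≤ X ^ 12 by linarith)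
    rw [h2]
    linarith
  have hfin : (N : ℝ) * (Real.exp (-σ) + Real.exp (Real.exp 1 * σ - 2 * m))
      ≤ 2 * y * (X ^ 12 / t ^ κ + 1 / t ^ κ) :=
    mul_le_mul hNy (add_le_add hexp1 hexp2) (by positivity) (by linarith)
  calc (s.card : ℝ) ≤ _ := hcard
    _ ≤ 2 * y * (X ^ 12 / t ^ κ + 1 / t ^ κ) + y / t ^ κ := add_le_add hfin herr
    _ = y * (2 * (X ^ 12 + 1) + 1) / t ^ κ := by ring
    _ ≤ y * X ^ 13 / t ^ κ := by
      refine div_le_div_of_nonneg_right (mul_le_mul_of_nonneg_left hX13 (by linarith)) (by positivity)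

end CommonValues


/-! ### Reciprocal sums over sieved sets -/

namespace CommonValues

open Finset

/-- Each dyadic block is counted by `sieve_count` with level max(R, 2^l) and contributes O(X^13 /
(log of that level)^κ). Summing over the blocks above R loses one power of log R. -/
theorem sieve_harmonic {X : ℝ} (hX : SieveRange X) {κ : ℕ} (hκ2 : 2 ≤ κ) (hκ : κ ≤ 3)
    {a b : Fin κ → ℤ} (ha : ∀ s, a s ≠ 0) (hab : ∀ s t, s ≠ t → a s * b t - a t * b s ≠ 0)
    (ha' : ∀ s, |(a s : ℝ)| ≤ Real.exp (Real.exp X))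
    (hb' : ∀ s, |(b s : ℝ)| ≤ Real.exp (Real.exp X)) {R : ℝ}
    (hR : Real.exp (Real.exp (Real.sqrt X)) ≤ R)
    (s : Finset ℕ) (hs : ∀ n ∈ s, R ≤ n ∧ (n : ℝ) ≤ Real.exp (Real.exp X) ∧
      ∀ i, (a i * n + b i).natAbs.Prime ∧ (n : ℝ) ≤ ((a i * n + b i).natAbs : ℝ) + 1) :
    ∑ n ∈ s, (1 : ℝ) / n ≤ X ^ 14 / Real.log R ^ (κ - 1) := by
  have hX1 := hX.large
  have hRpos : 0 < R := lt_of_lt_of_le (Real.exp_pos _) hR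
  set t : ℝ := Real.log R with ht
  have ht1 : Real.exp (Real.sqrt X) ≤ t := by
    rw [ht, Real.le_log_iff_exp_le hRpos]; exact hR
  have ht2 : 1000 * X ≤ t := hX.exp_sqrt.trans ht1
  have ht0 : 0 < t := by linarith
  obtain ⟨M, hM⟩ : ∃ M : ℕ, ∀ n ∈ s, Nat.log 2 n + 1 < M :=
    ⟨s.sup (fun n => Nat.log 2 n) + 2, fun n hn => by
      have := Finset.le_sup (f := fun n => Nat.log 2 n) hn
      omega⟩
  obtain ⟨j, hj⟩ := Nat.exists_eq_succ_of_ne_zero (Nat.ceil_pos.2 ht0).ne'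
  have hmaps : ∀ n ∈ s, Nat.log 2 n + 1 ∈ Finset.Ioo j M := by
    intro n hn
    rw [Finset.mem_Ioo]
    refine ⟨?_, hM n hn⟩
    have h1 : R ≤ (2 : ℝ) ^ (Nat.log 2 n + 1) := by
      refine (hs n hn).1.trans ?_
      exact_mod_cast (Nat.lt_pow_succ_log_self (by norm_num) n).le
    have h2 : t ≤ ((Nat.log 2 n + 1 : ℕ) : ℝ) := by
      have h3 := Real.log_le_log hRpos h1
      rw [Real.log_pow] at h3
      have h4 : Real.log 2 ≤ 1 := by linarith [Real.log_two_lt_d9]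
      exact h3.trans (mul_le_of_le_one_right (Nat.cast_nonneg _) h4)
    have := Nat.ceil_le.2 h2
    omega
  have hblock : ∀ k ∈ Finset.Ioo j M, ∑ n ∈ s with Nat.log 2 n + 1 = k, (1 : ℝ) / n
      ≤ 32 * X ^ 13 / t ^ (κ - 2) * ((k : ℝ) ^ 2)⁻¹ := by
    intro k hk
    rcases (s.filter fun n => Nat.log 2 n + 1 = k).eq_empty_or_nonempty with he | ⟨n0, hn0⟩
    · rw [he, Finset.sum_empty]; positivity
    obtain ⟨l, rfl⟩ : ∃ l, k = l + 1 := ⟨Nat.log 2 n0, (Finset.mem_filter.1 hn0).2.symm⟩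
    have hmem : ∀ n ∈ s.filter (fun n => Nat.log 2 n + 1 = l + 1),
        (2 : ℝ) ^ l ≤ n ∧ (n : ℝ) ≤ 2 ^ (l + 1) := by
      intro n hn
      rw [Finset.mem_filter] at hn
      have hl : Nat.log 2 n = l := by omega
      have hn0 : n ≠ 0 := by
        rintro rfl
        have := (hs 0 hn.1).1
        simp at this
        linarith
      constructor
      · exact_mod_cast hl ▸ Nat.pow_log_le_self 2 hn0
      · exact_mod_cast hl ▸ (Nat.lt_pow_succ_log_self (by norm_num) n).le
    have hmn := hmem n0 hn0
    have hsn := hs n0 (Finset.mem_filter.1 hn0).1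
    have hRk : R ≤ max R (2 ^ l) := le_max_left _ _
    have hcount := sieve_count hX hκ ha hab ha' hb' (R := max R (2 ^ l)) (y := 2 ^ (l + 1))
      (hR.trans hRk) (max_le (hsn.1.trans hsn.2.1) (hmn.1.trans hsn.2.1))
      (max_le (hsn.1.trans hmn.2) (hmn.1.trans hmn.2))
      (s.filter fun n => Nat.log 2 n + 1 = l + 1) (fun n hn => by
        have hsn := hs n (Finset.mem_filter.1 hn).1
        refine ⟨(hmem n hn).2, fun i => ⟨(hsn.2.2 i).1, ?_⟩⟩
        exact (max_le hsn.1 (hmem n hn).1).trans (hsn.2.2 i).2)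
    have hsum : ∑ n ∈ s with Nat.log 2 n + 1 = l + 1, (1 : ℝ) / n
        ≤ ((s.filter fun n => Nat.log 2 n + 1 = l + 1).card : ℝ) * (1 / 2 ^ l) := by
      rw [← nsmul_eq_mul]
      refine Finset.sum_le_card_nsmul _ _ _ fun n hn => ?_
      exact one_div_le_one_div_of_le (by positivity) (hmem n hn).1
    have hl1 : t ≤ Real.log (max R (2 ^ l)) := Real.log_le_log hRpos hRk
    have hl2 : ((l + 1 : ℕ) : ℝ) / 4 ≤ Real.log (max R (2 ^ l)) := by
      have h1 : (l : ℝ) * Real.log 2 ≤ Real.log (max R (2 ^ l)) := by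
        rw [← Real.log_pow]
        exact Real.log_le_log (by positivity) (le_max_right _ _)
      have h2 := Real.log_two_gt_d9
      have h3 : (l : ℝ) * (1 / 2) ≤ l * Real.log 2 :=
        mul_le_mul_of_nonneg_left (by linarith) (Nat.cast_nonneg _)
      push_cast
      by_cases h4 : (l : ℝ) ≤ 1
      · linarith
      · linarith
    -- Two of the κ logarithms are bounded below through the block index, to make the sum over
    -- blocks converge; the other κ - 2 by t = log R.
    have hden : t ^ (κ - 2) * (((l + 1 : ℕ) : ℝ) / 4) ^ 2 ≤ Real.log (max R (2 ^ l)) ^ κ := by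
      have e : κ = (κ - 2) + 2 := by omega
      conv_rhs => rw [e, pow_add]
      have h1 : 0 ≤ Real.log (max R (2 ^ l)) := by linarith
      exact mul_le_mul (pow_le_pow_left₀ ht0.le hl1 _) (pow_le_pow_left₀ (by positivity) hl2 _)
        (by positivity) (by positivity)
    have hlpos : (0 : ℝ) < ((l + 1 : ℕ) : ℝ) := by positivity
    calc _ ≤ _ := hsum
      _ ≤ (2 ^ (l + 1) * X ^ 13 / Real.log (max R (2 ^ l)) ^ κ) * (1 / 2 ^ l) :=
        mul_le_mul_of_nonneg_right hcount (by positivity)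
      _ = 2 * X ^ 13 / Real.log (max R (2 ^ l)) ^ κ := by
        rw [pow_succ]; field_simp
      _ ≤ 2 * X ^ 13 / (t ^ (κ - 2) * (((l + 1 : ℕ) : ℝ) / 4) ^ 2) :=
        div_le_div_of_nonneg_left (by positivity) (by positivity) hden
      _ = _ := by field_simp; ring
  rw [← Finset.sum_fiberwise_of_maps_to hmaps]
  refine (Finset.sum_le_sum hblock).trans ?_
  rw [← Finset.mul_sum]
  have hIoo := sum_Ioo_inv_sq_le (α := ℝ) j M
  have h2t : (2 : ℝ) / (j + 1) ≤ 2 / t := by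
    refine div_le_div_of_nonneg_left (by norm_num) ht0 ?_
    have := Nat.le_ceil t
    rw [hj] at this
    exact_mod_cast this
  calc _ ≤ 32 * X ^ 13 / t ^ (κ - 2) * (2 / t) :=
        mul_le_mul_of_nonneg_left (hIoo.trans h2t) (by positivity)
    _ = 64 * X ^ 13 / t ^ (κ - 1) := by
      have e : κ - 1 = (κ - 2) + 1 := by omega
      rw [e, pow_succ]
      field_simp
      ring
    _ ≤ X ^ 14 / t ^ (κ - 1) := by
      refine div_le_div_of_nonneg_right ?_ (by positivity)
      rw [pow_succ X 13, mul_comm]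
      exact mul_le_mul_of_nonneg_left (by linarith) (by positivity)

/-! ### Primes `r` for which `A r + 1` or `B r - 1` are prime -/

theorem natAbs_mul_add_one (A r : ℕ) : ((A : ℤ) * r + 1).natAbs = A * r + 1 := by
  have : ((A : ℤ) * r + 1) = ((A * r + 1 : ℕ) : ℤ) := by push_cast; ring
  rw [this, Int.natAbs_natCast]

theorem natAbs_mul_sub_one {B r : ℕ} (h : 1 ≤ B * r) : ((B : ℤ) * r + -1).natAbs = B * r - 1 := by
  have : ((B : ℤ) * r + -1) = ((B * r - 1 : ℕ) : ℤ) := by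
    rw [Nat.cast_sub h]; push_cast; ring
  rw [this, Int.natAbs_natCast]

theorem one_le_exp_exp (X : ℝ) : 1 ≤ Real.exp (Real.exp X) := Real.one_le_exp (Real.exp_pos _).le

theorem harmonic_add_one_le {X : ℝ} (hX : SieveRange X) {A : ℕ} (hA : 0 < A)
    (hA' : (A : ℝ) ≤ Real.exp (Real.exp X)) {R : ℝ}
    (hR : Real.exp (Real.exp (Real.sqrt X)) ≤ R) (s : Finset ℕ)
    (hs : ∀ r ∈ s, R ≤ r ∧ (r : ℝ) ≤ Real.exp (Real.exp X) ∧ r.Prime ∧ (A * r + 1).Prime) :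
    ∑ r ∈ s, (1 : ℝ) / r ≤ X ^ 14 / Real.log R := by
  have := sieve_harmonic hX (κ := 2) le_rfl (by norm_num) (a := ![1, (A : ℤ)]) (b := ![0, 1])
    (by simp [Fin.forall_fin_two]; omega) (by simp [Fin.forall_fin_two])
    (by simp [Fin.forall_fin_two]; exact ⟨(Real.exp_pos X).le, hA'⟩) (by simp [Fin.forall_fin_two]; exact
      ⟨(Real.exp_pos _).le, (Real.exp_pos X).le⟩) hR s (fun r hr => by
      obtain ⟨a, b, c, d⟩ := hs r hr
      refine ⟨a, b, ?_⟩
      have h2 : (r : ℝ) ≤ (A * r : ℕ) := by exact_mod_cast Nat.le_mul_of_pos_left r hA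
      simp only [Fin.forall_fin_two, Matrix.cons_val_zero, Matrix.cons_val_one, one_mul, add_zero,
        Int.natAbs_natCast, natAbs_mul_add_one]
      refine ⟨⟨c, by linarith⟩, d, ?_⟩
      push_cast at h2 ⊢
      linarith)
  simpa using this

theorem harmonic_sub_one_le {X : ℝ} (hX : SieveRange X) {B : ℕ} (hB : 0 < B)
    (hB' : (B : ℝ) ≤ Real.exp (Real.exp X)) {R : ℝ}
    (hR : Real.exp (Real.exp (Real.sqrt X)) ≤ R) (s : Finset ℕ)
    (hs : ∀ r ∈ s, R ≤ r ∧ (r : ℝ) ≤ Real.exp (Real.exp X) ∧ r.Prime ∧ (B * r - 1).Prime) :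
    ∑ r ∈ s, (1 : ℝ) / r ≤ X ^ 14 / Real.log R := by
  have := sieve_harmonic hX (κ := 2) le_rfl (by norm_num) (a := ![1, (B : ℤ)]) (b := ![0, -1])
    (by simp [Fin.forall_fin_two]; omega) (by simp [Fin.forall_fin_two])
    (by simp [Fin.forall_fin_two]; exact ⟨(Real.exp_pos X).le, hB'⟩) (by simp [Fin.forall_fin_two]; exact
      ⟨(Real.exp_pos _).le, (Real.exp_pos X).le⟩) hR s (fun r hr => by
      obtain ⟨a, b, c, d⟩ := hs r hr
      refine ⟨a, b, ?_⟩
      have h3 : r ≤ B * r := Nat.le_mul_of_pos_left r hB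
      have h4 : 1 ≤ B * r := c.one_le.trans h3
      have h2 : (r : ℝ) ≤ (B * r : ℕ) := by exact_mod_cast h3
      simp only [Fin.forall_fin_two, Matrix.cons_val_zero, Matrix.cons_val_one, one_mul, add_zero,
        Int.natAbs_natCast, natAbs_mul_sub_one h4]
      refine ⟨⟨c, by linarith⟩, d, ?_⟩
      rw [Nat.cast_sub h4]
      push_cast at h2 ⊢
      linarith)
  simpa using this

/-- The forms `r`, `A r + 1`, `B r - 1`. -/
theorem three_forms {X : ℝ} {A B : ℕ} (hA : 0 < A) (hB : 0 < B)
    (hA' : (A : ℝ) ≤ Real.exp (Real.exp X)) (hB' : (B : ℝ) ≤ Real.exp (Real.exp X)) :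
    (∀ s, (![1, (A : ℤ), (B : ℤ)] : Fin 3 → ℤ) s ≠ 0) ∧
    (∀ s t, s ≠ t → (![1, (A : ℤ), (B : ℤ)] : Fin 3 → ℤ) s * (![0, 1, -1] : Fin 3 → ℤ) t
      - (![1, (A : ℤ), (B : ℤ)] : Fin 3 → ℤ) t * (![0, 1, -1] : Fin 3 → ℤ) s ≠ 0) ∧
    (∀ s, |((![1, (A : ℤ), (B : ℤ)] : Fin 3 → ℤ) s : ℝ)| ≤ Real.exp (Real.exp X)) ∧
    (∀ s, |((![0, 1, -1] : Fin 3 → ℤ) s : ℝ)| ≤ Real.exp (Real.exp X)) := by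
  have h1 := one_le_exp_exp X
  have h0 := (Real.exp_pos (Real.exp X)).le
  have h2 := (Real.exp_pos X).le
  refine ⟨?_, ?_, ?_, ?_⟩
  · intro s
    fin_cases s <;> simp <;> omega
  · intro s t hst
    fin_cases s <;> fin_cases t <;> simp at hst ⊢ <;> omega
  · intro s
    fin_cases s <;> simp <;> assumption
  · intro s
    fin_cases s <;> simp <;> assumption

theorem three_forms_prime {A B r : ℕ} (hA : 0 < A) (hB : 0 < B) (hr : r.Prime)
    (h1 : (A * r + 1).Prime) (h2 : (B * r - 1).Prime) :
    ∀ i : Fin 3, ((![1, (A : ℤ), (B : ℤ)] : Fin 3 → ℤ) i * r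
        + (![0, 1, -1] : Fin 3 → ℤ) i).natAbs.Prime ∧
      (r : ℝ) ≤ (((![1, (A : ℤ), (B : ℤ)] : Fin 3 → ℤ) i * r
        + (![0, 1, -1] : Fin 3 → ℤ) i).natAbs : ℝ) + 1 := by
  have h3 : r ≤ B * r := Nat.le_mul_of_pos_left r hB
  have h4 : 1 ≤ B * r := hr.one_le.trans h3
  have h5 : r ≤ A * r := Nat.le_mul_of_pos_left r hA
  have key : ∀ n : ℕ, n.Prime → r ≤ n + 1 → n.Prime ∧ (r : ℝ) ≤ (n : ℝ) + 1 :=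
    fun n hn h => ⟨hn, by exact_mod_cast h⟩
  intro i
  fin_cases i
  · simpa using key r hr (by omega)
  · have := key _ h1 (by omega)
    rw [← natAbs_mul_add_one] at this
    simpa using this
  · have := key _ h2 (by omega)
    rw [← natAbs_mul_sub_one h4] at this
    simpa using this

theorem harmonic_add_sub_one_le {X : ℝ} (hX : SieveRange X) {A B : ℕ} (hA : 0 < A) (hB : 0 < B)
    (hA' : (A : ℝ) ≤ Real.exp (Real.exp X)) (hB' : (B : ℝ) ≤ Real.exp (Real.exp X)) {R : ℝ}
    (hR : Real.exp (Real.exp (Real.sqrt X)) ≤ R) (s : Finset ℕ)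
    (hs : ∀ r ∈ s, R ≤ r ∧ (r : ℝ) ≤ Real.exp (Real.exp X) ∧ r.Prime ∧ (A * r + 1).Prime ∧
      (B * r - 1).Prime) :
    ∑ r ∈ s, (1 : ℝ) / r ≤ X ^ 14 / Real.log R ^ 2 := by
  obtain ⟨k1, k2, k3, k4⟩ := three_forms hA hB hA' hB'
  exact sieve_harmonic hX (κ := 3) (by norm_num) le_rfl k1 k2 k3 k4 hR s (fun r hr => by
    obtain ⟨a, b, c, d, e⟩ := hs r hr
    exact ⟨a, b, three_forms_prime hA hB c d e⟩)

theorem count_add_sub_one_le {X : ℝ} (hX : SieveRange X) {A B : ℕ} (hA : 0 < A) (hB : 0 < B)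
    (hA' : (A : ℝ) ≤ Real.exp (Real.exp X)) (hB' : (B : ℝ) ≤ Real.exp (Real.exp X)) {R y : ℝ}
    (hR : Real.exp (Real.exp (Real.sqrt X)) ≤ R) (hR' : R ≤ Real.exp (Real.exp X))
    (hy : 0 ≤ y) (s : Finset ℕ)
    (hs : ∀ r ∈ s, R ≤ r ∧ (r : ℝ) ≤ y ∧ r.Prime ∧ (A * r + 1).Prime ∧ (B * r - 1).Prime) :
    (s.card : ℝ) ≤ y * X ^ 13 / Real.log R ^ 3 := by
  have hR1 : 1 ≤ R := (one_le_exp_exp _).trans hR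
  have hX1 := hX.large
  rcases s.eq_empty_or_nonempty with rfl | ⟨r0, hr0⟩
  · have := Real.log_nonneg hR1
    simp only [Finset.card_empty, Nat.cast_zero]
    positivity
  obtain ⟨k1, k2, k3, k4⟩ := three_forms hA hB hA' hB'
  exact sieve_count hX (κ := 3) le_rfl k1 k2 k3 k4 hR hR' ((hs r0 hr0).1.trans (hs r0 hr0).2.1) s
    (fun r hr => by
      obtain ⟨a, b, c, d, e⟩ := hs r hr
      exact ⟨b, fun i => ⟨(three_forms_prime hA hB c d e i).1,
        a.trans (three_forms_prime hA hB c d e i).2⟩⟩)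

end CommonValues


namespace CommonValues

open Finset

/-! ### Weighted sums over recursively restricted lists -/

section GoodLists

variable {α : Type*} [DecidableEq α]

/-- Lists of length `n` each of whose entries lies in the set determined by the entries after it. -/
def goodLists (S : List α → Finset α) : ℕ → Finset (List α)
  | 0 => {[]}
  | n + 1 => (goodLists S n).biUnion fun l => (S l).image fun t => t :: l

theorem cons_mem_goodLists {S : List α → Finset α} {n : ℕ} {t : α} {l : List α} :
    t :: l ∈ goodLists S (n + 1) ↔ l ∈ goodLists S n ∧ t ∈ S l := by
  simp only [goodLists, Finset.mem_biUnion, Finset.mem_image, List.cons.injEq]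
  constructor
  · rintro ⟨l', h1, t', h2, rfl, rfl⟩
    exact ⟨h1, h2⟩
  · rintro ⟨h1, h2⟩
    exact ⟨l, h1, t, h2, rfl, rfl⟩

/-- The head of the list is constrained only by its tail, and its weight sums to at most c whatever
the tail is, so the entries can be summed out one at a time. -/
theorem sum_goodLists_le {S : List α → Finset α} {f : α → ℝ} (hf : ∀ t, 0 ≤ f t) {c : ℝ}
    (hc : 0 ≤ c) (hS : ∀ l, ∑ t ∈ S l, f t ≤ c) (n : ℕ) :
    ∑ l ∈ goodLists S n, (l.map f).prod ≤ c ^ n := by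
  induction n with
  | zero => simp [goodLists]
  | succ n ih =>
    rw [goodLists, Finset.sum_biUnion]
    · have h1 : ∀ l ∈ goodLists S n, ∑ l' ∈ (S l).image (fun t => t :: l), (l'.map f).prod
          ≤ (l.map f).prod * c := by
        intro l _
        rw [Finset.sum_image (fun a _ b _ h => (List.cons.inj h).1)]
        simp only [List.map_cons, List.prod_cons]
        rw [← Finset.sum_mul, mul_comm]
        refine mul_le_mul_of_nonneg_left (hS l) (List.prod_nonneg fun a ha => ?_)
        obtain ⟨t, _, rfl⟩ := List.mem_map.1 ha
        exact hf t
      refine (Finset.sum_le_sum h1).trans ?_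
      rw [← Finset.sum_mul, pow_succ]
      exact mul_le_mul_of_nonneg_right ih hc
    · intro l _ l' _ hne
      refine Finset.disjoint_left.2 fun k hk hk' => hne ?_
      obtain ⟨t, _, rfl⟩ := Finset.mem_image.1 hk
      obtain ⟨t', _, h⟩ := Finset.mem_image.1 hk'
      exact (List.cons.inj h).2.symm

end GoodLists

/-! ### Smooth and rough parts -/

open Classical in
/-- The part of `n` composed of primes at most `w`. -/
noncomputable def smoothPart (w : ℝ) (n : ℕ) : ℕ :=
  ∏ p ∈ n.primeFactors with ((p : ℕ) : ℝ) ≤ w, p ^ n.factorization p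

open Classical in
/-- The primes exceeding `w` that divide `n`. -/
noncomputable def roughPrimes (w : ℝ) (n : ℕ) : Finset ℕ :=
  n.primeFactors.filter fun p => w < ((p : ℕ) : ℝ)

theorem mem_roughPrimes {w : ℝ} {n p : ℕ} :
    p ∈ roughPrimes w n ↔ p.Prime ∧ p ∣ n ∧ n ≠ 0 ∧ w < p := by
  classical
  rw [roughPrimes, Finset.mem_filter, Nat.mem_primeFactors]
  tauto

theorem smoothPart_mul_prod_roughPrimes {w : ℝ} {n : ℕ} (hn : n ≠ 0)
    (h : ∀ r : ℕ, r.Prime → w < r → ¬ r ^ 2 ∣ n) :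
    smoothPart w n * ∏ r ∈ roughPrimes w n, r = n := by
  classical
  conv_rhs => rw [← Nat.prod_factorization_pow_eq_self hn]
  rw [Finsupp.prod, Nat.support_factorization,
    ← Finset.prod_filter_mul_prod_filter_not n.primeFactors (fun p => ((p : ℕ) : ℝ) ≤ w), smoothPart]
  congr 1
  rw [roughPrimes]
  simp only [not_le]
  refine Finset.prod_congr rfl fun p hp => ?_
  rw [Finset.mem_filter] at hp
  have hpp := Nat.prime_of_mem_primeFactors hp.1
  have h1 : n.factorization p = 1 := by
    have h2 := hpp.factorization_pos_of_dvd hn (Nat.dvd_of_mem_primeFactors hp.1)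
    have h3 : ¬ 2 ≤ n.factorization p := fun h4 =>
      h p hpp hp.2 ((hpp.pow_dvd_iff_le_factorization hn).2 h4)
    omega
  rw [h1, pow_one]

theorem smoothPart_ne_zero (w : ℝ) (n : ℕ) : smoothPart w n ≠ 0 := by
  classical
  refine Finset.prod_ne_zero_iff.2 fun p hp => pow_ne_zero _ ?_
  exact (Nat.prime_of_mem_primeFactors (Finset.mem_filter.1 hp).1).ne_zero

theorem smoothPart_dvd_smoothPart (w : ℝ) {m n : ℕ} (hn : n ≠ 0) (h : m ∣ n) :
    smoothPart w m ∣ smoothPart w n := by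
  classical
  have hm : m ≠ 0 := fun h0 => hn (by rw [h0] at h; exact zero_dvd_iff.1 h)
  refine (Finset.prod_dvd_prod_of_dvd _ (fun p => p ^ n.factorization p) fun p hp => ?_).trans
    (Finset.prod_dvd_prod_of_subset _ _ _ fun p hp => ?_)
  · exact pow_dvd_pow p ((Nat.factorization_le_iff_dvd hm hn).2 h p)
  · rw [Finset.mem_filter] at hp ⊢
    exact ⟨Nat.primeFactors_mono h hn hp.1, hp.2⟩

theorem smoothPart_dvd (w : ℝ) {n : ℕ} (hn : n ≠ 0) : smoothPart w n ∣ n := by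
  classical
  conv_rhs => rw [← Nat.prod_factorization_pow_eq_self hn]
  exact Finset.prod_dvd_prod_of_subset _ _ _ (Finset.filter_subset _ _)

theorem prime_le_of_dvd_smoothPart {w : ℝ} {n p : ℕ} (hp : p.Prime) (h : p ∣ smoothPart w n) :
    (p : ℝ) ≤ w := by
  classical
  obtain ⟨q, hq, hpq⟩ := (Prime.dvd_finsetProd_iff hp.prime _).1 h
  rw [Finset.mem_filter] at hq
  have := (Nat.prime_dvd_prime_iff_eq hp (Nat.prime_of_mem_primeFactors hq.1)).1
    (hp.dvd_of_dvd_pow hpq)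
  rw [this]; exact hq.2

theorem largestPrime_spec {n : ℕ} (hn : 1 < n) :
    (largestPrime n).Prime ∧ largestPrime n ∣ n ∧ ∀ q : ℕ, q.Prime → q ∣ n → q ≤ largestPrime n := by
  have hne : n.primeFactors.Nonempty := Nat.nonempty_primeFactors.2 hn
  obtain ⟨p, hp, he⟩ := Finset.exists_mem_eq_sup n.primeFactors hne id
  have hpp := Nat.prime_of_mem_primeFactors hp
  have h1 : largestPrime n = p := by
    rw [largestPrime, he]
    exact max_eq_right hpp.one_le
  refine ⟨h1 ▸ hpp, h1 ▸ Nat.dvd_of_mem_primeFactors hp, fun q hq hqn => ?_⟩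
  exact (Finset.le_sup (f := id) (Nat.mem_primeFactors.2 ⟨hq, hqn, by omega⟩)).trans
    (le_max_right _ _)

/-! ### The scale of levels -/

/-- The level `u_t = exp exp ((t + 1) √X)`. -/
noncomputable def lev (X : ℝ) (t : ℕ) : ℝ := Real.exp (Real.exp (((t : ℝ) + 1) * Real.sqrt X))

theorem lev_mono {X : ℝ} {s t : ℕ} (h : s ≤ t) : lev X s ≤ lev X t := by
  refine Real.exp_le_exp.2 (Real.exp_le_exp.2 (mul_le_mul_of_nonneg_right ?_ (Real.sqrt_nonneg _)))
  have : (s : ℝ) ≤ t := by exact_mod_cast h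
  linarith

theorem lev_pos (X : ℝ) (t : ℕ) : 0 < lev X t := Real.exp_pos _

theorem one_lt_lev (X : ℝ) (t : ℕ) : 1 < lev X t := Real.one_lt_exp_iff.2 (Real.exp_pos _)

theorem iterLog_two (x : ℝ) : iterLog 2 x = Real.log (Real.log x) := rfl

theorem iterLog_lev (X : ℝ) (t : ℕ) : iterLog 2 (lev X t) = ((t : ℝ) + 1) * Real.sqrt X := by
  rw [iterLog_two, lev, Real.log_exp, Real.log_exp]

theorem iterLog_two_mono {x y : ℝ} (hx : 1 < x) (h : x ≤ y) : iterLog 2 x ≤ iterLog 2 y :=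
  Real.log_le_log (Real.log_pos hx) (Real.log_le_log (by linarith) h)

/-- The difference of the two Mertens bounds at u_t and u_0. The primes up to u_0 are subtracted,
whence t√X and not (t + 1)√X. -/
theorem sum_inv_prime_lev_le {X : ℝ} (hX : SieveRange X) (s : Finset ℕ) (t : ℕ)
    (hs : ∀ r ∈ s, r.Prime ∧ lev X 0 < r ∧ (r : ℝ) ≤ lev X t) :
    ∑ r ∈ s, (1 : ℝ) / r ≤ t * Real.sqrt X + 9 := by
  have hX1 := hX.large
  have h3 : 3 ≤ Real.log (lev X 0) := by
    rw [lev, Real.log_exp]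
    have := hX.exp_sqrt
    push_cast
    rw [zero_add, one_mul]
    linarith
  have h0t : lev X 0 ≤ lev X t := lev_mono (Nat.zero_le t)
  have h4 : 4 ≤ lev X 0 := by
    have := Real.add_one_le_exp (Real.log (lev X 0))
    rw [Real.exp_log (lev_pos X 0)] at this
    linarith
  set N := ⌊lev X t⌋₊ with hN
  set n := ⌊lev X 0⌋₊ with hn
  have hn1 : (n : ℝ) ≤ lev X 0 := Nat.floor_le (lev_pos X 0).le
  have hn2 : lev X 0 < n + 1 := Nat.lt_floor_add_one _
  have hn3 : (3 : ℝ) < n := by linarith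
  have hn4 : 3 < n := by exact_mod_cast hn3
  have hN1 : (N : ℝ) ≤ lev X t := Nat.floor_le (lev_pos X t).le
  have hnN : n ≤ N := Nat.floor_mono h0t
  have hup := sum_inv_prime_le (show 2 ≤ N by omega)
  have hlow := le_sum_inv_prime (show 1 ≤ n by omega)
  have hNlog : Real.log (Real.log N) ≤ (t + 1) * Real.sqrt X := by
    rw [← iterLog_lev]
    refine iterLog_two_mono ?_ hN1
    have : (n : ℝ) ≤ N := by exact_mod_cast hnN
    linarith
  have hnlog : Real.sqrt X - 1 ≤ Real.log (Real.log n) := by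
    have h5 : Real.log (lev X 0) / Real.exp 1 ≤ Real.log n := by
      have h6 : Real.log (lev X 0 / 2) ≤ Real.log n := Real.log_le_log (by linarith) (by linarith)
      rw [Real.log_div (by linarith) (by norm_num)] at h6
      have h7 := Real.log_two_lt_d9
      have h8 : Real.log (lev X 0) / Real.exp 1 ≤ Real.log (lev X 0) / 2 :=
        div_le_div_of_nonneg_left (by linarith) (by norm_num) (by linarith [Real.exp_one_gt_d9])
      linarith
    have h9 := Real.log_le_log (div_pos (by linarith) (Real.exp_pos 1)) h5
    rw [Real.log_div (by linarith) (Real.exp_pos 1).ne', Real.log_exp] at h9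
    have h10 := iterLog_lev X 0
    rw [iterLog_two] at h10
    push_cast at h10
    linarith
  have hsub : ∑ r ∈ s, (1 : ℝ) / r + ∑ p ∈ (n + 1).primesBelow, (1 : ℝ) / p
      ≤ ∑ p ∈ (N + 1).primesBelow, (1 : ℝ) / p := by
    rw [← Finset.sum_union]
    · refine Finset.sum_le_sum_of_subset_of_nonneg (fun p hp => ?_) fun p _ _ => by positivity
      rw [Nat.mem_primesBelow]
      rcases Finset.mem_union.1 hp with hp | hp
      · obtain ⟨a, b, c⟩ := hs p hp
        exact ⟨Nat.lt_succ_iff.2 (Nat.le_floor c), a⟩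
      · rw [Nat.mem_primesBelow] at hp
        exact ⟨by omega, hp.2⟩
    · refine Finset.disjoint_left.2 fun p hp hp' => ?_
      obtain ⟨a, b, c⟩ := hs p hp
      have h1 : p ≤ n := Nat.lt_succ_iff.1 (Nat.lt_of_mem_primesBelow hp')
      have h2 : (p : ℝ) ≤ n := by exact_mod_cast h1
      linarith
  linarith

/-! ### The number of rows reaching a prime -/

open Classical in
/-- The indices `i` with `r ≤ u_{ℓ_i}`. -/
noncomputable def reach (X : ℝ) {M : ℕ} (ℓ : Fin (M + 1) → ℕ) (r : ℕ) : Finset (Fin (M + 1)) :=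
  Finset.univ.filter fun i => (r : ℝ) ≤ lev X (ℓ i)

theorem eq_range_card_of_lower {s : Finset ℕ} (h : ∀ a ∈ s, ∀ b ≤ a, b ∈ s) :
    s = range s.card := by
  refine (Finset.eq_of_subset_of_card_le (fun b hb => ?_) (by simp)).symm
  rw [Finset.mem_range] at hb
  by_contra hbs
  have : s ⊆ range b := fun a ha => Finset.mem_range.2 (by
    by_contra hc
    exact hbs (h a ha b (by omega)))
  have := Finset.card_le_card this
  rw [Finset.card_range] at this
  omega

/-- Since the levels decrease, the indices reaching r form an initial segment {0, …, k - 1}, and log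
k telescopes (with log 0 = 0). Written this way, a sum over r becomes a weighted count of the primes
below each u_{ℓ_m}. -/
theorem log_card_reach (X : ℝ) {M : ℕ} {ℓ : Fin (M + 1) → ℕ} (hℓ : Antitone ℓ) (r : ℕ) :
    Real.log ((reach X ℓ r).card : ℝ)
      = ∑ m ∈ reach X ℓ r, (Real.log ((m : ℕ) + 1 : ℝ) - Real.log (m : ℕ)) := by
  have h1 : ∑ m ∈ reach X ℓ r, (Real.log ((m : ℕ) + 1 : ℝ) - Real.log (m : ℕ))
      = ∑ m ∈ (reach X ℓ r).image (fun i : Fin (M + 1) => (i : ℕ)),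
        (Real.log ((m : ℕ) + 1 : ℝ) - Real.log m) := by
    rw [Finset.sum_image (fun a _ b _ h => Fin.ext h)]
  have h2 : (reach X ℓ r).image (fun i : Fin (M + 1) => (i : ℕ)) = range (reach X ℓ r).card := by
    have hc : ((reach X ℓ r).image (fun i : Fin (M + 1) => (i : ℕ))).card = (reach X ℓ r).card :=
      Finset.card_image_of_injective _ Fin.val_injective
    rw [← hc]
    refine eq_range_card_of_lower fun a ha b hb => ?_
    obtain ⟨i, hi, rfl⟩ := Finset.mem_image.1 ha
    refine Finset.mem_image.2 ⟨⟨b, lt_of_le_of_lt hb i.2⟩, ?_, rfl⟩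
    simp only [reach, Finset.mem_filter, Finset.mem_univ, true_and] at hi ⊢
    exact hi.trans (lev_mono (hℓ (Fin.le_def.2 hb)))
  rw [h1, h2]
  have h3 := Finset.sum_range_sub (fun m : ℕ => Real.log (m : ℝ)) (reach X ℓ r).card
  push_cast at h3
  rw [h3]
  simp

/-- This is where the constants a_k enter. The terms with max(i, m) = k have total weight log k + (k
+ 1)(log(k + 1) - log k), the increment (k + 1) log(k + 1) - k log k = a_k + 1. -/
theorem sum_log_mul_max (ℓ : ℕ → ℝ) (n : ℕ) :
    ∑ m ∈ range n, ∑ i ∈ range n, (Real.log ((m : ℝ) + 1) - Real.log m) * ℓ (max i m)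
      = ∑ k ∈ range n, ℓ k * (coeffA k + 1) := by
  induction n with
  | zero => simp
  | succ n ih =>
    rw [Finset.sum_range_succ, Finset.sum_range_succ (fun k => ℓ k * (coeffA k + 1)), ← ih]
    have h1 : ∑ m ∈ range n, ∑ i ∈ range (n + 1),
        (Real.log ((m : ℝ) + 1) - Real.log m) * ℓ (max i m)
        = ∑ m ∈ range n, ∑ i ∈ range n, (Real.log ((m : ℝ) + 1) - Real.log m) * ℓ (max i m)
          + Real.log n * ℓ n := by
      have h2 := Finset.sum_range_sub (fun m : ℕ => Real.log (m : ℝ)) n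
      push_cast at h2
      rw [Real.log_zero, sub_zero] at h2
      rw [← h2, Finset.sum_mul, ← Finset.sum_add_distrib]
      refine Finset.sum_congr rfl fun m hm => ?_
      rw [Finset.mem_range] at hm
      rw [Finset.sum_range_succ, max_eq_left hm.le]
    have h3 : ∑ i ∈ range (n + 1), (Real.log ((n : ℝ) + 1) - Real.log n) * ℓ (max i n)
        = ((n : ℝ) + 1) * ((Real.log ((n : ℝ) + 1) - Real.log n) * ℓ n) := by
      rw [Finset.sum_congr rfl (g := fun _ => (Real.log ((n : ℝ) + 1) - Real.log n) * ℓ n)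
        (fun i hi => by rw [Finset.mem_range] at hi; rw [max_eq_right (by omega)])]
      simp
    rw [h1, h3, coeffA]
    ring

theorem sum_log_mul_min {M : ℕ} {ℓ : Fin (M + 1) → ℕ} (hℓ : Antitone ℓ) :
    ∑ m : Fin (M + 1), ∑ i : Fin (M + 1),
        (Real.log ((m : ℕ) + 1 : ℝ) - Real.log (m : ℕ)) * (min (ℓ i) (ℓ m) : ℕ)
      = ∑ k : Fin (M + 1), (ℓ k : ℝ) * (coeffA k + 1) := by
  set g : ℕ → ℝ := fun n => if h : n < M + 1 then (ℓ ⟨n, h⟩ : ℝ) else 0 with hg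
  have hgi : ∀ i : Fin (M + 1), g i = ℓ i := fun i => by simp only [hg]; rw [dif_pos i.2]
  have h := sum_log_mul_max g (M + 1)
  rw [← Fin.sum_univ_eq_sum_range (fun m => ∑ i ∈ range (M + 1),
    (Real.log ((m : ℝ) + 1) - Real.log m) * g (max i m)),
    ← Fin.sum_univ_eq_sum_range (fun k => g k * (coeffA k + 1))] at h
  simp only [hgi] at h
  rw [← h]
  refine Finset.sum_congr rfl fun m _ => ?_
  rw [← Fin.sum_univ_eq_sum_range (fun i => (Real.log ((m : ℝ) + 1) - Real.log (m : ℕ)) * g (max i m))]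
  refine Finset.sum_congr rfl fun i _ => ?_
  have h1 : ((max (i : ℕ) (m : ℕ) : ℕ)) = ((max i m : Fin (M + 1)) : ℕ) := by
    rcases le_total i m with h | h
    · rw [max_eq_right h, max_eq_right (Fin.le_def.1 h)]
    · rw [max_eq_left h, max_eq_left (Fin.le_def.1 h)]
  rw [h1, hgi, hℓ.map_max]

end CommonValues


namespace CommonValues

open Finset

/-! ### Factorizations attached to one side of the equation -/

/-- `F` lists the relevant values `f(p_i)`, with levels `ℓ`, of one side of a common value `v`;
`pr` expresses that `f(p)` comes from a prime. -/
structure SideData (X η : ℝ) {M : ℕ} (pr : ℕ → Prop) (ℓ : Fin (M + 1) → ℕ) (v : ℕ)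
    (F : Fin (M + 1) → ℕ) : Prop where
  pos : ∀ i, 0 < F i
  prod_dvd : ∏ i, F i ∣ v
  cover : ∀ r : ℕ, r.Prime → lev X 0 < r → r ∣ v → ∃ i, r ∣ F i
  lt_level : ∀ i, ℓ i ≠ 0 → lev X (ℓ i - 1) < F i
  le_level : ∀ i, (F i : ℝ) ≤ lev X (ℓ i)
  antitone : Antitone ℓ
  prime : ∀ i, ℓ i ≠ 0 → pr (F i)
  dens : ∀ i, ∀ T : ℝ, lev X 0 < T → T ≤ F i →
    (bigOmegaBetween (F i) (lev X 0) T : ℝ) ≤ iterLog 2 T - Real.sqrt X + η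
  top : ∀ i, 2 ≤ ℓ i → Real.log (F i) ≤ 10 * X * Real.log (largestPrime (F i))
  zero_top : Real.exp (Real.exp X / X) ≤ largestPrime (F 0)
  lt_top : ∀ i, i ≠ 0 → (F i : ℝ) < Real.exp (Real.exp X / X)

/-- Conditions on the common value `v` itself. -/
structure ValueData (X : ℝ) (Om v : ℕ) : Prop where
  pos : v ≠ 0
  le : (v : ℝ) ≤ Real.exp (Real.exp X)
  sq : ∀ r : ℕ, r.Prime → lev X 0 < r → ¬ r ^ 2 ∣ v
  smooth : (smoothPart (lev X 0) v).primeFactorsList.length ≤ Om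

namespace SideData

variable {X η : ℝ} {M Om : ℕ} {pr : ℕ → Prop} {ℓ : Fin (M + 1) → ℕ} {v : ℕ}
  {F : Fin (M + 1) → ℕ}

theorem dvd (hF : SideData X η pr ℓ v F) (i : Fin (M + 1)) : F i ∣ v :=
  (Finset.dvd_prod_of_mem F (Finset.mem_univ i)).trans hF.prod_dvd

theorem index_unique (hF : SideData X η pr ℓ v F) (hv : ValueData X Om v) {r : ℕ} (hr : r.Prime)
    (hr' : lev X 0 < r) {i j : Fin (M + 1)} (hi : r ∣ F i) (hj : r ∣ F j) : i = j := by
  by_contra hne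
  refine hv.sq r hr hr' ?_
  have h1 : ∏ k ∈ ({i, j} : Finset (Fin (M + 1))), F k ∣ ∏ k, F k :=
    Finset.prod_dvd_prod_of_subset _ _ _ (Finset.subset_univ _)
  rw [Finset.prod_pair hne] at h1
  rw [pow_two]
  exact ((mul_dvd_mul hi hj).trans h1).trans hF.prod_dvd

theorem one_lt (hF : SideData X η pr ℓ v F) {i : Fin (M + 1)} (hi : ℓ i ≠ 0) : 1 < F i := by
  have h1 := hF.lt_level i hi
  have h2 := one_lt_lev X (ℓ i - 1)
  have : (1 : ℝ) < F i := h2.trans h1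
  exact_mod_cast this

theorem exp_lt_log (hF : SideData X η pr ℓ v F) {i : Fin (M + 1)} (hi : ℓ i ≠ 0) :
    Real.exp (ℓ i * Real.sqrt X) < Real.log (F i) := by
  have h1 := Real.log_lt_log (lev_pos _ _) (hF.lt_level i hi)
  rw [lev, Real.log_exp] at h1
  rw [Nat.cast_sub (Nat.one_le_iff_ne_zero.2 hi)] at h1
  simpa using h1

theorem le_largestPrime (hF : SideData X η pr ℓ v F) (hX : SieveRange X) {i : Fin (M + 1)}
    (hi : 2 ≤ ℓ i) :
    Real.exp (Real.exp (ℓ i * Real.sqrt X) / (10 * X)) < largestPrime (F i) := by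
  have h0 : 0 < X := by linarith [hX.large]
  have h1 := hF.exp_lt_log (i := i) (by omega)
  have h2 := hF.top i hi
  have h3 : (0 : ℝ) < largestPrime (F i) := by
    exact_mod_cast lt_of_lt_of_le one_pos (le_max_left _ _)
  rw [← Real.lt_log_iff_exp_lt h3, div_lt_iff₀ (by positivity)]
  linarith

/-- The reason why tops are taken only from rows and columns of level at least 2: dividing a
logarithm by 10X costs less than one level, so such a top still exceeds u_0 and lies in the range of
the sieve. -/
theorem exp_le_of_two_le (hX : SieveRange X) {n : ℕ} (hn : 2 ≤ n) :
    Real.exp (Real.sqrt X) ≤ Real.exp (n * Real.sqrt X) / (10 * X) := by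
  have h0 : 0 < X := by linarith [hX.large]
  have hn' : (2 : ℝ) ≤ n := by exact_mod_cast hn
  rw [le_div_iff₀ (by positivity)]
  have h1 : Real.exp (Real.sqrt X) * Real.exp (Real.sqrt X) ≤ Real.exp (n * Real.sqrt X) := by
    rw [← Real.exp_add]
    refine Real.exp_le_exp.2 ?_
    nlinarith [Real.sqrt_nonneg X]
  refine le_trans (mul_le_mul_of_nonneg_left ?_ (Real.exp_pos _).le) h1
  linarith [hX.exp_sqrt]

theorem lev_zero_lt_largestPrime (hF : SideData X η pr ℓ v F) (hX : SieveRange X)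
    {i : Fin (M + 1)} (hi : 2 ≤ ℓ i) : lev X 0 < largestPrime (F i) := by
  refine lt_of_le_of_lt ?_ (hF.le_largestPrime hX hi)
  rw [lev]
  push_cast
  rw [zero_add, one_mul]
  exact Real.exp_le_exp.2 (exp_le_of_two_le hX hi)

/-- Normality is applied at T = min(u_{ℓ_m}, F_i). The term -√X in the density condition, due to
discarding primes up to u_0, cancels the + 1 in the exponent of the level. -/
theorem card_rough_le (hF : SideData X η pr ℓ v F) (hη : 0 ≤ η) (i m : Fin (M + 1)) :
    ((((roughPrimes (lev X 0) (F i)).filter fun r : ℕ => (r : ℝ) ≤ lev X (ℓ m)).card : ℕ) : ℝ)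
      ≤ (min (ℓ i) (ℓ m) : ℕ) * Real.sqrt X + η := by
  classical
  have hs := Real.sqrt_nonneg X
  rcases ((roughPrimes (lev X 0) (F i)).filter fun r : ℕ => (r : ℝ) ≤ lev X (ℓ m)).eq_empty_or_nonempty
    with he | ⟨r0, hr0⟩
  · rw [he, Finset.card_empty, Nat.cast_zero]
    positivity
  rw [Finset.mem_filter, mem_roughPrimes] at hr0
  obtain ⟨⟨hp0, hd0, hF0, hw0⟩, hm0⟩ := hr0
  set T : ℝ := min (lev X (ℓ m)) (F i) with hT
  have hle0 : (r0 : ℝ) ≤ F i := by exact_mod_cast Nat.le_of_dvd (hF.pos i) hd0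
  have hT1 : lev X 0 < T := lt_of_lt_of_le hw0 (le_min hm0 hle0)
  have h1 := hF.dens i T hT1 (min_le_right _ _)
  have h2 : iterLog 2 T ≤ (((min (ℓ i) (ℓ m) : ℕ) : ℝ) + 1) * Real.sqrt X := by
    rw [← iterLog_lev]
    refine iterLog_two_mono ((one_lt_lev X 0).trans hT1) ?_
    rcases le_total (ℓ i) (ℓ m) with h | h
    · rw [min_eq_left h]; exact (min_le_right _ _).trans (hF.le_level i)
    · rw [min_eq_right h]; exact min_le_left _ _
  have h3 : ((roughPrimes (lev X 0) (F i)).filter fun r : ℕ => (r : ℝ) ≤ lev X (ℓ m)).card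
      ≤ bigOmegaBetween (F i) (lev X 0) T := by
    rw [bigOmegaBetween, Finset.card_eq_sum_ones]
    refine le_trans (Finset.sum_le_sum (g := fun p => (F i).factorization p) fun p hp => ?_)
      (Finset.sum_le_sum_of_subset fun p hp => ?_)
    · rw [Finset.mem_filter, mem_roughPrimes] at hp
      exact hp.1.1.factorization_pos_of_dvd hp.1.2.2.1 hp.1.2.1
    · rw [Finset.mem_filter, mem_roughPrimes] at hp
      rw [Finset.mem_filter, Nat.mem_primeFactors]
      refine ⟨⟨hp.1.1, hp.1.2.1, hp.1.2.2.1⟩, hp.1.2.2.2, le_min hp.2 ?_⟩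
      exact_mod_cast Nat.le_of_dvd (hF.pos i) hp.1.2.1
  have h4 : ((((roughPrimes (lev X 0) (F i)).filter fun r : ℕ => (r : ℝ) ≤ lev X (ℓ m)).card : ℕ) : ℝ)
      ≤ (bigOmegaBetween (F i) (lev X 0) T : ℝ) := by exact_mod_cast h3
  linarith

/-- The constraint that makes the bulk small. After log |reach| is expanded by `log_card_reach` and
the summations are exchanged, the rough primes up to u_{ℓ_m} are counted row by row with
`card_rough_le`; `sum_log_mul_min` evaluates the main term. -/
theorem sum_log_reach_le (hF : SideData X η pr ℓ v F) (hη : 0 ≤ η) :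
    ∑ r ∈ roughPrimes (lev X 0) v, Real.log ((reach X ℓ r).card : ℝ)
      ≤ Real.sqrt X * ∑ k : Fin (M + 1), (ℓ k : ℝ) * (coeffA k + 1)
        + ((M : ℝ) + 1) ^ 2 * η := by
  classical
  set c : Fin (M + 1) → ℝ := fun m => Real.log ((m : ℕ) + 1 : ℝ) - Real.log (m : ℕ) with hc
  have hc0 : ∀ m, 0 ≤ c m := by
    intro m
    rcases Nat.eq_zero_or_pos (m : ℕ) with h | h
    · simp [hc, h]
    · exact sub_nonneg.2 (Real.log_le_log (by exact_mod_cast h) (by linarith))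
  have hcsum : ∑ m, c m ≤ (M : ℝ) + 1 := by
    have h1 : ∑ m, c m = Real.log ((M : ℝ) + 1) := by
      have h2 := Finset.sum_range_sub (fun m : ℕ => Real.log (m : ℝ)) (M + 1)
      rw [← Fin.sum_univ_eq_sum_range (fun m => Real.log ((m + 1 : ℕ) : ℝ) - Real.log (m : ℝ))] at h2
      push_cast at h2
      rw [Real.log_zero, sub_zero] at h2
      exact h2
    rw [h1]
    have := Real.log_le_sub_one_of_pos (show (0 : ℝ) < (M : ℝ) + 1 by positivity)
    linarith
  have e1 : ∑ r ∈ roughPrimes (lev X 0) v, Real.log ((reach X ℓ r).card : ℝ)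
      = ∑ m, c m * (((roughPrimes (lev X 0) v).filter fun r : ℕ => (r : ℝ) ≤ lev X (ℓ m)).card : ℝ) := by
    rw [Finset.sum_congr rfl (g := fun r : ℕ => ∑ m, if (r : ℝ) ≤ lev X (ℓ m) then c m else 0)
      (fun r _ => by rw [log_card_reach X hF.antitone, reach, Finset.sum_filter]), Finset.sum_comm]
    refine Finset.sum_congr rfl fun m _ => ?_
    rw [← Finset.sum_filter, Finset.sum_const, nsmul_eq_mul, mul_comm]
  have e2 : ∀ m, (((roughPrimes (lev X 0) v).filter fun r : ℕ => (r : ℝ) ≤ lev X (ℓ m)).card : ℝ)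
      ≤ ∑ i, ((min (ℓ i) (ℓ m) : ℕ) * Real.sqrt X + η) := by
    intro m
    have h1 : ((roughPrimes (lev X 0) v).filter fun r : ℕ => (r : ℝ) ≤ lev X (ℓ m))
        ⊆ Finset.univ.biUnion fun i =>
          (roughPrimes (lev X 0) (F i)).filter fun r : ℕ => (r : ℝ) ≤ lev X (ℓ m) := by
      intro r hr
      rw [Finset.mem_filter, mem_roughPrimes] at hr
      obtain ⟨i, hi⟩ := hF.cover r hr.1.1 hr.1.2.2.2 hr.1.2.1
      rw [Finset.mem_biUnion]
      refine ⟨i, Finset.mem_univ _, ?_⟩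
      rw [Finset.mem_filter, mem_roughPrimes]
      exact ⟨⟨hr.1.1, hi, (hF.pos i).ne', hr.1.2.2.2⟩, hr.2⟩
    have h2 := (Finset.card_le_card h1).trans Finset.card_biUnion_le
    refine (Nat.cast_le (α := ℝ).2 h2).trans ?_
    push_cast
    exact Finset.sum_le_sum fun i _ => by
      have := hF.card_rough_le hη i m
      push_cast at this
      exact this
  rw [e1]
  refine (Finset.sum_le_sum fun m _ => mul_le_mul_of_nonneg_left (e2 m) (hc0 m)).trans ?_
  rw [← sum_log_mul_min hF.antitone, Finset.mul_sum]
  have e3 : ∀ m, c m * ∑ i, (((min (ℓ i) (ℓ m) : ℕ) : ℝ) * Real.sqrt X + η)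
      = Real.sqrt X * ∑ i, c m * ((min (ℓ i) (ℓ m) : ℕ) : ℝ) + c m * (((M : ℝ) + 1) * η) := by
    intro m
    rw [Finset.sum_add_distrib, Finset.sum_const, Finset.card_univ, Fintype.card_fin, nsmul_eq_mul,
      ← Finset.sum_mul, ← Finset.mul_sum]
    push_cast
    ring
  rw [Finset.sum_congr rfl fun m _ => e3 m, Finset.sum_add_distrib, ← Finset.sum_mul]
  refine add_le_add le_rfl ?_
  have h5 := mul_le_mul_of_nonneg_right hcsum (show 0 ≤ ((M : ℝ) + 1) * η by positivity)
  calc _ ≤ _ := h5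
    _ = _ := by ring

end SideData

/-! ### Labelled tops -/

/-- The label of a top prime: its row and column, and whether it is the largest prime of the row
respectively of the column. -/
abbrev Label (M : ℕ) : Type := (Fin (M + 1) × Fin (M + 1)) × (Bool × Bool)

/-- The product of the entries in row `i`. -/
def rowProd {M : ℕ} (i : Fin (M + 1)) : List (Label M × ℕ) → ℕ
  | [] => 1
  | t :: l => (if t.1.1.1 = i then t.2 else 1) * rowProd i l

/-- The product of the entries in column `j`. -/
def colProd {M : ℕ} (j : Fin (M + 1)) : List (Label M × ℕ) → ℕ
  | [] => 1
  | t :: l => (if t.1.1.2 = j then t.2 else 1) * colProd j l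

/-- The weight of a label. -/
noncomputable def labelWeight (X : ℝ) {M : ℕ} (ℓ ℓ' : Fin (M + 1) → ℕ) (t : Label M) : ℝ :=
  (if t.2.1 then Real.exp (ℓ t.1.1 * Real.sqrt X) else 1) *
    (if t.2.2 then Real.exp (ℓ' t.1.2 * Real.sqrt X) else 1)

/-- The conditions on a top prime `r` with cofactors `A` in its row and `B` in its column. -/
structure StepOK (X : ℝ) {M : ℕ} (ℓ ℓ' : Fin (M + 1) → ℕ) (A B : ℕ) (t : Label M) (r : ℕ) :
    Prop where
  prime : r.Prime
  flag : t.2.1 = true ∨ t.2.2 = true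
  row : t.2.1 = true → 2 ≤ ℓ t.1.1 ∧ Real.exp (Real.exp (ℓ t.1.1 * Real.sqrt X) / (10 * X)) ≤ r ∧
    0 < A ∧ (A : ℝ) ≤ Real.exp (Real.exp X) ∧ (A * r + 1).Prime
  col : t.2.2 = true → 2 ≤ ℓ' t.1.2 ∧ Real.exp (Real.exp (ℓ' t.1.2 * Real.sqrt X) / (10 * X)) ≤ r ∧
    0 < B ∧ (B : ℝ) ≤ Real.exp (Real.exp X) ∧ (B * r - 1).Prime

open Classical in
/-- The labelled primes that may precede the list `l` of smaller tops. -/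
noncomputable def stepSet (X : ℝ) {M : ℕ} (ℓ ℓ' : Fin (M + 1) → ℕ) (a b : Fin (M + 1) → ℕ)
    (l : List (Label M × ℕ)) : Finset (Label M × ℕ) :=
  (Finset.univ ×ˢ range (⌊Real.exp (Real.exp X)⌋₊ + 1)).filter fun t =>
    StepOK X ℓ ℓ' (a t.1.1.1 * rowProd t.1.1.1 l) (b t.1.1.2 * colProd t.1.1.2 l) t.1 t.2

theorem mem_stepSet {X : ℝ} {M : ℕ} {ℓ ℓ' a b : Fin (M + 1) → ℕ} {l : List (Label M × ℕ)}
    {t : Label M} {r : ℕ} : (t, r) ∈ stepSet X ℓ ℓ' a b l ↔ (r : ℝ) ≤ Real.exp (Real.exp X) ∧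
      StepOK X ℓ ℓ' (a t.1.1 * rowProd t.1.1 l) (b t.1.2 * colProd t.1.2 l) t r := by
  classical
  rw [stepSet, Finset.mem_filter, Finset.mem_product, Finset.mem_range, Nat.lt_succ_iff,
    Nat.le_floor_iff (Real.exp_pos _).le]
  simp

/-- The weight of a label is exactly what the sieve saves: a top of a row of level ℓ has log r ≥
exp(ℓ√X) / (10X), so the weighted sum is bounded by a power of X. The power 17 leaves room for the
factors 10X and (10X)². -/
theorem sum_stepOK_le {X : ℝ} (hX : SieveRange X) {M : ℕ} (ℓ ℓ' : Fin (M + 1) → ℕ) (A B : ℕ)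
    (t : Label M) (s : Finset ℕ)
    (hs : ∀ r ∈ s, (r : ℝ) ≤ Real.exp (Real.exp X) ∧ StepOK X ℓ ℓ' A B t r) :
    labelWeight X ℓ ℓ' t * ∑ r ∈ s, (1 : ℝ) / r ≤ X ^ 17 := by
  have hX1 := hX.large
  have hX0 : 0 < X := by linarith
  rcases s.eq_empty_or_nonempty with rfl | ⟨r0, hr0⟩
  · simp; positivity
  have h0 := (hs r0 hr0).2
  have hlog : ∀ n : ℕ, Real.log (Real.exp (Real.exp (n * Real.sqrt X) / (10 * X)))
      = Real.exp (n * Real.sqrt X) / (10 * X) := fun n => Real.log_exp _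
  have hbase : ∀ {n : ℕ}, 2 ≤ n → Real.exp (Real.exp (Real.sqrt X)) ≤
      Real.exp (Real.exp (n * Real.sqrt X) / (10 * X)) := fun hn =>
    Real.exp_le_exp.2 (SideData.exp_le_of_two_le hX hn)
  have hX15 : 10 * X ^ 15 ≤ X ^ 17 := by
    have : X ^ 17 = X ^ 2 * X ^ 15 := by ring
    rw [this]
    exact mul_le_mul_of_nonneg_right (by nlinarith) (by positivity)
  obtain ⟨⟨i, j⟩, bP, bQ⟩ := t
  rcases bP with _ | _ <;> rcases bQ with _ | _
  · exact absurd h0.flag (by simp)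
  · obtain ⟨h2, hr, hB, hB', hpr⟩ := h0.col rfl
    simp only at h2 hr
    have := harmonic_sub_one_le hX hB hB' (hbase h2) s (fun r hr => by
      have := hs r hr
      have h3 := this.2.col rfl
      exact ⟨h3.2.1, this.1, this.2.prime, h3.2.2.2.2⟩)
    rw [hlog] at this
    simp only [labelWeight, if_true, Bool.false_eq_true, if_false, one_mul]
    refine (mul_le_mul_of_nonneg_left this (Real.exp_pos _).le).trans ?_
    have hp := Real.exp_pos (ℓ' j * Real.sqrt X)
    refine le_trans (le_of_eq ?_) hX15
    field_simp
  · obtain ⟨h2, hr, hB, hB', hpr⟩ := h0.row rfl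
    simp only at h2 hr
    have := harmonic_add_one_le hX hB hB' (hbase h2) s (fun r hr => by
      have := hs r hr
      have h3 := this.2.row rfl
      exact ⟨h3.2.1, this.1, this.2.prime, h3.2.2.2.2⟩)
    rw [hlog] at this
    simp only [labelWeight, if_true, Bool.false_eq_true, if_false, mul_one]
    refine (mul_le_mul_of_nonneg_left this (Real.exp_pos _).le).trans ?_
    have hp := Real.exp_pos (ℓ i * Real.sqrt X)
    refine le_trans (le_of_eq ?_) hX15
    field_simp
  · obtain ⟨h2, hr, hA, hA', hprA⟩ := h0.row rfl
    obtain ⟨h2', hr', hB, hB', hprB⟩ := h0.col rfl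
    simp only at h2 hr h2' hr'
    -- For a prime that is top of both a row and a column the three forms save (log R)²; with R the
    -- larger threshold this dominates the product of the two separate savings.
    set R := max (Real.exp (Real.exp (ℓ i * Real.sqrt X) / (10 * X)))
      (Real.exp (Real.exp (ℓ' j * Real.sqrt X) / (10 * X))) with hR
    have := harmonic_add_sub_one_le hX hA hB hA' hB' ((hbase h2).trans (le_max_left _ _) : _ ≤ R) s
      (fun r hr => by
      have := hs r hr
      have h3 := this.2.row rfl
      have h4 := this.2.col rfl
      exact ⟨max_le h3.2.1 h4.2.1, this.1, this.2.prime, h3.2.2.2.2, h4.2.2.2.2⟩)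
    simp only [labelWeight, if_true]
    have hp := Real.exp_pos (ℓ i * Real.sqrt X)
    have hp' := Real.exp_pos (ℓ' j * Real.sqrt X)
    have l1 : Real.exp (ℓ i * Real.sqrt X) / (10 * X) ≤ Real.log R := by
      rw [← hlog]; exact Real.log_le_log (Real.exp_pos _) (le_max_left _ _)
    have l2 : Real.exp (ℓ' j * Real.sqrt X) / (10 * X) ≤ Real.log R := by
      rw [← hlog]; exact Real.log_le_log (Real.exp_pos _) (le_max_right _ _)
    have l3 : Real.exp (ℓ i * Real.sqrt X) / (10 * X) * (Real.exp (ℓ' j * Real.sqrt X) / (10 * X))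
        ≤ Real.log R ^ 2 := by
      rw [pow_two]
      exact mul_le_mul l1 l2 (by positivity) (le_trans (by positivity) l1)
    have l4 : X ^ 14 / Real.log R ^ 2 ≤ X ^ 14 / (Real.exp (ℓ i * Real.sqrt X) / (10 * X) *
        (Real.exp (ℓ' j * Real.sqrt X) / (10 * X))) :=
      div_le_div_of_nonneg_left (by positivity) (by positivity) l3
    refine (mul_le_mul_of_nonneg_left (this.trans l4) (by positivity)).trans ?_
    have hX16 : 100 * X ^ 16 ≤ X ^ 17 := by
      have : X ^ 17 = X * X ^ 16 := by ring
      rw [this]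
      exact mul_le_mul_of_nonneg_right (by linarith) (by positivity)
    refine le_trans (le_of_eq ?_) hX16
    field_simp
    ring

theorem sum_stepSet_le {X : ℝ} (hX : SieveRange X) {M : ℕ} (ℓ ℓ' a b : Fin (M + 1) → ℕ)
    (l : List (Label M × ℕ)) :
    ∑ t ∈ stepSet X ℓ ℓ' a b l, labelWeight X ℓ ℓ' t.1 / t.2
      ≤ 4 * ((M : ℝ) + 1) ^ 2 * X ^ 17 := by
  classical
  rw [stepSet, Finset.sum_filter, Finset.sum_product]
  have h1 : ∀ t ∈ (Finset.univ : Finset (Label M)),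
      ∑ r ∈ range (⌊Real.exp (Real.exp X)⌋₊ + 1),
        (if StepOK X ℓ ℓ' (a t.1.1 * rowProd t.1.1 l) (b t.1.2 * colProd t.1.2 l) t r then
          labelWeight X ℓ ℓ' t / r else 0) ≤ X ^ 17 := by
    intro t _
    rw [← Finset.sum_filter]
    refine le_trans (le_of_eq ?_) (sum_stepOK_le hX ℓ ℓ' (a t.1.1 * rowProd t.1.1 l)
      (b t.1.2 * colProd t.1.2 l) t ((range (⌊Real.exp (Real.exp X)⌋₊ + 1)).filter fun r =>
        StepOK X ℓ ℓ' (a t.1.1 * rowProd t.1.1 l) (b t.1.2 * colProd t.1.2 l) t r)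
      (fun r hr => ?_))
    · rw [Finset.mul_sum]
      exact Finset.sum_congr rfl fun r _ => by ring
    · rw [Finset.mem_filter, Finset.mem_range, Nat.lt_succ_iff,
        Nat.le_floor_iff (Real.exp_pos _).le] at hr
      exact hr
  refine (Finset.sum_le_sum h1).trans (le_of_eq ?_)
  rw [Finset.sum_const, Finset.card_univ, nsmul_eq_mul]
  simp only [Fintype.card_prod, Fintype.card_fin, Fintype.card_bool]
  push_cast
  ring

end CommonValues


/-! ### Decomposing a common value into bulk, tops and largest prime -/

namespace CommonValues

open Finset

namespace SideData

variable {X η : ℝ} {M Om : ℕ} {pr : ℕ → Prop} {ℓ : Fin (M + 1) → ℕ} {v : ℕ}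
  {F : Fin (M + 1) → ℕ}

theorem two_le_level_zero (hF : SideData X η pr ℓ v F) (hX : SieveRange X) : 2 ≤ ℓ 0 := by
  have hX1 := hX.large
  have hX0 : 0 < X := by linarith
  by_contra hcon
  have h1 : (F 0 : ℝ) ≤ lev X 1 := (hF.le_level 0).trans (lev_mono (by omega))
  have h2 : (largestPrime (F 0) : ℝ) ≤ F 0 := by
    rcases Nat.lt_or_ge 1 (F 0) with h | h
    · exact_mod_cast Nat.le_of_dvd (hF.pos 0) (largestPrime_spec h).2.1
    · have h3 := hF.pos 0
      have h4 : F 0 = 1 := by omega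
      rw [h4]
      simp [largestPrime]
  have h3 := hF.zero_top.trans (h2.trans h1)
  rw [lev, Real.exp_le_exp, div_le_iff₀ hX0] at h3
  push_cast at h3
  have hs : Real.sqrt X * 10 ≤ X := by
    have h10 : (10 : ℝ) ≤ Real.sqrt X := Real.le_sqrt_of_sq_le (by linarith)
    nlinarith [Real.mul_self_sqrt hX0.le, Real.sqrt_nonneg X]
  have h4 : Real.exp X = Real.exp ((1 + 1) * Real.sqrt X) * Real.exp (X - (1 + 1) * Real.sqrt X) := by
    rw [← Real.exp_add]; ring_nf
  rw [h4] at h3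
  have h5 := le_of_mul_le_mul_left h3 (Real.exp_pos _)
  have h6 := Real.quadratic_le_exp_of_nonneg (show 0 ≤ X - (1 + 1) * Real.sqrt X by linarith)
  have h7 : X / 2 ≤ X - (1 + 1) * Real.sqrt X := by linarith
  generalize X - (1 + 1) * Real.sqrt X = D at h5 h6 h7
  nlinarith

theorem roughPrimes_eq (hF : SideData X η pr ℓ v F) (hv : ValueData X Om v)
    {iR : ℕ → Fin (M + 1)} (hiR : ∀ r ∈ roughPrimes (lev X 0) v, r ∣ F (iR r))
    (i : Fin (M + 1)) :
    roughPrimes (lev X 0) (F i) = (roughPrimes (lev X 0) v).filter fun r => iR r = i := by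
  ext r
  rw [Finset.mem_filter, mem_roughPrimes]
  constructor
  · rintro ⟨h1, h2, h3, h4⟩
    have hr : r ∈ roughPrimes (lev X 0) v :=
      mem_roughPrimes.2 ⟨h1, h2.trans (hF.dvd i), hv.pos, h4⟩
    exact ⟨hr, hF.index_unique hv h1 h4 (hiR r hr) h2⟩
  · rintro ⟨h1, rfl⟩
    have h2 := hiR r h1
    rw [mem_roughPrimes] at h1
    exact ⟨h1.1, h2, (hF.pos _).ne', h1.2.2.2⟩

theorem largestPrime_mem (hF : SideData X η pr ℓ v F) (hX : SieveRange X) (hv : ValueData X Om v)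
    {i : Fin (M + 1)} (hi : 2 ≤ ℓ i) :
    largestPrime (F i) ∈ roughPrimes (lev X 0) v := by
  obtain ⟨h1, h2, _⟩ := largestPrime_spec (hF.one_lt (i := i) (by omega))
  exact mem_roughPrimes.2 ⟨h1, h2.trans (hF.dvd i), hv.pos, hF.lev_zero_lt_largestPrime hX hi⟩

theorem index_largestPrime (hF : SideData X η pr ℓ v F) (hX : SieveRange X)
    (hv : ValueData X Om v) {iR : ℕ → Fin (M + 1)}
    (hiR : ∀ r ∈ roughPrimes (lev X 0) v, r ∣ F (iR r)) {i : Fin (M + 1)} (hi : 2 ≤ ℓ i) :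
    iR (largestPrime (F i)) = i := by
  obtain ⟨h1, h2, _⟩ := largestPrime_spec (hF.one_lt (i := i) (by omega))
  exact hF.index_unique hv h1 (hF.lev_zero_lt_largestPrime hX hi)
    (hiR _ (hF.largestPrime_mem hX hv hi)) h2

/-- Each rough prime occurs once and belongs to a single row, and the elements of T in row i other
than its largest prime are smaller than it. Thus the cofactor of a top is determined by the smooth
part, the bulk and the smaller tops, which is what allows the tops to be chosen in increasing order.
-/
theorem row_identity (hF : SideData X η pr ℓ v F) (hX : SieveRange X) (hv : ValueData X Om v)
    {iR : ℕ → Fin (M + 1)} (hiR : ∀ r ∈ roughPrimes (lev X 0) v, r ∣ F (iR r))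
    {T : Finset ℕ} {i : Fin (M + 1)} (hi : 2 ≤ ℓ i) (hT : largestPrime (F i) ∈ T)
    (hTR : T ⊆ roughPrimes (lev X 0) v) :
    smoothPart (lev X 0) (F i) *
      (∏ r ∈ (roughPrimes (lev X 0) v \ T).filter (fun r => iR r = i), r) *
      (∏ r ∈ (T.filter (fun r => r < largestPrime (F i))).filter (fun r => iR r = i), r) *
      largestPrime (F i) = F i := by
  obtain ⟨_, _, hmax⟩ := largestPrime_spec (hF.one_lt (i := i) (by omega))
  set a := largestPrime (F i) with ha
  have hai : iR a = i := hF.index_largestPrime hX hv hiR hi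
  have h1 := smoothPart_mul_prod_roughPrimes (w := lev X 0) (hF.pos i).ne'
    (fun r hr hr' h => hv.sq r hr hr' (h.trans (hF.dvd i)))
  conv_rhs => rw [← h1]
  rw [hF.roughPrimes_eq hv hiR i, mul_assoc, mul_assoc]
  congr 1
  have h2 : (roughPrimes (lev X 0) v).filter (fun r => iR r = i)
      = (roughPrimes (lev X 0) v \ T).filter (fun r => iR r = i)
        ∪ insert a ((T.filter (fun r => r < a)).filter (fun r => iR r = i)) := by
    ext r
    simp only [Finset.mem_union, Finset.mem_insert, Finset.mem_filter, Finset.mem_sdiff]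
    constructor
    · rintro ⟨h3, h4⟩
      by_cases hr : r ∈ T
      · right
        have h5 : r ≤ a := hmax r (mem_roughPrimes.1 h3).1 (h4 ▸ hiR r h3)
        rcases h5.eq_or_lt with h6 | h6
        · exact Or.inl h6
        · exact Or.inr ⟨⟨hr, h6⟩, h4⟩
      · exact Or.inl ⟨⟨h3, hr⟩, h4⟩
    · rintro (⟨⟨h3, _⟩, h4⟩ | rfl | ⟨⟨h3, _⟩, h4⟩)
      · exact ⟨h3, h4⟩
      · exact ⟨hTR hT, hai⟩
      · exact ⟨hTR h3, h4⟩
  rw [h2, Finset.prod_union, Finset.prod_insert (by simp), mul_comm a]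
  refine Finset.disjoint_left.2 fun r h3 h4 => ?_
  rw [Finset.mem_filter, Finset.mem_sdiff] at h3
  rw [Finset.mem_insert, Finset.mem_filter, Finset.mem_filter] at h4
  rcases h4 with rfl | h4
  · exact h3.1.2 hT
  · exact h3.1.2 h4.1.1

/-- Rows of level at most 1 have no top, but they contribute nothing positive to the left side; this
is the reason for ℓ_i - 1 in place of ℓ_i. Different rows have different tops, and none of those
with i ≠ 0 is the removed prime of row 0. -/
theorem weight_sum_le (hF : SideData X η pr ℓ v F) (hX : SieveRange X)
    (hv : ValueData X Om v) {iR : ℕ → Fin (M + 1)}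
    (hiR : ∀ r ∈ roughPrimes (lev X 0) v, r ∣ F (iR r)) {T : Finset ℕ}
    (hT : ∀ i, 2 ≤ ℓ i → largestPrime (F i) ∈ T) :
    ∑ i ∈ Finset.univ.erase 0, ((ℓ i : ℝ) - 1) * Real.sqrt X
      ≤ ∑ r ∈ T.erase (largestPrime (F 0)),
        if 2 ≤ ℓ (iR r) ∧ r = largestPrime (F (iR r)) then ℓ (iR r) * Real.sqrt X else 0 := by
  have hs := Real.sqrt_nonneg X
  have hidx : ∀ {i}, 2 ≤ ℓ i → iR (largestPrime (F i)) = i := fun hi =>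
    hF.index_largestPrime hX hv hiR hi
  set I := (Finset.univ.erase (0 : Fin (M + 1))).filter fun i => 2 ≤ ℓ i with hI
  have hI2 : ∀ i ∈ I, 2 ≤ ℓ i := fun i hi => (Finset.mem_filter.1 hi).2
  have h1 : ∑ i ∈ Finset.univ.erase 0, ((ℓ i : ℝ) - 1) * Real.sqrt X
      ≤ ∑ i ∈ I, (ℓ i : ℝ) * Real.sqrt X := by
    rw [hI, Finset.sum_filter]
    refine Finset.sum_le_sum fun i _ => ?_
    split_ifs with h
    · exact mul_le_mul_of_nonneg_right (by linarith) hs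
    · have : (ℓ i : ℝ) ≤ 1 := by exact_mod_cast (by omega : ℓ i ≤ 1)
      exact mul_nonpos_of_nonpos_of_nonneg (by linarith) hs
  refine h1.trans ?_
  have h2 : ∑ i ∈ I, (ℓ i : ℝ) * Real.sqrt X = ∑ r ∈ I.image (fun i => largestPrime (F i)),
      if 2 ≤ ℓ (iR r) ∧ r = largestPrime (F (iR r)) then ℓ (iR r) * Real.sqrt X else 0 := by
    rw [Finset.sum_image]
    · refine Finset.sum_congr rfl fun i hi => ?_
      rw [hidx (hI2 i hi), if_pos ⟨hI2 i hi, rfl⟩]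
    · intro i hi j hj h
      have h3 := congrArg iR h
      simp only at h3
      rwa [hidx (hI2 i hi), hidx (hI2 j hj)] at h3
  rw [h2]
  refine Finset.sum_le_sum_of_subset_of_nonneg (fun r hr => ?_) fun r _ _ => ?_
  · obtain ⟨i, hi, rfl⟩ := Finset.mem_image.1 hr
    refine Finset.mem_erase.2 ⟨fun h => ?_, hT i (hI2 i hi)⟩
    have h3 := congrArg iR h
    rw [hidx (hI2 i hi), hidx (hF.two_le_level_zero hX)] at h3
    exact (Finset.mem_erase.1 (Finset.mem_filter.1 hi).1).1 h3
  · split_ifs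
    · positivity
    · exact le_rfl

/-- The other F_i are themselves smaller than the largest prime of F_0. Applied to both sides it
shows that the largest primes of F_0 and G_0 coincide. -/
theorem le_largestPrime_zero (hF : SideData X η pr ℓ v F) (hX : SieveRange X)
    {r : ℕ} (hr : r.Prime) {i : Fin (M + 1)} (h : r ∣ F i) : r ≤ largestPrime (F 0) := by
  by_cases hi : i = 0
  · subst hi
    exact (largestPrime_spec (hF.one_lt (i := 0) (by have := hF.two_le_level_zero hX; omega))).2.2
      r hr h
  · have h1 : (r : ℝ) ≤ F i := by exact_mod_cast Nat.le_of_dvd (hF.pos i) h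
    have h2 := (h1.trans_lt (hF.lt_top i hi)).trans_le hF.zero_top
    exact_mod_cast h2.le

end SideData

/-- The part of the cofactor of a row that does not come from the tops. -/
def rowBase {M : ℕ} (d : Fin (M + 1) → ℕ) (Q : Fin (M + 1) × Fin (M + 1) → Finset ℕ)
    (i : Fin (M + 1)) : ℕ := d i * ∏ j, ∏ r ∈ Q (i, j), r

/-- The part of the cofactor of a column that does not come from the tops. -/
def colBase {M : ℕ} (d : Fin (M + 1) → ℕ) (Q : Fin (M + 1) × Fin (M + 1) → Finset ℕ)
    (j : Fin (M + 1)) : ℕ := d j * ∏ i, ∏ r ∈ Q (i, j), r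

/-- The conditions on the largest prime `r` of a common value with cofactors `A`, `B`. -/
structure TopOK (X : ℝ) (A B r : ℕ) : Prop where
  prime : r.Prime
  ge : Real.exp (Real.exp X / X) ≤ r
  A_pos : 0 < A
  B_pos : 0 < B
  A_le : (A : ℝ) ≤ Real.exp (Real.exp X)
  B_le : (B : ℝ) ≤ Real.exp (Real.exp X)
  primeA : (A * r + 1).Prime
  primeB : (B * r - 1).Prime

/-- A decomposition of `v` into a smooth part, bulk primes, a list of labelled tops and the
largest prime. -/
structure Decomposition (X : ℝ) {M : ℕ} (ℓ ℓ' : Fin (M + 1) → ℕ) (v : ℕ)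
    (d d' : Fin (M + 1) → ℕ) (Q : Fin (M + 1) × Fin (M + 1) → Finset ℕ) (n : ℕ)
    (l : List (Label M × ℕ)) (r₀ : ℕ) : Prop where
  d_dvd : ∀ i, d i ∣ smoothPart (lev X 0) v
  d'_dvd : ∀ j, d' j ∣ smoothPart (lev X 0) v
  bulk : ∀ t, ∀ r ∈ Q t, r.Prime ∧ lev X 0 < r ∧ (r : ℝ) ≤ lev X (ℓ t.1) ∧
    (r : ℝ) ≤ lev X (ℓ' t.2) ∧ (r : ℝ) ≤ Real.exp (Real.exp X)
  bulk_le : ∑ t, ∑ r ∈ Q t,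
      (Real.log ((reach X ℓ r).card : ℝ) + Real.log ((reach X ℓ' r).card : ℝ))
    ≤ ∑ r ∈ roughPrimes (lev X 0) v,
      (Real.log ((reach X ℓ r).card : ℝ) + Real.log ((reach X ℓ' r).card : ℝ))
  n_le : n ≤ 2 * (M + 1)
  mem : l ∈ goodLists (stepSet X ℓ ℓ' (rowBase d Q) (colBase d' Q)) n
  weight : Real.exp (∑ i ∈ Finset.univ.erase 0, ((ℓ i : ℝ) - 1) * Real.sqrt X
    + ∑ i ∈ Finset.univ.erase 0, ((ℓ' i : ℝ) - 1) * Real.sqrt X)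
      ≤ (l.map fun t => labelWeight X ℓ ℓ' t.1).prod
  top : TopOK X (rowBase d Q 0 * rowProd 0 l) (colBase d' Q 0 * colProd 0 l) r₀
  eq : v = smoothPart (lev X 0) v * (∏ t, ∏ r ∈ Q t, r) * (l.map Prod.snd).prod * r₀

/-- Every rough prime receives its row and its column; T collects the tops of both sides. The tops
other than the largest prime r₀ are listed in decreasing order, so the tail of the list at a top
contains exactly the smaller tops, and `row_identity` on either side supplies the linear forms that
must be prime. -/
theorem exists_decomposition {X η : ℝ} (hX : SieveRange X) {M Om v : ℕ}
    {ℓ ℓ' F G : Fin (M + 1) → ℕ} (hv : ValueData X Om v)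
    (hF : SideData X η (fun n => (n + 1).Prime) ℓ v F)
    (hG : SideData X η (fun n => (n - 1).Prime) ℓ' v G) :
    ∃ d d' Q n l r₀, Decomposition X ℓ ℓ' v d d' Q n l r₀ := by
  classical
  set R := roughPrimes (lev X 0) v with hR
  have hRp : ∀ r ∈ R, r.Prime := fun r hr => (mem_roughPrimes.1 hr).1
  have hex : ∀ r, ∃ i, r ∈ R → r ∣ F i := by
    intro r
    by_cases hr : r ∈ R
    · rw [hR, mem_roughPrimes] at hr
      obtain ⟨i, hi⟩ := hF.cover r hr.1 hr.2.2.2 hr.2.1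
      exact ⟨i, fun _ => hi⟩
    · exact ⟨0, fun h => absurd h hr⟩
  have hex' : ∀ r, ∃ i, r ∈ R → r ∣ G i := by
    intro r
    by_cases hr : r ∈ R
    · rw [hR, mem_roughPrimes] at hr
      obtain ⟨i, hi⟩ := hG.cover r hr.1 hr.2.2.2 hr.2.1
      exact ⟨i, fun _ => hi⟩
    · exact ⟨0, fun h => absurd h hr⟩
  choose iR hiR using hex
  choose jR hjR using hex'
  have hl0 := hF.two_le_level_zero hX
  have hl0' := hG.two_le_level_zero hX
  have hr0F := hF.largestPrime_mem hX hv hl0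
  have hr0G := hG.largestPrime_mem hX hv hl0'
  -- Each of the two primes divides v, hence lies in some part of the other factorization and is
  -- bounded by the other prime.
  have heq : largestPrime (G 0) = largestPrime (F 0) :=
    le_antisymm (hF.le_largestPrime_zero hX (hRp _ hr0G) (hiR _ hr0G))
      (hG.le_largestPrime_zero hX (hRp _ hr0F) (hjR _ hr0F))
  set r₀ := largestPrime (F 0) with hr₀
  set T := (Finset.univ.filter fun i => 2 ≤ ℓ i).image (fun i => largestPrime (F i)) ∪
    (Finset.univ.filter fun i => 2 ≤ ℓ' i).image (fun i => largestPrime (G i)) with hT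
  have hTF : ∀ i, 2 ≤ ℓ i → largestPrime (F i) ∈ T := fun i hi =>
    Finset.mem_union_left _ (Finset.mem_image.2 ⟨i, by simpa using hi, rfl⟩)
  have hTG : ∀ i, 2 ≤ ℓ' i → largestPrime (G i) ∈ T := fun i hi =>
    Finset.mem_union_right _ (Finset.mem_image.2 ⟨i, by simpa using hi, rfl⟩)
  have hTcases : ∀ r ∈ T, (2 ≤ ℓ (iR r) ∧ r = largestPrime (F (iR r))) ∨
      (2 ≤ ℓ' (jR r) ∧ r = largestPrime (G (jR r))) := by
    intro r hr
    rcases Finset.mem_union.1 hr with h | h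
    · obtain ⟨i, hi, rfl⟩ := Finset.mem_image.1 h
      have hi' : 2 ≤ ℓ i := by simpa using hi
      left
      rw [hF.index_largestPrime hX hv hiR hi']
      exact ⟨hi', rfl⟩
    · obtain ⟨i, hi, rfl⟩ := Finset.mem_image.1 h
      have hi' : 2 ≤ ℓ' i := by simpa using hi
      right
      rw [hG.index_largestPrime hX hv hjR hi']
      exact ⟨hi', rfl⟩
  have hTR : T ⊆ R := by
    intro r hr
    rcases hTcases r hr with h | h
    · rw [h.2]; exact hF.largestPrime_mem hX hv h.1
    · rw [h.2]; exact hG.largestPrime_mem hX hv h.1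
  have hr0T : r₀ ∈ T := hTF 0 hl0
  have hmax : ∀ r ∈ R, r ≤ r₀ := fun r hr => hF.le_largestPrime_zero hX (hRp r hr) (hiR r hr)
  set d : Fin (M + 1) → ℕ := fun i => smoothPart (lev X 0) (F i) with hd
  set d' : Fin (M + 1) → ℕ := fun i => smoothPart (lev X 0) (G i) with hd'
  set Q : Fin (M + 1) × Fin (M + 1) → Finset ℕ := fun t =>
    (R \ T).filter fun r => iR r = t.1 ∧ jR r = t.2 with hQ
  have hrow : ∀ i, rowBase d Q i
      = smoothPart (lev X 0) (F i) * ∏ r ∈ (R \ T).filter (fun r => iR r = i), r := by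
    intro i
    rw [rowBase, ← Finset.prod_fiberwise ((R \ T).filter (fun r => iR r = i)) jR (fun r => r)]
    congr 1
    refine Finset.prod_congr rfl fun j _ => ?_
    rw [Finset.filter_filter]
  have hcol : ∀ j, colBase d' Q j
      = smoothPart (lev X 0) (G j) * ∏ r ∈ (R \ T).filter (fun r => jR r = j), r := by
    intro j
    rw [colBase, ← Finset.prod_fiberwise ((R \ T).filter (fun r => jR r = j)) iR (fun r => r)]
    congr 1
    refine Finset.prod_congr rfl fun i _ => ?_
    rw [Finset.filter_filter]
    refine Finset.prod_congr ?_ fun _ _ => rfl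
    ext r
    simp only [hQ, Finset.mem_filter]
    tauto
  set label : ℕ → Label M := fun r => ((iR r, jR r),
    (decide (2 ≤ ℓ (iR r) ∧ r = largestPrime (F (iR r))),
      decide (2 ≤ ℓ' (jR r) ∧ r = largestPrime (G (jR r))))) with hlabel
  have hFle : ∀ i, (F i : ℝ) ≤ Real.exp (Real.exp X) := fun i =>
    le_trans (by exact_mod_cast Nat.le_of_dvd (Nat.pos_of_ne_zero hv.pos) (hF.dvd i)) hv.le
  have hGle : ∀ i, (G i : ℝ) ≤ Real.exp (Real.exp X) := fun i =>
    le_trans (by exact_mod_cast Nat.le_of_dvd (Nat.pos_of_ne_zero hv.pos) (hG.dvd i)) hv.le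
  have hfactor : ∀ {A r n : ℕ}, A * r = n → 0 < n → (n : ℝ) ≤ Real.exp (Real.exp X) →
      0 < A ∧ (A : ℝ) ≤ Real.exp (Real.exp X) := by
    intro A r n h hn hle
    have hA : 0 < A := Nat.pos_of_ne_zero fun h0 => by rw [h0, zero_mul] at h; omega
    refine ⟨hA, le_trans ?_ hle⟩
    exact_mod_cast Nat.le_of_dvd hn ⟨r, h.symm⟩
  have hrowid : ∀ r ∈ T, (2 ≤ ℓ (iR r) ∧ r = largestPrime (F (iR r))) →
      rowBase d Q (iR r) * (∏ q ∈ (T.filter (fun q => q < r)).filter (fun q => iR q = iR r), q) * r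
        = F (iR r) := by
    intro r hr h
    have := hF.row_identity hX hv hiR h.1 (hTF _ h.1) hTR
    rw [← h.2] at this
    rw [hrow]; exact this
  have hcolid : ∀ r ∈ T, (2 ≤ ℓ' (jR r) ∧ r = largestPrime (G (jR r))) →
      colBase d' Q (jR r) * (∏ q ∈ (T.filter (fun q => q < r)).filter (fun q => jR q = jR r), q) * r
        = G (jR r) := by
    intro r hr h
    have := hG.row_identity hX hv hjR h.1 (hTG _ h.1) hTR
    rw [← h.2] at this
    rw [hcol]; exact this
  -- Induction over the initial segments of T. Closure under smaller elements identifies the segment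
  -- preceding a with all tops below a, so its row and column products complete the cofactors of a.
  have hchain : ∀ s : Finset ℕ, s ⊆ T → (∀ t ∈ T, ∀ y ∈ s, t < y → t ∈ s) →
      ∃ l ∈ goodLists (stepSet X ℓ ℓ' (rowBase d Q) (colBase d' Q)) s.card,
        (∀ i, rowProd i l = ∏ r ∈ s.filter (fun r => iR r = i), r) ∧
        (∀ j, colProd j l = ∏ r ∈ s.filter (fun r => jR r = j), r) ∧
        (l.map Prod.snd).prod = ∏ r ∈ s, r ∧
        (l.map fun t => labelWeight X ℓ ℓ' t.1).prod = ∏ r ∈ s, labelWeight X ℓ ℓ' (label r) := by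
    intro s
    induction s using Finset.induction_on_max with
    | empty => exact fun _ _ => ⟨[], by simp [goodLists], by simp [rowProd], by simp [colProd],
        by simp, by simp⟩
    | insert a s has ih =>
      intro hsT hlow
      have hna : a ∉ s := fun h => lt_irrefl _ (has a h)
      have haT : a ∈ T := hsT (Finset.mem_insert_self _ _)
      have hs : s = T.filter (fun q => q < a) := by
        ext t
        rw [Finset.mem_filter]
        refine ⟨fun h => ⟨hsT (Finset.mem_insert_of_mem h), has t h⟩, fun h => ?_⟩
        rcases Finset.mem_insert.1 (hlow t h.1 a (Finset.mem_insert_self _ _) h.2) with h1 | h1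
        · exact absurd h1 h.2.ne
        · exact h1
      obtain ⟨l, hl, hl1, hl2, hl3, hl4⟩ := ih
        (fun t ht => hsT (Finset.mem_insert_of_mem ht)) (fun t ht y hy hty => by
          rw [hs, Finset.mem_filter]
          exact ⟨ht, hty.trans (has y hy)⟩)
      refine ⟨(label a, a) :: l, ?_, ?_, ?_, ?_, ?_⟩
      · rw [Finset.card_insert_of_notMem hna, cons_mem_goodLists, mem_stepSet]
        refine ⟨hl, ?_, hRp a (hTR haT), ?_, ?_, ?_⟩
        · exact le_trans (by exact_mod_cast Nat.le_of_dvd (hF.pos _) (hiR a (hTR haT))) (hFle (iR a))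
        · simpa [hlabel] using hTcases a haT
        · intro hb
          have hb' : 2 ≤ ℓ (iR a) ∧ a = largestPrime (F (iR a)) := by simpa [hlabel] using hb
          have hid := hrowid a haT hb'
          rw [← hs, ← hl1] at hid
          obtain ⟨hA, hA'⟩ := hfactor hid (hF.pos _) (hFle _)
          refine ⟨hb'.1, ?_, hA, hA', ?_⟩
          · have := hF.le_largestPrime hX hb'.1
            rw [← hb'.2] at this
            exact this.le
          · have := hF.prime (iR a) (by omega)
            show (rowBase d Q (iR a) * rowProd (iR a) l * a + 1).Prime
            rw [hid]; exact this
        · intro hb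
          have hb' : 2 ≤ ℓ' (jR a) ∧ a = largestPrime (G (jR a)) := by simpa [hlabel] using hb
          have hid := hcolid a haT hb'
          rw [← hs, ← hl2] at hid
          obtain ⟨hA, hA'⟩ := hfactor hid (hG.pos _) (hGle _)
          refine ⟨hb'.1, ?_, hA, hA', ?_⟩
          · have := hG.le_largestPrime hX hb'.1
            rw [← hb'.2] at this
            exact this.le
          · have := hG.prime (jR a) (by omega)
            show (colBase d' Q (jR a) * colProd (jR a) l * a - 1).Prime
            rw [hid]; exact this
      · intro i
        rw [rowProd, hl1, Finset.filter_insert]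
        show (if iR a = i then a else 1) * _ = _
        split_ifs with h
        · rw [Finset.prod_insert (by simp [hna])]
        · rw [one_mul]
      · intro i
        rw [colProd, hl2, Finset.filter_insert]
        show (if jR a = i then a else 1) * _ = _
        split_ifs with h
        · rw [Finset.prod_insert (by simp [hna])]
        · rw [one_mul]
      · rw [List.map_cons, List.prod_cons, hl3, Finset.prod_insert hna]
      · rw [List.map_cons, List.prod_cons, hl4, Finset.prod_insert hna]
  have hlow : ∀ t ∈ T, ∀ y ∈ T.erase r₀, t < y → t ∈ T.erase r₀ := by
    intro t ht y hy hty
    refine Finset.mem_erase.2 ⟨?_, ht⟩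
    rintro rfl
    exact absurd (hmax y (hTR (Finset.mem_erase.1 hy).2)) (not_le.2 hty)
  obtain ⟨l, hl, hl1, hl2, hl3, hl4⟩ := hchain (T.erase r₀) (Finset.erase_subset _ _) hlow
  have herase : T.erase r₀ = T.filter (fun q => q < r₀) := by
    ext t
    rw [Finset.mem_erase, Finset.mem_filter]
    exact ⟨fun h => ⟨h.2, lt_of_le_of_ne (hmax t (hTR h.2)) h.1⟩, fun h => ⟨h.2.ne, h.1⟩⟩
  have hi0 : iR r₀ = 0 := hF.index_largestPrime hX hv hiR hl0
  have hj0 : jR r₀ = 0 := by rw [← heq]; exact hG.index_largestPrime hX hv hjR hl0'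
  have hidA : rowBase d Q 0 * rowProd 0 l * r₀ = F 0 := by
    have := hrowid r₀ hr0T (by rw [hi0]; exact ⟨hl0, rfl⟩)
    rw [hi0, ← herase] at this
    rw [hl1]; exact this
  have hidB : colBase d' Q 0 * colProd 0 l * r₀ = G 0 := by
    have := hcolid r₀ hr0T (by rw [hj0]; exact ⟨hl0', heq.symm⟩)
    rw [hj0, ← herase] at this
    rw [hl2]; exact this
  have hQprod : ∀ f : ℕ → ℕ, ∏ t, ∏ r ∈ Q t, f r = ∏ r ∈ R \ T, f r := by
    intro f
    rw [← Finset.prod_fiberwise (R \ T) (fun r => (iR r, jR r)) f]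
    refine Finset.prod_congr rfl fun t _ => Finset.prod_congr ?_ fun _ _ => rfl
    ext r
    simp only [hQ, Finset.mem_filter, Prod.ext_iff]
  have hQsum : ∀ f : ℕ → ℝ, ∑ t, ∑ r ∈ Q t, f r = ∑ r ∈ R \ T, f r := by
    intro f
    rw [← Finset.sum_fiberwise (R \ T) (fun r => (iR r, jR r)) f]
    refine Finset.sum_congr rfl fun t _ => Finset.sum_congr ?_ fun _ _ => rfl
    ext r
    simp only [hQ, Finset.mem_filter, Prod.ext_iff]
  refine ⟨d, d', Q, (T.erase r₀).card, l, r₀, ?_, ?_, ?_, ?_, ?_, hl, ?_, ?_, ?_⟩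
  · exact fun i => smoothPart_dvd_smoothPart _ hv.pos (hF.dvd i)
  · exact fun i => smoothPart_dvd_smoothPart _ hv.pos (hG.dvd i)
  · rintro ⟨i, j⟩ r hr
    simp only [hQ, Finset.mem_filter, Finset.mem_sdiff] at hr
    obtain ⟨⟨hrR, _⟩, rfl, rfl⟩ := hr
    have h1 : (r : ℝ) ≤ F (iR r) := by exact_mod_cast Nat.le_of_dvd (hF.pos _) (hiR r hrR)
    have h2 : (r : ℝ) ≤ G (jR r) := by exact_mod_cast Nat.le_of_dvd (hG.pos _) (hjR r hrR)
    exact ⟨hRp r hrR, (mem_roughPrimes.1 hrR).2.2.2, h1.trans (hF.le_level _),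
      h2.trans (hG.le_level _), h1.trans (hFle _)⟩
  · rw [hQsum]
    refine Finset.sum_le_sum_of_subset_of_nonneg Finset.sdiff_subset fun r _ _ => ?_
    exact add_nonneg (Real.log_natCast_nonneg _) (Real.log_natCast_nonneg _)
  · refine (Finset.card_le_card (Finset.erase_subset _ _)).trans ((Finset.card_union_le _ _).trans ?_)
    have h1 : ∀ (p : Fin (M + 1) → Prop) [DecidablePred p] (f : Fin (M + 1) → ℕ),
        ((Finset.univ.filter p).image f).card ≤ M + 1 := fun p _ f =>
      Finset.card_image_le.trans ((Finset.card_le_univ _).trans (by simp))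
    have h2 := h1 (fun i => 2 ≤ ℓ i) (fun i => largestPrime (F i))
    have h3 := h1 (fun i => 2 ≤ ℓ' i) (fun i => largestPrime (G i))
    omega
  · have hw1 := hF.weight_sum_le hX hv hiR hTF
    have hw2 := hG.weight_sum_le hX hv hjR hTG
    rw [heq] at hw2
    have hlw : ∀ r, labelWeight X ℓ ℓ' (label r) = Real.exp
        ((if 2 ≤ ℓ (iR r) ∧ r = largestPrime (F (iR r)) then ℓ (iR r) * Real.sqrt X else 0)
        + if 2 ≤ ℓ' (jR r) ∧ r = largestPrime (G (jR r)) then ℓ' (jR r) * Real.sqrt X else 0) := by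
      intro r
      rw [Real.exp_add]
      simp only [labelWeight, hlabel, decide_eq_true_eq]
      congr 1 <;> split_ifs <;> simp
    rw [hl4, Finset.prod_congr rfl fun r _ => hlw r, ← Real.exp_sum, Finset.sum_add_distrib]
    exact Real.exp_le_exp.2 (add_le_add hw1 hw2)
  · obtain ⟨hA, hA'⟩ := hfactor hidA (hF.pos _) (hFle _)
    obtain ⟨hB, hB'⟩ := hfactor hidB (hG.pos _) (hGle _)
    refine ⟨hRp _ hr0F, hF.zero_top, hA, hB, hA', hB', ?_, ?_⟩
    · rw [hidA]; exact hF.prime 0 (by omega)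
    · rw [hidB]; exact hG.prime 0 (by omega)
  · rw [hQprod (fun r => r), hl3, mul_assoc, Finset.prod_erase_mul _ _ hr0T, mul_assoc,
      Finset.prod_sdiff hTR]
    exact (smoothPart_mul_prod_roughPrimes hv.pos hv.sq).symm

end CommonValues


/-! ### Counting the common values with prescribed levels -/

namespace CommonValues

open Finset

theorem card_biUnion_le_sum {α β : Type*} [DecidableEq β] (s : Finset α) (t : α → Finset β)
    (f : α → ℝ) (h : ∀ a ∈ s, ((t a).card : ℝ) ≤ f a) : ((s.biUnion t).card : ℝ) ≤ ∑ a ∈ s, f a := by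
  refine (Nat.cast_le (α := ℝ).2 Finset.card_biUnion_le).trans ?_
  push_cast
  exact Finset.sum_le_sum h

theorem card_divisors_le_two_pow {n : ℕ} (hn : n ≠ 0) :
    n.divisors.card ≤ 2 ^ n.primeFactorsList.length := by
  have h1 : n.primeFactorsList.length = ∑ p ∈ n.primeFactors, n.factorization p := by
    rw [← ArithmeticFunction.cardFactors_apply, ArithmeticFunction.cardFactors_eq_sum_factorization]
    rfl
  rw [Nat.card_divisors hn, h1, ← Finset.prod_pow_eq_pow_sum]
  exact Finset.prod_le_prod' fun p _ => Nat.lt_two_pow_self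

open Classical in
/-- The primes that may occupy position `t` of the bulk. -/
noncomputable def bulkPrimes (X : ℝ) {M : ℕ} (ℓ ℓ' : Fin (M + 1) → ℕ)
    (t : Fin (M + 1) × Fin (M + 1)) : Finset ℕ :=
  (range (⌊Real.exp (Real.exp X)⌋₊ + 1)).filter fun r =>
    (r.Prime ∧ lev X 0 < r) ∧ t.1 ∈ reach X ℓ r ∧ t.2 ∈ reach X ℓ' r

/-- AM-GM for √(AB). It decouples rows from columns, so that the two sides of the equation
contribute separately from here on. -/
theorem mul_exp_neg_half_log_le {A B : ℕ} :
    (A : ℝ) * B * Real.exp (-((Real.log A + Real.log B) / 2)) ≤ (A + B) / 2 := by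
  rcases Nat.eq_zero_or_pos A with rfl | hA
  · simp; positivity
  rcases Nat.eq_zero_or_pos B with rfl | hB
  · simp; positivity
  have hA' : (0 : ℝ) < A := by exact_mod_cast hA
  have hB' : (0 : ℝ) < B := by exact_mod_cast hB
  have ha : (A : ℝ) = Real.exp (Real.log A / 2) * Real.exp (Real.log A / 2) := by
    rw [← Real.exp_add, add_halves, Real.exp_log hA']
  have hb : (B : ℝ) = Real.exp (Real.log B / 2) * Real.exp (Real.log B / 2) := by
    rw [← Real.exp_add, add_halves, Real.exp_log hB']
  have hc : Real.exp (-((Real.log A + Real.log B) / 2))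
      = (Real.exp (Real.log A / 2))⁻¹ * (Real.exp (Real.log B / 2))⁻¹ := by
    rw [← Real.exp_neg, ← Real.exp_neg, ← Real.exp_add]; ring_nf
  rw [hc]
  have ha0 := Real.exp_pos (Real.log A / 2)
  have hb0 := Real.exp_pos (Real.log B / 2)
  generalize Real.exp (Real.log A / 2) = a at *
  generalize Real.exp (Real.log B / 2) = b at *
  rw [ha, hb]
  have e : a * a * (b * b) * (a⁻¹ * b⁻¹) = a * b := by field_simp
  rw [e]
  nlinarith [sq_nonneg (a - b)]

theorem sum_sum_reach_le {X : ℝ} (hX : SieveRange X) {M : ℕ} (ℓ : Fin (M + 1) → ℕ)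
    (P : Finset ℕ) (hP : ∀ r ∈ P, r.Prime ∧ lev X 0 < r) :
    ∑ r ∈ P, ((reach X ℓ r).card : ℝ) / r ≤ ∑ i, ((ℓ i : ℝ) * Real.sqrt X + 9) := by
  classical
  have h1 : ∀ r ∈ P, ((reach X ℓ r).card : ℝ) / r
      = ∑ i, if (r : ℝ) ≤ lev X (ℓ i) then (1 : ℝ) / r else 0 := by
    intro r _
    rw [← Finset.sum_filter, Finset.sum_const, nsmul_eq_mul, reach]
    ring
  rw [Finset.sum_congr rfl h1, Finset.sum_comm]
  refine Finset.sum_le_sum fun i _ => ?_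
  rw [← Finset.sum_filter]
  refine sum_inv_prime_lev_le hX _ _ fun r hr => ?_
  rw [Finset.mem_filter] at hr
  exact ⟨(hP r hr.1).1, (hP r hr.1).2, hr.2⟩

/-- A prime r occurs for AB positions, A and B being the numbers of rows and columns that reach it,
each with weight (AB)^(-1/2) / r. -/
theorem sum_bulkPrimes_le {X : ℝ} (hX : SieveRange X) {M : ℕ} (ℓ ℓ' : Fin (M + 1) → ℕ) :
    ∑ t, ∑ r ∈ bulkPrimes X ℓ ℓ' t, Real.exp (-((Real.log ((reach X ℓ r).card : ℝ)
      + Real.log ((reach X ℓ' r).card : ℝ)) / 2)) / r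
      ≤ (∑ i, ((ℓ i : ℝ) * Real.sqrt X + 9) + ∑ i, ((ℓ' i : ℝ) * Real.sqrt X + 9)) / 2 := by
  classical
  set P := (range (⌊Real.exp (Real.exp X)⌋₊ + 1)).filter fun r : ℕ => r.Prime ∧ lev X 0 < r with hP
  have hPp : ∀ r ∈ P, r.Prime ∧ lev X 0 < r := fun r hr => (Finset.mem_filter.1 hr).2
  set f : ℕ → ℝ := fun r => Real.exp (-((Real.log ((reach X ℓ r).card : ℝ)
      + Real.log ((reach X ℓ' r).card : ℝ)) / 2)) / r with hf
  have h1 : ∑ t, ∑ r ∈ bulkPrimes X ℓ ℓ' t, f r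
      = ∑ r ∈ P, ((reach X ℓ r).card : ℝ) * (reach X ℓ' r).card * f r := by
    have h2 : ∀ t, ∑ r ∈ bulkPrimes X ℓ ℓ' t, f r
        = ∑ r ∈ P, if t ∈ reach X ℓ r ×ˢ reach X ℓ' r then f r else 0 := by
      intro t
      rw [← Finset.sum_filter, hP, Finset.filter_filter, bulkPrimes]
      simp only [Finset.mem_product]
    rw [Finset.sum_congr rfl fun t _ => h2 t, Finset.sum_comm]
    refine Finset.sum_congr rfl fun r _ => ?_
    rw [← Finset.sum_filter, Finset.sum_const, nsmul_eq_mul, Finset.filter_univ_mem,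
      Finset.card_product]
    push_cast
    ring
  rw [h1]
  have h3 : ∀ r ∈ P, ((reach X ℓ r).card : ℝ) * (reach X ℓ' r).card * f r
      ≤ (((reach X ℓ r).card : ℝ) / r + ((reach X ℓ' r).card : ℝ) / r) / 2 := by
    intro r hr
    have hr0 : (0 : ℝ) < r := by exact_mod_cast (hPp r hr).1.pos
    have h4 := div_le_div_of_nonneg_right
      (mul_exp_neg_half_log_le (A := (reach X ℓ r).card) (B := (reach X ℓ' r).card)) hr0.le
    calc _ = _ := by rw [hf]; exact (mul_div_assoc _ _ _).symm
      _ ≤ _ := h4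
      _ = _ := by ring
  refine (Finset.sum_le_sum h3).trans ?_
  rw [← Finset.sum_div, Finset.sum_add_distrib]
  exact div_le_div_of_nonneg_right (add_le_add (sum_sum_reach_le hX ℓ P hPp)
    (sum_sum_reach_le hX ℓ' P hPp)) (by norm_num)

/-- Rankin's trick: since the sum of the logarithms is at most g, each term may be multiplied by
exp((g - that sum) / 2) ≥ 1. The sum over all subsets in all positions then factors and is at most
the exponential of the sum over primes. The exponent 1/2 makes the level sums cancel exactly in
`level_exponent_le`. -/
theorem sum_bulk_le {X : ℝ} (hX : SieveRange X) {M : ℕ} (ℓ ℓ' : Fin (M + 1) → ℕ) (g : ℝ)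
    (s : Finset (Fin (M + 1) × Fin (M + 1) → Finset ℕ))
    (hs : ∀ Q ∈ s, (∀ t, Q t ⊆ bulkPrimes X ℓ ℓ' t) ∧ ∑ t, ∑ r ∈ Q t,
      (Real.log ((reach X ℓ r).card : ℝ) + Real.log ((reach X ℓ' r).card : ℝ)) ≤ g) :
    ∑ Q ∈ s, (1 : ℝ) / (∏ t, ∏ r ∈ Q t, r : ℕ) ≤ Real.exp (g / 2 +
      (∑ i, ((ℓ i : ℝ) * Real.sqrt X + 9) + ∑ i, ((ℓ' i : ℝ) * Real.sqrt X + 9)) / 2) := by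
  classical
  set f : ℕ → ℝ := fun r => Real.exp (-((Real.log ((reach X ℓ r).card : ℝ)
      + Real.log ((reach X ℓ' r).card : ℝ)) / 2)) / r with hf
  have hf0 : ∀ r, 0 ≤ f r := fun r => by positivity
  have h1 : ∀ Q ∈ s, (1 : ℝ) / (∏ t, ∏ r ∈ Q t, r : ℕ) ≤ Real.exp (g / 2) * ∏ t, ∏ r ∈ Q t, f r := by
    intro Q hQ
    have h2 : ∏ t, ∏ r ∈ Q t, f r = Real.exp (-(∑ t, ∑ r ∈ Q t,
      (Real.log ((reach X ℓ r).card : ℝ) + Real.log ((reach X ℓ' r).card : ℝ))) / 2)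
        * (1 / (∏ t, ∏ r ∈ Q t, r : ℕ)) := by
      push_cast
      rw [one_div, ← Finset.prod_inv_distrib, neg_div, Finset.sum_div, ← Finset.sum_neg_distrib,
        Real.exp_sum, ← Finset.prod_mul_distrib]
      refine Finset.prod_congr rfl fun t _ => ?_
      rw [← Finset.prod_inv_distrib, Finset.sum_div, ← Finset.sum_neg_distrib,
        Real.exp_sum, ← Finset.prod_mul_distrib]
      exact Finset.prod_congr rfl fun r _ => div_eq_mul_inv _ _
    rw [h2, ← mul_assoc, ← Real.exp_add]
    refine le_mul_of_one_le_left (by positivity) (Real.one_le_exp ?_)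
    linarith [(hs Q hQ).2]
  refine (Finset.sum_le_sum h1).trans ?_
  rw [← Finset.mul_sum, Real.exp_add]
  refine mul_le_mul_of_nonneg_left ?_ (Real.exp_pos _).le
  have h3 : s ⊆ Fintype.piFinset fun t => (bulkPrimes X ℓ ℓ' t).powerset := fun Q hQ =>
    Fintype.mem_piFinset.2 fun t => Finset.mem_powerset.2 ((hs Q hQ).1 t)
  refine (Finset.sum_le_sum_of_subset_of_nonneg h3 fun Q _ _ =>
    Finset.prod_nonneg fun t _ => Finset.prod_nonneg fun r _ => hf0 r).trans ?_
  rw [← Finset.prod_univ_sum (fun t => (bulkPrimes X ℓ ℓ' t).powerset) (fun _ q => ∏ r ∈ q, f r)]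
  have h4 : ∀ t ∈ (Finset.univ : Finset (Fin (M + 1) × Fin (M + 1))),
      ∑ q ∈ (bulkPrimes X ℓ ℓ' t).powerset, ∏ r ∈ q, f r
        ≤ Real.exp (∑ r ∈ bulkPrimes X ℓ ℓ' t, f r) := by
    intro t _
    rw [← Finset.prod_one_add]
    exact Real.prod_one_add_le_exp_sum _ hf0
  refine (Finset.prod_le_prod (fun t _ => Finset.sum_nonneg fun q _ =>
    Finset.prod_nonneg fun r _ => hf0 r) h4).trans ?_
  rw [← Real.exp_sum]
  exact Real.exp_le_exp.2 (sum_bulkPrimes_le hX ℓ ℓ')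

theorem prod_map_weight_div {X : ℝ} {M : ℕ} (ℓ ℓ' : Fin (M + 1) → ℕ) (l : List (Label M × ℕ)) :
    (l.map fun t => labelWeight X ℓ ℓ' t.1 / t.2).prod
      = (l.map fun t => labelWeight X ℓ ℓ' t.1).prod / ((l.map Prod.snd).prod : ℕ) := by
  induction l with
  | nil => simp
  | cons t l ih =>
    simp only [List.map_cons, List.prod_cons, ih]
    push_cast
    rw [div_mul_div_comm]

theorem labelWeight_nonneg (X : ℝ) {M : ℕ} (ℓ ℓ' : Fin (M + 1) → ℕ) (t : Label M) :
    0 ≤ labelWeight X ℓ ℓ' t := by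
  refine mul_nonneg ?_ ?_ <;> split_ifs <;> first | positivity

/-- Each list has total weight at least exp g, so inserting the weights at the price exp(-g) brings
the sum into the form handled by `sum_goodLists_le`. -/
theorem sum_tops_le {X : ℝ} (hX : SieveRange X) {M : ℕ} (ℓ ℓ' a b : Fin (M + 1) → ℕ) (n : ℕ)
    (g : ℝ) (s : Finset (List (Label M × ℕ)))
    (hs : ∀ l ∈ s, l ∈ goodLists (stepSet X ℓ ℓ' a b) n ∧
      Real.exp g ≤ (l.map fun t => labelWeight X ℓ ℓ' t.1).prod) :
    ∑ l ∈ s, (1 : ℝ) / ((l.map Prod.snd).prod : ℕ)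
      ≤ Real.exp (-g) * (4 * ((M : ℝ) + 1) ^ 2 * X ^ 17) ^ n := by
  have hX0 : 0 < X := by linarith [hX.large]
  have hf : ∀ t : Label M × ℕ, 0 ≤ labelWeight X ℓ ℓ' t.1 / t.2 := fun t =>
    div_nonneg (labelWeight_nonneg X ℓ ℓ' t.1) (Nat.cast_nonneg _)
  have h1 := sum_goodLists_le hf (c := 4 * ((M : ℝ) + 1) ^ 2 * X ^ 17) (by positivity)
    (sum_stepSet_le hX ℓ ℓ' a b) n
  refine le_trans ?_ (mul_le_mul_of_nonneg_left h1 (Real.exp_pos _).le)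
  rw [Finset.mul_sum]
  refine le_trans (Finset.sum_le_sum (g := fun l => Real.exp (-g) *
    (l.map fun t : Label M × ℕ => labelWeight X ℓ ℓ' t.1 / t.2).prod) fun l hl => ?_)
    (Finset.sum_le_sum_of_subset_of_nonneg (fun l hl => (hs l hl).1) fun l _ _ => ?_)
  · rw [prod_map_weight_div, ← mul_div_assoc]
    refine div_le_div_of_nonneg_right ?_ (Nat.cast_nonneg _)
    rw [Real.exp_neg, ← div_eq_inv_mul, le_div_iff₀ (Real.exp_pos _), one_mul]
    exact (hs l hl).2
  · refine mul_nonneg (Real.exp_pos _).le (List.prod_nonneg fun a ha => ?_)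
    obtain ⟨t, _, rfl⟩ := List.mem_map.1 ha
    exact hf t

theorem exp_sqrt_le_exp_div {X : ℝ} (hX : SieveRange X) :
    Real.exp (Real.sqrt X) ≤ Real.exp X / X := by
  have hX1 := hX.large
  have hX0 : 0 < X := by linarith
  rw [le_div_iff₀ hX0]
  have h2 : 2 * Real.sqrt X ≤ X := by
    have h10 : (2 : ℝ) ≤ Real.sqrt X := Real.le_sqrt_of_sq_le (by linarith)
    nlinarith [Real.mul_self_sqrt hX0.le, Real.sqrt_nonneg X]
  have h3 : X ≤ Real.exp (Real.sqrt X) := by linarith [hX.exp_sqrt]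
  calc Real.exp (Real.sqrt X) * X ≤ Real.exp (Real.sqrt X) * Real.exp (Real.sqrt X) :=
        mul_le_mul_of_nonneg_left h3 (Real.exp_pos _).le
    _ = Real.exp (2 * Real.sqrt X) := by rw [← Real.exp_add]; ring_nf
    _ ≤ Real.exp X := Real.exp_le_exp.2 h2

/-- The three-form sieve with log R = exp(X) / X; cubing it turns X^13 into X^16 exp(-3X). -/
theorem card_topOK_le {X : ℝ} (hX : SieveRange X) {A B : ℕ} {y : ℝ} (hy : 0 ≤ y) (s : Finset ℕ)
    (hs : ∀ r ∈ s, (r : ℝ) ≤ y ∧ TopOK X A B r) :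
    (s.card : ℝ) ≤ y * (X ^ 16 * Real.exp (-(3 * X))) := by
  have hX1 := hX.large
  have hX0 : 0 < X := by linarith
  rcases s.eq_empty_or_nonempty with rfl | ⟨r0, hr0⟩
  · simp; positivity
  obtain ⟨_, h0⟩ := hs r0 hr0
  have h := count_add_sub_one_le hX h0.A_pos h0.B_pos h0.A_le h0.B_le
    (R := Real.exp (Real.exp X / X)) (Real.exp_le_exp.2 (exp_sqrt_le_exp_div hX))
    (Real.exp_le_exp.2 (div_le_self (Real.exp_pos _).le (by linarith))) hy s
    (fun r hr => ⟨(hs r hr).2.ge, (hs r hr).1, (hs r hr).2.prime, (hs r hr).2.primeA,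
      (hs r hr).2.primeB⟩)
  rw [Real.log_exp] at h
  refine h.trans (le_of_eq ?_)
  have e : Real.exp (-(3 * X)) = (Real.exp X ^ 3)⁻¹ := by
    rw [← Real.exp_nat_mul, ← Real.exp_neg]; norm_num
  rw [e]
  field_simp

/-- The smooth parts of the M + 1 rows and M + 1 columns all divide D, so there are at most
d(D)^(2(M + 1)) choices for them. -/
theorem sum_divisors_smooth_le {X : ℝ} (hX : SieveRange X) (M Om : ℕ) (s : Finset ℕ)
    (hs : ∀ D ∈ s, D ∈ (⌊lev X 0⌋₊ + 1).smoothNumbers ∧ D.primeFactorsList.length ≤ Om) :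
    ∑ D ∈ s, ((D.divisors.card : ℝ) ^ (M + 1)) ^ 2 / D
      ≤ 2 ^ (2 * (M + 1) * Om) * Real.exp (Real.sqrt X + 7) := by
  have h1 : ∑ D ∈ s, ((D.divisors.card : ℝ) ^ (M + 1)) ^ 2 / D
      ≤ ∑ D ∈ s, 2 ^ (2 * (M + 1) * Om) * ((1 : ℝ) / D) := by
    refine Finset.sum_le_sum fun D hD => ?_
    obtain ⟨h2, h3⟩ := hs D hD
    have h4 := card_divisors_le_two_pow (Nat.ne_zero_of_mem_smoothNumbers h2)
    have h5 : (D.divisors.card : ℝ) ≤ 2 ^ Om := by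
      exact_mod_cast h4.trans (Nat.pow_le_pow_right (by norm_num) h3)
    rw [mul_one_div]
    refine div_le_div_of_nonneg_right ?_ (Nat.cast_nonneg _)
    rw [← pow_mul]
    refine (pow_le_pow_left₀ (Nat.cast_nonneg _) h5 _).trans (le_of_eq ?_)
    rw [← pow_mul]
    ring_nf
  refine h1.trans ?_
  rw [← Finset.mul_sum]
  refine mul_le_mul_of_nonneg_left ?_ (by positivity)
  refine (sum_smooth_inv_le ⌊lev X 0⌋₊ s fun D hD => (hs D hD).1).trans (Real.exp_le_exp.2 ?_)
  have h3 : 3 ≤ lev X 0 := by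
    have h1 := Real.add_one_le_exp (Real.exp (((0 : ℕ) + 1 : ℝ) * Real.sqrt X))
    have h2 := hX.exp_sqrt
    have h4 := hX.large
    rw [lev]
    push_cast at h1 ⊢
    rw [zero_add, one_mul] at h1 ⊢
    linarith
  have h2 : 2 ≤ ⌊lev X 0⌋₊ := Nat.le_floor (by push_cast; linarith)
  have h5 := sum_inv_prime_le h2
  have h6 : Real.log (Real.log ⌊lev X 0⌋₊) ≤ Real.sqrt X := by
    have := iterLog_two_mono (x := ⌊lev X 0⌋₊) (y := lev X 0) (by exact_mod_cast (by omega))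
      (Nat.floor_le (lev_pos X 0).le)
    rw [iterLog_lev] at this
    rw [iterLog_two] at this
    push_cast at this
    linarith
  linarith

/-- A value is the product of the entries of its decomposition, so it suffices to count
decompositions. The sums are taken from the inside out: largest prime, tops, bulk, distribution of
the smooth part, smooth part; each bound is uniform in the outer variables. -/
theorem card_values_le {X η : ℝ} (hX : SieveRange X) (hη : 0 ≤ η) {M Om : ℕ}
    {ℓ ℓ' : Fin (M + 1) → ℕ} (V : Finset ℕ) (hV : ∀ v ∈ V, ValueData X Om v ∧
      (∃ F, SideData X η (fun n => (n + 1).Prime) ℓ v F) ∧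
      ∃ G, SideData X η (fun n => (n - 1).Prime) ℓ' v G) :
    (V.card : ℝ) ≤ Real.exp (Real.exp X) * (X ^ 16 * Real.exp (-(3 * X))) *
      (Real.exp (-(∑ i ∈ Finset.univ.erase 0, ((ℓ i : ℝ) - 1) * Real.sqrt X
        + ∑ i ∈ Finset.univ.erase 0, ((ℓ' i : ℝ) - 1) * Real.sqrt X)) *
        ((2 * M + 3) * (4 * ((M : ℝ) + 1) ^ 2 * X ^ 17) ^ (2 * (M + 1)))) *
      Real.exp (((Real.sqrt X * ∑ k : Fin (M + 1), (ℓ k : ℝ) * (coeffA k + 1)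
        + ((M : ℝ) + 1) ^ 2 * η) + (Real.sqrt X * ∑ k : Fin (M + 1), (ℓ' k : ℝ) * (coeffA k + 1)
        + ((M : ℝ) + 1) ^ 2 * η)) / 2 +
      (∑ i, ((ℓ i : ℝ) * Real.sqrt X + 9) + ∑ i, ((ℓ' i : ℝ) * Real.sqrt X + 9)) / 2) *
      (2 ^ (2 * (M + 1) * Om) * Real.exp (Real.sqrt X + 7)) := by
  classical
  have hX1 := hX.large
  have hX0 : 0 < X := by linarith
  set x := Real.exp (Real.exp X) with hx
  have hx0 : 0 < x := Real.exp_pos _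
  set K := X ^ 16 * Real.exp (-(3 * X)) with hK
  have hK0 : 0 ≤ K := by positivity
  set ξ := ∑ i ∈ Finset.univ.erase 0, ((ℓ i : ℝ) - 1) * Real.sqrt X
        + ∑ i ∈ Finset.univ.erase 0, ((ℓ' i : ℝ) - 1) * Real.sqrt X with hξ
  set c := 4 * ((M : ℝ) + 1) ^ 2 * X ^ 17 with hc
  have hc1 : 1 ≤ c := by
    have h1 : (1 : ℝ) ≤ ((M : ℝ) + 1) ^ 2 := one_le_pow₀ (by linarith [Nat.cast_nonneg (α := ℝ) M])
    have h2 : (1 : ℝ) ≤ X ^ 17 := one_le_pow₀ (by linarith)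
    rw [hc]
    nlinarith
  set g := (Real.sqrt X * ∑ k : Fin (M + 1), (ℓ k : ℝ) * (coeffA k + 1)
        + ((M : ℝ) + 1) ^ 2 * η) + (Real.sqrt X * ∑ k : Fin (M + 1), (ℓ' k : ℝ) * (coeffA k + 1)
        + ((M : ℝ) + 1) ^ 2 * η) with hg
  set Λ := Real.exp (-ξ) * ((2 * M + 3) * c ^ (2 * (M + 1))) with hΛ
  have hΛ0 : 0 ≤ Λ := by positivity
  set Γ := Real.exp (g / 2 +
      (∑ i, ((ℓ i : ℝ) * Real.sqrt X + 9) + ∑ i, ((ℓ' i : ℝ) * Real.sqrt X + 9)) / 2) with hΓ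
  -- index sets
  set Ds := (range (⌊x⌋₊ + 1)).filter fun D => D ∈ (⌊lev X 0⌋₊ + 1).smoothNumbers ∧
    D.primeFactorsList.length ≤ Om with hDs
  set ds : ℕ → Finset (Fin (M + 1) → ℕ) := fun D => Fintype.piFinset fun _ => D.divisors with hds
  set Qs := (Fintype.piFinset fun t => (bulkPrimes X ℓ ℓ' t).powerset).filter fun Q =>
    ∑ t, ∑ r ∈ Q t, (Real.log ((reach X ℓ r).card : ℝ) + Real.log ((reach X ℓ' r).card : ℝ)) ≤ g
    with hQs
  set Ls : (Fin (M + 1) → ℕ) × (Fin (M + 1) → ℕ) → (Fin (M + 1) × Fin (M + 1) → Finset ℕ) → ℕ →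
      Finset (List (Label M × ℕ)) := fun d Q n =>
    (goodLists (stepSet X ℓ ℓ' (rowBase d.1 Q) (colBase d.2 Q)) n).filter fun l =>
      Real.exp ξ ≤ (l.map fun t => labelWeight X ℓ ℓ' t.1).prod with hLs
  set Rs : ℕ → (Fin (M + 1) → ℕ) × (Fin (M + 1) → ℕ) → (Fin (M + 1) × Fin (M + 1) → Finset ℕ) →
      List (Label M × ℕ) → Finset ℕ := fun D d Q l =>
    (range (⌊x⌋₊ + 1)).filter fun r =>
      (r : ℝ) ≤ x / (D * (∏ t, ∏ r ∈ Q t, r : ℕ) * ((l.map Prod.snd).prod : ℕ)) ∧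
      TopOK X (rowBase d.1 Q 0 * rowProd 0 l) (colBase d.2 Q 0 * colProd 0 l) r with hRs
  -- The cofactors of the tops depend on the bulk and on the distribution of the smooth part, so
  -- these must be chosen before the list, and the largest prime last.
  have hsub : V ⊆ Ds.biUnion fun D => (ds D ×ˢ ds D).biUnion fun d => Qs.biUnion fun Q =>
      (range (2 * (M + 1) + 1)).biUnion fun n => (Ls d Q n).biUnion fun l =>
        (Rs D d Q l).image fun r => D * (∏ t, ∏ r ∈ Q t, r) * (l.map Prod.snd).prod * r := by
    intro v hv
    obtain ⟨hvd, ⟨F, hF⟩, ⟨G, hG⟩⟩ := hV v hv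
    obtain ⟨d, d', Q, n, l, r₀, hdec⟩ := exists_decomposition hX hvd hF hG
    set D := smoothPart (lev X 0) v with hD
    have hD0 : D ≠ 0 := smoothPart_ne_zero _ _
    have hDv : D ∣ v := smoothPart_dvd _ hvd.pos
    have hvpos := Nat.pos_of_ne_zero hvd.pos
    have hle : ∀ {m : ℕ}, m ∣ v → m < ⌊x⌋₊ + 1 := fun {m} hm => Nat.lt_succ_iff.2
      (Nat.le_floor (le_trans (by exact_mod_cast Nat.le_of_dvd hvpos hm) hvd.le))
    simp only [Finset.mem_biUnion, Finset.mem_image]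
    refine ⟨D, ?_, (d, d'), ?_, Q, ?_, n, ?_, l, ?_, r₀, ?_, hdec.eq.symm⟩
    · rw [hDs, Finset.mem_filter, Finset.mem_range]
      refine ⟨hle hDv, Nat.mem_smoothNumbers'.2 fun p hp hpD => ?_, hvd.smooth⟩
      exact Nat.lt_succ_iff.2 (Nat.le_floor (prime_le_of_dvd_smoothPart hp hpD))
    · rw [Finset.mem_product]
      exact ⟨Fintype.mem_piFinset.2 fun i => Nat.mem_divisors.2 ⟨hdec.d_dvd i, hD0⟩,
        Fintype.mem_piFinset.2 fun i => Nat.mem_divisors.2 ⟨hdec.d'_dvd i, hD0⟩⟩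
    · rw [hQs, Finset.mem_filter]
      refine ⟨Fintype.mem_piFinset.2 fun t => Finset.mem_powerset.2 fun r hr => ?_, ?_⟩
      · obtain ⟨h1, h2, h3, h4, h5⟩ := hdec.bulk t r hr
        rw [bulkPrimes, Finset.mem_filter, Finset.mem_range, Nat.lt_succ_iff]
        refine ⟨Nat.le_floor h5, ⟨h1, h2⟩, ?_, ?_⟩
        · simpa [reach] using h3
        · simpa [reach] using h4
      · refine hdec.bulk_le.trans ?_
        rw [Finset.sum_add_distrib]
        exact add_le_add (hF.sum_log_reach_le hη) (hG.sum_log_reach_le hη)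
    · rw [Finset.mem_range]
      have := hdec.n_le
      omega
    · rw [hLs, Finset.mem_filter]
      exact ⟨hdec.mem, hdec.weight⟩
    · rw [hRs, Finset.mem_filter, Finset.mem_range]
      refine ⟨hle (Dvd.intro_left _ hdec.eq.symm), ?_, hdec.top⟩
      have h1 : ((v : ℕ) : ℝ) = (D * (∏ t, ∏ r ∈ Q t, r : ℕ) * ((l.map Prod.snd).prod : ℕ) : ℝ) * r₀ := by
        exact_mod_cast hdec.eq
      have h2 : D * (∏ t, ∏ r ∈ Q t, r) * (l.map Prod.snd).prod ≠ 0 := fun h0 => by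
        have := hdec.eq
        rw [h0, zero_mul] at this
        exact hvd.pos this
      have h3 : (0 : ℝ) < D * (∏ t, ∏ r ∈ Q t, r : ℕ) * ((l.map Prod.snd).prod : ℕ) := by
        exact_mod_cast Nat.pos_of_ne_zero h2
      rw [le_div_iff₀ h3, mul_comm, ← h1]
      exact hvd.le
  refine (Nat.cast_le (α := ℝ).2 (Finset.card_le_card hsub)).trans ?_
  -- the lists
  have hlists : ∀ (D : ℕ) (d : (Fin (M + 1) → ℕ) × (Fin (M + 1) → ℕ))
      (Q : Fin (M + 1) × Fin (M + 1) → Finset ℕ),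
      ((((range (2 * (M + 1) + 1)).biUnion fun n => (Ls d Q n).biUnion fun l =>
        (Rs D d Q l).image fun r => D * (∏ t, ∏ r ∈ Q t, r) * (l.map Prod.snd).prod * r).card : ℕ) : ℝ)
      ≤ x * K * Λ * (1 / D) * (1 / (∏ t, ∏ r ∈ Q t, r : ℕ)) := by
    intro D d Q
    have h1 : ∀ n ∈ range (2 * (M + 1) + 1), ((((Ls d Q n).biUnion fun l =>
        (Rs D d Q l).image fun r => D * (∏ t, ∏ r ∈ Q t, r) * (l.map Prod.snd).prod * r).card : ℕ) : ℝ)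
        ≤ x * K * (1 / D) * (1 / (∏ t, ∏ r ∈ Q t, r : ℕ)) * (Real.exp (-ξ) * c ^ (2 * (M + 1))) := by
      intro n hn
      have h2 := card_biUnion_le_sum (Ls d Q n) (fun l => (Rs D d Q l).image fun r =>
        D * (∏ t, ∏ r ∈ Q t, r) * (l.map Prod.snd).prod * r)
        (fun l => x * K * (1 / D) * (1 / (∏ t, ∏ r ∈ Q t, r : ℕ)) * (1 / ((l.map Prod.snd).prod : ℕ)))
        (fun l _ => by
          refine (Nat.cast_le (α := ℝ).2 Finset.card_image_le).trans ?_
          refine (card_topOK_le hX (by positivity) (Rs D d Q l)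
            (fun r hr => (Finset.mem_filter.1 hr).2)).trans (le_of_eq ?_)
          rw [← hK]
          ring)
      refine h2.trans ?_
      rw [← Finset.mul_sum]
      refine mul_le_mul_of_nonneg_left ?_ (by positivity)
      refine (sum_tops_le hX ℓ ℓ' (rowBase d.1 Q) (colBase d.2 Q) n ξ (Ls d Q n)
        (fun l hl => Finset.mem_filter.1 hl)).trans ?_
      refine mul_le_mul_of_nonneg_left (pow_le_pow_right₀ hc1 ?_) (Real.exp_pos _).le
      rw [Finset.mem_range] at hn
      omega
    refine (card_biUnion_le_sum _ _ _ h1).trans (le_of_eq ?_)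
    rw [Finset.sum_const, Finset.card_range, nsmul_eq_mul, hΛ]
    push_cast
    ring
  have hall : ∀ D ∈ Ds, ((((ds D ×ˢ ds D).biUnion fun d => Qs.biUnion fun Q =>
      (range (2 * (M + 1) + 1)).biUnion fun n => (Ls d Q n).biUnion fun l =>
        (Rs D d Q l).image fun r => D * (∏ t, ∏ r ∈ Q t, r) * (l.map Prod.snd).prod * r).card : ℕ) : ℝ)
      ≤ x * K * Λ * Γ * (((D.divisors.card : ℝ) ^ (M + 1)) ^ 2 / D) := by
    intro D _
    have h1 : ∀ d ∈ ds D ×ˢ ds D, (((Qs.biUnion fun Q =>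
      (range (2 * (M + 1) + 1)).biUnion fun n => (Ls d Q n).biUnion fun l =>
        (Rs D d Q l).image fun r => D * (∏ t, ∏ r ∈ Q t, r) * (l.map Prod.snd).prod * r).card : ℕ) : ℝ)
        ≤ x * K * Λ * (1 / D) * Γ := by
      intro d _
      refine (card_biUnion_le_sum _ _ _ fun Q _ => hlists D d Q).trans ?_
      rw [← Finset.mul_sum]
      refine mul_le_mul_of_nonneg_left ?_ (by positivity)
      refine sum_bulk_le hX ℓ ℓ' g Qs fun Q hQ => ?_
      rw [hQs, Finset.mem_filter] at hQ
      exact ⟨fun t => Finset.mem_powerset.1 (Fintype.mem_piFinset.1 hQ.1 t), hQ.2⟩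
    refine (card_biUnion_le_sum _ _ _ h1).trans (le_of_eq ?_)
    rw [Finset.sum_const, Finset.card_product, nsmul_eq_mul, hds]
    simp only [Fintype.card_piFinset, Finset.prod_const, Finset.card_univ, Fintype.card_fin]
    push_cast
    ring
  refine (card_biUnion_le_sum _ _ _ hall).trans ?_
  rw [← Finset.mul_sum]
  refine mul_le_mul_of_nonneg_left ?_ (by positivity)
  exact sum_divisors_smooth_le hX M Om Ds fun D hD => (Finset.mem_filter.1 hD).2

end CommonValues


namespace CommonValues

open Finset

/-! ### The functions `φ` and `σ` -/

/-- The common properties of `φ` and `σ` that are used; `pr (f p)` records that `p` is prime. -/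
structure ValueFunction (f : ℕ → ℕ) (pr : ℕ → Prop) : Prop where
  eq : f = phi ∨ f = sigma
  map_one : f 1 = 1
  map_mul : ∀ m n : ℕ, Nat.Coprime m n → f (m * n) = f m * f n
  pos : ∀ n, 0 < n → 0 < f n
  le_sq : ∀ n, f n ≤ n ^ 2
  prime_le : ∀ p : ℕ, p.Prime → f p ≤ p + 1
  le_prime : ∀ p : ℕ, p.Prime → p ≤ f p + 1
  mono : ∀ p q : ℕ, p.Prime → q.Prime → p ≤ q → f p ≤ f q
  prime : ∀ p : ℕ, p.Prime → pr (f p)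

theorem sigma_prime {p : ℕ} (hp : p.Prime) : sigma p = p + 1 := by
  have h := ArithmeticFunction.sigma_one_apply p
  rw [sigma, h, hp.sum_divisors, add_comm]

theorem valueFunction_phi : ValueFunction phi (fun n => (n + 1).Prime) where
  eq := Or.inl rfl
  map_one := Nat.totient_one
  map_mul _ _ h := Nat.totient_mul h
  pos _ h := Nat.totient_pos.2 h
  le_sq n := (Nat.totient_le n).trans (Nat.le_self_pow two_ne_zero n)
  prime_le p _ := (Nat.totient_le p).trans (Nat.le_succ p)
  le_prime p hp := by rw [phi, Nat.totient_prime hp]; omega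
  mono p q hp hq h := by rw [phi, phi, Nat.totient_prime hp, Nat.totient_prime hq]; omega
  prime p hp := by rw [phi, Nat.totient_prime hp, Nat.sub_add_cancel hp.one_le]; exact hp

theorem valueFunction_sigma : ValueFunction sigma (fun n => (n - 1).Prime) where
  eq := Or.inr rfl
  map_one := by simp [sigma]
  map_mul _ _ h := ArithmeticFunction.isMultiplicative_sigma.map_mul_of_coprime h
  pos n h := by
    rw [sigma, ArithmeticFunction.sigma_one_apply]
    exact Finset.sum_pos (fun d hd => Nat.pos_of_mem_divisors hd) ⟨1, by simp [h.ne']⟩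
  le_sq n := by
    rw [sigma, ArithmeticFunction.sigma_one_apply, pow_two]
    refine (Finset.sum_le_card_nsmul _ _ n fun d hd => Nat.divisor_le hd).trans ?_
    exact Nat.mul_le_mul_right n (Nat.card_divisors_le_self n)
  prime_le p hp := (sigma_prime hp).le
  le_prime p hp := by rw [sigma_prime hp]; omega
  mono p q hp hq h := by rw [sigma_prime hp, sigma_prime hq]; omega
  prime p hp := by rw [sigma_prime hp]; exact hp

theorem ValueFunction.map_prod {f : ℕ → ℕ} {pr : ℕ → Prop} (hf : ValueFunction f pr)
    (s : Finset ℕ) (hs : ∀ p ∈ s, p.Prime) (g : ℕ → ℕ) :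
    f (∏ p ∈ s, p ^ g p) = ∏ p ∈ s, f (p ^ g p) := by
  induction s using Finset.induction_on with
  | empty => simpa using hf.map_one
  | insert a s ha ih =>
    rw [Finset.prod_insert ha, Finset.prod_insert ha, hf.map_mul,
      ih fun p hp => hs p (Finset.mem_insert_of_mem hp)]
    refine Nat.Coprime.prod_right fun p hp => Nat.Coprime.pow _ _ ?_
    exact (Nat.coprime_primes (hs a (Finset.mem_insert_self a s))
      (hs p (Finset.mem_insert_of_mem hp))).2 fun h => ha (h ▸ hp)

/-! ### The prime factors in decreasing order -/

theorem primeAt_of_lt {n i : ℕ} (hi : i < bigOmega n) :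
    (primeAt n i).Prime ∧ primeAt n i ∣ n := by
  have h1 : i < n.primeFactorsList.reverse.length := by rwa [List.length_reverse]
  have h2 : primeAt n i ∈ n.primeFactorsList := by
    rw [primeAt, List.getD_eq_getElem _ _ h1, ← List.mem_reverse]
    exact List.getElem_mem h1
  exact ⟨Nat.prime_of_mem_primeFactorsList h2, Nat.dvd_of_mem_primeFactorsList h2⟩

theorem primeAt_antitone {n i j : ℕ} (hij : i ≤ j) (hj : j < bigOmega n) :
    primeAt n j ≤ primeAt n i := by
  have h1 : j < n.primeFactorsList.reverse.length := by rwa [List.length_reverse]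
  have h2 : n.primeFactorsList.reverse.Pairwise (fun a b => b ≤ a) := by
    rw [List.pairwise_reverse]
    exact (Nat.primeFactorsList_sorted n).pairwise
  rw [primeAt, primeAt, List.getD_eq_getElem _ _ h1, List.getD_eq_getElem _ _ (hij.trans_lt h1)]
  rcases hij.eq_or_lt with rfl | h
  · exact le_rfl
  · exact List.pairwise_iff_getElem.1 h2 i j _ h1 h

theorem exists_primeAt_eq {n p : ℕ} (hp : p.Prime) (hn : n ≠ 0) (h : p ∣ n) :
    ∃ i < bigOmega n, primeAt n i = p := by
  have h1 : p ∈ n.primeFactorsList.reverse :=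
    List.mem_reverse.2 ((Nat.mem_primeFactorsList hn).2 ⟨hp, h⟩)
  obtain ⟨i, hi, rfl⟩ := List.getElem_of_mem h1
  refine ⟨i, by rwa [List.length_reverse] at hi, ?_⟩
  rw [primeAt, List.getD_eq_getElem _ _ hi]

theorem sq_dvd_of_primeAt_eq {n i j : ℕ} (hij : i < j) (hj : j < bigOmega n)
    (h : primeAt n i = primeAt n j) : primeAt n i ^ 2 ∣ n := by
  have h1 : j < n.primeFactorsList.reverse.length := by rwa [List.length_reverse]
  have hn : n ≠ 0 := by rintro rfl; simp [bigOmega] at hj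
  set l := n.primeFactorsList.reverse with hl
  have hp := (primeAt_of_lt hj).1
  rw [h]
  rw [hp.pow_dvd_iff_le_factorization hn, ← Nat.primeFactorsList_count_eq,
    ← List.count_reverse, ← hl]
  have h2 : [primeAt n j, primeAt n j].Sublist l := by
    have h3 : [l[i]'(hij.trans h1), l[j]].Sublist l := by
      have := List.map_getElem_sublist (l := l) (is := [⟨i, hij.trans h1⟩, ⟨j, h1⟩])
        (by simpa using hij)
      simpa using this
    have e1 : primeAt n i = l[i]'(hij.trans h1) := List.getD_eq_getElem _ _ _
    have e2 : primeAt n j = l[j] := List.getD_eq_getElem _ _ _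
    rw [← e1, ← e2, h] at h3
    exact h3
  have := h2.count_le (primeAt n j)
  simpa using this

/-- The prime factors are in decreasing order: if p_i = 2 then all later ones are 2 as well, leaving
at most i odd ones. -/
theorem two_lt_primeAt {n L i : ℕ} (h : L + 1 ≤ (n.primeFactorsList.filter (fun p => p ≠ 2)).length)
    (hi : i ≤ L) : i < bigOmega n ∧ 2 < primeAt n i := by
  have h0 : i < bigOmega n := by
    have := List.length_filter_le (fun p => decide (p ≠ 2)) n.primeFactorsList
    rw [bigOmega]; omega
  refine ⟨h0, ?_⟩
  by_contra hlt
  have h1 : i < n.primeFactorsList.reverse.length := by rwa [List.length_reverse]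
  set l := n.primeFactorsList.reverse with hl
  have h2 : (l.filter (fun p => p ≠ 2)).length
      = (n.primeFactorsList.filter (fun p => p ≠ 2)).length := by
    rw [hl, List.filter_reverse, List.length_reverse]
  rw [← h2, ← List.take_append_drop i l, List.filter_append, List.length_append] at h
  have h3 : (l.drop i).filter (fun p => p ≠ 2) = [] := by
    rw [List.filter_eq_nil_iff]
    intro p hp
    obtain ⟨k, hk, rfl⟩ := List.getElem_of_mem hp
    rw [List.length_drop] at hk
    have hk' : i + k < bigOmega n := by
      have : l.length = bigOmega n := by rw [hl, List.length_reverse, bigOmega]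
      omega
    have h4 := primeAt_antitone (n := n) (Nat.le_add_right i k) hk'
    have h5 := (primeAt_of_lt hk').1.two_le
    have e : primeAt n (i + k) = l[i + k] := List.getD_eq_getElem _ _ _
    rw [List.getElem_drop, ← e]
    have : primeAt n (i + k) = 2 := by omega
    simpa using this
  have h4 := List.length_filter_le (fun p => decide (p ≠ 2)) (l.take i)
  have h5 := List.length_take_le i l
  rw [h3, List.length_nil] at h
  omega

/-! ### Counting prime factors in an interval -/

theorem bigOmegaBetween_eq (n : ℕ) (U T : ℝ) : (bigOmegaBetween n U T) =
    n.factorization.sum fun p k => by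
      classical exact if U < (p : ℝ) ∧ (p : ℝ) ≤ T then k else 0 := by
  classical
  rw [bigOmegaBetween, Finsupp.sum, Nat.support_factorization, ← Finset.sum_filter]

theorem bigOmegaBetween_mul {m n : ℕ} (hm : m ≠ 0) (hn : n ≠ 0) (U T : ℝ) :
    bigOmegaBetween (m * n) U T = bigOmegaBetween m U T + bigOmegaBetween n U T := by
  classical
  rw [bigOmegaBetween_eq, bigOmegaBetween_eq, bigOmegaBetween_eq, Nat.factorization_mul hm hn]
  refine Finsupp.sum_add_index' (fun _ => by simp) fun p a b => ?_
  split_ifs <;> rfl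

theorem bigOmegaBetween_one (U T : ℝ) : bigOmegaBetween 1 U T = 0 := by
  simp [bigOmegaBetween]

theorem bigOmegaBetween_prod {ι : Type*} (s : Finset ι) (F : ι → ℕ) (hF : ∀ i ∈ s, F i ≠ 0)
    (U T : ℝ) : bigOmegaBetween (∏ i ∈ s, F i) U T = ∑ i ∈ s, bigOmegaBetween (F i) U T := by
  classical
  induction s using Finset.induction_on with
  | empty => simp [bigOmegaBetween_one]
  | insert a s ha ih =>
    rw [Finset.prod_insert ha, Finset.sum_insert ha, bigOmegaBetween_mul
      (hF a (Finset.mem_insert_self a s)) (Finset.prod_ne_zero_iff.2 fun i hi =>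
        hF i (Finset.mem_insert_of_mem hi)), ih fun i hi => hF i (Finset.mem_insert_of_mem hi)]

theorem bigOmega_eq_sum (n : ℕ) : bigOmega n = ∑ p ∈ n.primeFactors, n.factorization p := by
  rw [bigOmega, ← ArithmeticFunction.cardFactors_apply,
    ArithmeticFunction.cardFactors_eq_sum_factorization]
  rfl

theorem bigOmegaBetween_le_bigOmega (n : ℕ) (U T : ℝ) : bigOmegaBetween n U T ≤ bigOmega n := by
  rw [bigOmega_eq_sum, bigOmegaBetween]
  exact Finset.sum_le_sum_of_subset (Finset.filter_subset _ _)

theorem bigOmegaBetween_add {n : ℕ} {U V T : ℝ} (h1 : U ≤ V) (h2 : V ≤ T) :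
    bigOmegaBetween n U T = bigOmegaBetween n U V + bigOmegaBetween n V T := by
  classical
  rw [bigOmegaBetween_eq, bigOmegaBetween_eq, bigOmegaBetween_eq, Finsupp.sum, Finsupp.sum,
    Finsupp.sum, ← Finset.sum_add_distrib]
  refine Finset.sum_congr rfl fun p _ => ?_
  by_cases hV : (p : ℝ) ≤ V
  · have h3 : ¬ V < (p : ℝ) := not_lt.2 hV
    simp [hV, h3, hV.trans h2]
  · have h3 := not_le.1 hV
    simp [hV, h3, h1.trans_lt h3]

theorem length_primeFactorsList_smoothPart {w : ℝ} {n : ℕ} :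
    (smoothPart w n).primeFactorsList.length = bigOmegaBetween n 1 w := by
  classical
  have e := bigOmega_eq_sum (smoothPart w n)
  rw [bigOmega] at e
  rw [e, smoothPart]
  have h1 : ∀ p ∈ n.primeFactors.filter (fun p : ℕ => (p : ℝ) ≤ w), p.Prime := fun p hp =>
    Nat.prime_of_mem_primeFactors (Finset.mem_filter.1 hp).1
  have h2 : (∏ p ∈ n.primeFactors with ((p : ℕ) : ℝ) ≤ w, p ^ n.factorization p)
      = (Finsupp.filter (fun p : ℕ => (p : ℝ) ≤ w) n.factorization).prod fun p k => p ^ k := by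
    rw [Finsupp.prod, Finsupp.support_filter, Nat.support_factorization]
    refine Finset.prod_congr rfl fun p hp => ?_
    rw [Finsupp.filter_apply_pos (fun p : ℕ => (p : ℝ) ≤ w) _ (Finset.mem_filter.1 hp).2]
  rw [h2, ← Nat.support_factorization, Nat.prod_pow_factorization_eq_self fun p hp => ?_]
  · rw [Finsupp.support_filter, Nat.support_factorization, bigOmegaBetween]
    refine Finset.sum_congr ?_ fun p hp => ?_
    · refine Finset.filter_congr fun p hp => ?_
      have : (1 : ℝ) < p := by exact_mod_cast (Nat.prime_of_mem_primeFactors hp).one_lt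
      simp [this]
    · exact Finsupp.filter_apply_pos (fun p : ℕ => (p : ℝ) ≤ w) _ (Finset.mem_filter.1 hp).2.2
  · rw [Finsupp.support_filter, Nat.support_factorization] at hp
    exact h1 p hp

theorem bigOmega_le_of_dvd {m n : ℕ} (hn : n ≠ 0) (h : m ∣ n) : bigOmega m ≤ bigOmega n := by
  have hm : m ≠ 0 := fun h0 => hn (by rw [h0] at h; exact zero_dvd_iff.1 h)
  rw [bigOmega_eq_sum, bigOmega_eq_sum]
  exact (Finset.sum_le_sum fun p _ => (Nat.factorization_le_iff_dvd hm hn).2 h p).trans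
    (Finset.sum_le_sum_of_subset (Nat.primeFactors_mono h hn))

theorem log_le_bigOmega_mul {n : ℕ} {B : ℝ} (hn : n ≠ 0)
    (h : ∀ p : ℕ, p.Prime → p ∣ n → Real.log p ≤ B) : Real.log n ≤ bigOmega n * B := by
  have h1 : Real.log n = ∑ p ∈ n.primeFactors, n.factorization p * Real.log p := by
    conv_lhs => rw [← Nat.prod_factorization_pow_eq_self hn]
    rw [Finsupp.prod, Nat.support_factorization, Nat.cast_prod, Real.log_prod]
    · exact Finset.sum_congr rfl fun p _ => by rw [Nat.cast_pow, Real.log_pow]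
    · intro p hp
      exact_mod_cast pow_ne_zero _ (Nat.prime_of_mem_primeFactors hp).ne_zero
  rw [h1, bigOmega_eq_sum, Nat.cast_sum, Finset.sum_mul]
  refine Finset.sum_le_sum fun p hp => mul_le_mul_of_nonneg_left
    (h p (Nat.prime_of_mem_primeFactors hp) (Nat.dvd_of_mem_primeFactors hp)) (Nat.cast_nonneg _)

theorem bigOmega_mul_log_two_le {n : ℕ} (hn : n ≠ 0) : bigOmega n * Real.log 2 ≤ Real.log n := by
  have h1 : 2 ^ bigOmega n ≤ n := by
    conv_rhs => rw [← Nat.prod_primeFactorsList hn]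
    rw [bigOmega]
    exact List.pow_card_le_prod _ _ fun p hp => (Nat.prime_of_mem_primeFactorsList hp).two_le
  rw [← Real.log_pow]
  exact Real.log_le_log (by positivity) (by exact_mod_cast h1)

end CommonValues


namespace CommonValues

open Finset

/-! ### Decay of the last coordinate in the simplex -/

theorem sum_Icc_one_eq_sum_range (g : ℕ → ℝ) (n : ℕ) :
    ∑ j ∈ Finset.Icc 1 n, g j = ∑ j ∈ Finset.range n, g (j + 1) := by
  induction n with
  | zero => simp
  | succ n ih => rw [Finset.sum_Icc_succ_top (by omega), ih, Finset.sum_range_succ]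

theorem InSimplex.le_of_le {L : ℕ} {ξ z : ℕ → ℝ} (hz : InSimplex L ξ z) {i j : ℕ} (hi : 1 ≤ i)
    (hij : i ≤ j) (hj : j ≤ L) : z j ≤ z i := by
  induction j, hij using Nat.le_induction with
  | base => exact le_rfl
  | succ j hij ih => exact (hz.antitone j (by omega) (by omega)).trans (ih (by omega))

theorem InSimplex.nonneg {L : ℕ} {ξ z : ℕ → ℝ} (hz : InSimplex L ξ z) {i : ℕ} (hi : 1 ≤ i)
    (hj : i ≤ L) : 0 ≤ z i := hz.last_nonneg.trans (hz.le_of_le hi hj le_rfl)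

theorem coeffA_succ_nonneg (n : ℕ) : 0 ≤ coeffA (n + 1) := by
  linarith [(coeffA_succ_bounds n).1]

/-- Read backwards from z_L, the simplex inequalities say that ξ_i z_i is at least the combination
of the later coordinates with coefficients a_j. If these already grow like t^k and the partial sum
of F(1/t) exceeds ξ_i, the growth propagates. The factor t^(-J) covers the first J steps, where
monotonicity suffices. -/
theorem InSimplex.growth {L : ℕ} {ξ z : ℕ → ℝ} (hz : InSimplex L ξ z) {t δ : ℝ} {J : ℕ}
    (hJ : 1 ≤ J) (ht : 1 ≤ t) (hδ : 0 < δ)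
    (hsum : 1 + δ ≤ ∑ j ∈ Finset.range J, coeffA (j + 1) * t⁻¹ ^ (j + 1))
    (hξ : ∀ i, 1 ≤ i → i + 2 ≤ L → ξ i ≤ 1 + δ) (k : ℕ) (hk : k + 1 ≤ L) :
    z L * t⁻¹ ^ J * t ^ k ≤ z (L - k) := by
  have ht0 : 0 < t := by linarith
  induction k using Nat.strong_induction_on with
  | _ k ih =>
  by_cases hkJ : k ≤ J
  · refine le_trans ?_ (hz.le_of_le (i := L - k) (by omega) (by omega) le_rfl)
    rw [mul_assoc]
    refine mul_le_of_le_one_right hz.last_nonneg ?_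
    rw [inv_pow, inv_mul_le_iff₀ (by positivity), mul_one]
    exact pow_le_pow_right₀ ht hkJ
  · have hkJ' : J < k := not_le.1 hkJ
    have h1 := hz.ineq (L - k) (by omega) (by omega)
    rw [Nat.sub_sub_self (by omega), sum_Icc_one_eq_sum_range] at h1
    have h2 : ∑ j ∈ Finset.range J, coeffA (j + 1) * z (L - k + (j + 1))
        ≤ ∑ j ∈ Finset.range k, coeffA (j + 1) * z (L - k + (j + 1)) := by
      refine Finset.sum_le_sum_of_subset_of_nonneg
        (Finset.range_subset_range.2 hkJ'.le) fun j hj _ => ?_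
      rw [Finset.mem_range] at hj
      exact mul_nonneg (coeffA_succ_nonneg j) (hz.nonneg (by omega) (by omega))
    have h3 : ∑ j ∈ Finset.range J, coeffA (j + 1) * t⁻¹ ^ (j + 1) * (z L * t⁻¹ ^ J * t ^ k)
        ≤ ∑ j ∈ Finset.range J, coeffA (j + 1) * z (L - k + (j + 1)) := by
      refine Finset.sum_le_sum fun j hj => ?_
      rw [Finset.mem_range] at hj
      have h4 := ih (k - (j + 1)) (by omega) (by omega)
      rw [show L - (k - (j + 1)) = L - k + (j + 1) by omega] at h4
      rw [mul_assoc]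
      refine mul_le_mul_of_nonneg_left (le_trans (le_of_eq ?_) h4) (coeffA_succ_nonneg j)
      have e : t ^ k = t ^ (k - (j + 1)) * t ^ (j + 1) := by
        rw [← pow_add, Nat.sub_add_cancel (by omega)]
      rw [e, inv_pow t (j + 1)]
      field_simp
    rw [← Finset.sum_mul] at h3
    have h5 : 0 ≤ z L * t⁻¹ ^ J * t ^ k := mul_nonneg (mul_nonneg hz.last_nonneg (by positivity))
      (by positivity)
    have h6 := mul_le_mul_of_nonneg_right hsum h5
    have h7 := mul_le_mul_of_nonneg_right (hξ (L - k) (by omega) (by omega))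
      (hz.nonneg (i := L - k) (by omega) (by omega))
    have h8 : (1 + δ) * (z L * t⁻¹ ^ J * t ^ k) ≤ (1 + δ) * z (L - k) := by linarith
    exact le_of_mul_le_mul_left h8 (by linarith)

theorem rho_spec : (0 < rho ∧ rho < 1) ∧ seriesF rho = 1 := existsUnique_rho.choose_spec.1

theorem neg_log_rho_pos : 0 < -Real.log rho := by
  have := Real.log_neg rho_spec.1.1 rho_spec.1.2
  linarith

theorem two_mul_constC_mul : 2 * constC * (-Real.log rho) = 1 := by
  have h := neg_log_rho_pos
  have h' : Real.log rho ≠ 0 := fun h0 => by simp [h0] at h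
  rw [constC, abs_of_neg (by linarith)]
  field_simp

theorem constC_pos : 0 < constC := by
  have h := neg_log_rho_pos
  rw [constC, abs_of_neg (by linarith)]
  positivity

/-- F is strictly increasing and F(ρ) = 1, so F(1/t) > 1 as soon as 1/t > ρ, and some partial sum
already exceeds 1. -/
theorem exists_partial_sum_gt {t : ℝ} (ht : 1 < t) (ht' : t * rho < 1) :
    ∃ δ > 0, ∃ J ≥ 1, 1 + δ ≤ ∑ j ∈ Finset.range J, coeffA (j + 1) * t⁻¹ ^ (j + 1) := by
  have h0 : 0 < t⁻¹ := by positivity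
  have h1 : t⁻¹ < 1 := inv_lt_one_of_one_lt₀ ht
  have h2 : rho < t⁻¹ := by
    rw [lt_inv_comm₀ rho_spec.1.1 (by linarith), ← one_div, lt_div_iff₀ rho_spec.1.1]
    exact ht'
  have h3 : 1 < seriesF t⁻¹ := by
    rw [← rho_spec.2]
    exact seriesF_strictMonoOn ⟨rho_spec.1.1.le, rho_spec.1.2⟩ ⟨h0.le, h1⟩ h2
  have h4 := (seriesF_summable h0.le h1).hasSum.tendsto_sum_nat
  have h5 := h4.eventually (lt_mem_nhds (a := 1 + (seriesF t⁻¹ - 1) / 2) (by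
    change _ < seriesF t⁻¹
    linarith))
  obtain ⟨J, hJ, hJ1⟩ := (h5.and (eventually_ge_atTop 1)).exists
  exact ⟨(seriesF t⁻¹ - 1) / 2, by linarith, J, hJ1, hJ.le⟩

/-! ### Admissible values of the parameter -/

/-- What is required of a large `x`, with `X = log log x`. -/
structure LargeParam (x : ℝ) : Prop where
  range : SieveRange (iterLog 2 x)
  exp_exp : Real.exp (Real.exp (iterLog 2 x)) = x
  one_le : 1 ≤ paramL x
  log_le : 36 * Real.log (iterLog 2 x) ≤ Real.sqrt (iterLog 2 x)
  last_le : ∀ z, InSimplex (paramL x) (xi x) z →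
    iterLog 2 x * z (paramL x) ≤ Real.sqrt (iterLog 2 x) - 1
  le_log : (paramL x : ℝ) ≤ 2 * constC * Real.log (iterLog 2 x)

theorem tendsto_iterLog_two : Tendsto (iterLog 2) atTop atTop :=
  Real.tendsto_log_atTop.comp Real.tendsto_log_atTop

/-- A lower bound for `L` in terms of `u = log_3 x`. -/
theorem le_paramL (x : ℝ) : 2 * constC * (iterLog 3 x - iterLog 4 x)
    - 2 - 2 * Real.sqrt (iterLog 3 x) ≤ paramL x := by
  have h1 := Int.lt_floor_add_one (2 * constC * (iterLog 3 x - iterLog 4 x))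
  have h2 := Nat.lt_floor_add_one ((L0 x : ℝ) - 2 * Real.sqrt (iterLog 3 x))
  rw [← paramL] at h2
  rw [L0] at h2
  linarith

theorem paramL_le {x : ℝ} (h : 1 ≤ paramL x) :
    (paramL x : ℝ) ≤ (L0 x : ℝ) - 2 * Real.sqrt (iterLog 3 x) := by
  rw [paramL] at h ⊢
  exact Nat.floor_le (by
    have := Nat.floor_pos.1 h
    linarith)

theorem log_add_sqrt_le (a b c d : ℝ) (hd : 0 < d) :
    ∀ᶠ u : ℝ in atTop, a + b * Real.log u + c * Real.sqrt u ≤ d * u := by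
  have h1 : (fun u : ℝ => a + b * Real.log u + c * Real.sqrt u) =o[atTop] (fun u : ℝ => u) := by
    refine (Asymptotics.IsLittleO.add ?_ ?_).add ?_
    · exact (Asymptotics.isLittleO_const_id_atTop a)
    · exact Real.isLittleO_log_id_atTop.const_mul_left b
    · refine Asymptotics.IsLittleO.const_mul_left ?_ c
      refine Asymptotics.isLittleO_of_tendsto' ?_ ?_
      · filter_upwards [eventually_gt_atTop 0] with u hu h0
        exact absurd h0 hu.ne'
      · refine (tendsto_inv_atTop_zero.comp Real.tendsto_sqrt_atTop).congr' ?_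
        filter_upwards [eventually_gt_atTop 0] with u hu
        rw [Function.comp, Real.sqrt_div_self]
  filter_upwards [h1.bound hd, eventually_ge_atTop 0] with u hu hu0
  rw [Real.norm_eq_abs, Real.norm_eq_abs, abs_of_nonneg hu0] at hu
  exact (le_abs_self _).trans hu

/-- Growth at rate t = ρ^(-3/4) from z_L up to z_1 ≤ 1 over L ≈ log X / |log ρ| steps forces z_L ≤
X^(-3/4 + o(1)); thus X z_L is at most X^(3/8), well below √X. -/
theorem eventually_last_le : ∀ᶠ x : ℝ in atTop, ∀ z, InSimplex (paramL x) (xi x) z →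
    1 ≤ paramL x → iterLog 2 x * z (paramL x) ≤ Real.sqrt (iterLog 2 x) - 1 := by
  set lam := -Real.log rho with hlam
  have hlam0 : 0 < lam := neg_log_rho_pos
  -- Any exponent strictly between 1/2 and 1 would serve: below 1 to get t ρ < 1, above 1/2 to end
  -- below √X.
  set t := Real.exp (3 / 4 * lam) with ht
  have ht1 : 1 < t := Real.one_lt_exp_iff.2 (by positivity)
  have htr : t * rho < 1 := by
    rw [ht, ← Real.exp_log rho_spec.1.1, ← Real.exp_add, Real.exp_lt_one_iff]
    linarith
  obtain ⟨δ, hδ, J, hJ, hsum⟩ := exists_partial_sum_gt ht1 htr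
  have hu : Tendsto (iterLog 3) atTop atTop := Real.tendsto_log_atTop.comp tendsto_iterLog_two
  have e1 := hu.eventually (log_add_sqrt_le (3 / 4 * lam * (J + 1) + 3 / 2 * lam) (3 / 4)
    (3 / 2 * lam) (1 / 8) (by norm_num))
  have e2 := hu.eventually (eventually_ge_atTop (max 16 (1 / δ ^ 2)))
  filter_upwards [e1, e2, tendsto_iterLog_two.eventually_ge_atTop 1] with x h1 h2 hX z hz hL
  set u := iterLog 3 x with hu
  set X := iterLog 2 x with hXd
  have hu16 : 16 ≤ u := (le_max_left _ _).trans h2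
  have hXu : X = Real.exp u := by
    rw [hu, hXd, show iterLog 3 x = Real.log (iterLog 2 x) from rfl, Real.exp_log]
    linarith
  have hLle := paramL_le hL
  have hsq : 1 / δ ≤ Real.sqrt u := by
    rw [Real.le_sqrt (by positivity) (by linarith)]
    rw [div_pow, one_pow]
    exact (le_max_right _ _).trans h2
  -- L stays 2√(log_3 x) below L_0, so every L_0 - i occurring here is large and ξ_i is close to 1.
  have hxi : ∀ i, 1 ≤ i → i + 2 ≤ paramL x → xi x i ≤ 1 + δ := by
    intro i _ hi
    have h3 : (i : ℝ) + 2 ≤ paramL x := by exact_mod_cast hi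
    set y := (L0 x : ℝ) - i with hy
    have h4 : 2 * Real.sqrt u + 2 ≤ y := by linarith
    have h5 : 1 ≤ y := by linarith [Real.sqrt_nonneg u]
    have h6 : 1 / δ ≤ 10 * y ^ 3 := by
      have : y ≤ y ^ 3 := le_self_pow₀ h5 (by norm_num)
      linarith [Real.sqrt_nonneg u]
    rw [xi, ← hy]
    have h7 : 1 / (10 * y ^ 3) ≤ δ := by
      rw [div_le_iff₀ (by positivity)]
      rw [div_le_iff₀ hδ] at h6
      linarith
    linarith
  have h3 := hz.growth hJ ht1.le hδ hsum hxi (paramL x - 1) (by omega)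
  rw [show paramL x - (paramL x - 1) = 1 by omega] at h3
  have h4 := h3.trans hz.first_le_one
  have h5 : t⁻¹ ^ J * t ^ (paramL x - 1)
      = Real.exp (3 / 4 * lam * (paramL x - 1) - 3 / 4 * lam * J) := by
    rw [ht, ← Real.exp_neg, ← Real.exp_nat_mul, ← Real.exp_nat_mul, ← Real.exp_add,
      Nat.cast_sub hL, Nat.cast_one]
    congr 1
    ring
  rw [mul_assoc, h5] at h4
  have h6 := le_paramL x
  rw [show iterLog 4 x = Real.log u from rfl, ← hu] at h6
  have hC : 2 * constC * lam = 1 := two_mul_constC_mul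
  have h7 : u - Real.log u - 2 * lam - 2 * lam * Real.sqrt u ≤ lam * paramL x := by
    have := mul_le_mul_of_nonneg_left h6 hlam0.le
    have e : lam * (2 * constC * (u - Real.log u) - 2 - 2 * Real.sqrt u)
      = (2 * constC * lam) * (u - Real.log u) - 2 * lam - 2 * lam * Real.sqrt u := by ring
    rw [e, hC] at this
    linarith
  have h8 : X * z (paramL x) ≤ Real.exp (3 / 8 * u) := by
    have h9 : z (paramL x) ≤ Real.exp (-(3 / 4 * lam * (paramL x - 1) - 3 / 4 * lam * J)) := by
      rw [Real.exp_neg, ← one_div, le_div_iff₀ (Real.exp_pos _)]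
      exact h4
    have h10 := mul_le_mul_of_nonneg_left h9 (Real.exp_pos u).le
    rw [hXu]
    refine h10.trans ?_
    rw [← Real.exp_add]
    refine Real.exp_le_exp.2 ?_
    linarith
  have h9 : Real.sqrt X = Real.exp (1 / 8 * u) * Real.exp (3 / 8 * u) := by
    rw [hXu, ← Real.exp_add, Real.sqrt_eq_iff_mul_self_eq (Real.exp_pos _).le (Real.exp_pos _).le,
      ← Real.exp_add]
    congr 1
    ring
  have h10 : 2 ≤ Real.exp (1 / 8 * u) := by
    linarith [Real.add_one_le_exp (1 / 8 * u)]
  have h11 : 1 ≤ Real.exp (3 / 8 * u) := Real.one_le_exp (by linarith)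
  rw [h9]
  nlinarith

theorem eventually_largeParam : ∀ᶠ x : ℝ in atTop, LargeParam x := by
  have hu : Tendsto (iterLog 3) atTop atTop := Real.tendsto_log_atTop.comp tendsto_iterLog_two
  have e1 := hu.eventually (log_add_sqrt_le 3 (2 * constC) 2 (2 * constC)
    (by linarith [constC_pos]))
  have e2 := hu.eventually_ge_atTop 1
  have e4 : ∀ᶠ u : ℝ in atTop, 36 * u ≤ Real.exp (1 / 2 * u) := by
    have := (isLittleO_pow_exp_pos_mul_atTop (k := 1) (b := 1 / 2) (by norm_num)).bound
      (c := 1 / 36) (by norm_num)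
    filter_upwards [this, eventually_ge_atTop 0] with u h1 h2
    simp only [pow_one, Real.norm_eq_abs, abs_of_nonneg h2, Real.abs_exp] at h1
    linarith
  filter_upwards [tendsto_iterLog_two.eventually eventually_sieveRange, e1, e2,
    hu.eventually e4, eventually_last_le,
    Real.tendsto_log_atTop.eventually_gt_atTop 0, eventually_gt_atTop 0] with x h1 h2 h3 h4 h5 h6 h7
  have hone : 1 ≤ paramL x := by
    have := le_paramL x
    rw [show iterLog 4 x = Real.log (iterLog 3 x) from rfl] at this
    have : (1 : ℝ) ≤ paramL x := by linarith
    exact_mod_cast this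
  have h8 := h1.large
  have e5 : iterLog 3 x = Real.log (iterLog 2 x) := rfl
  refine ⟨h1, ?_, hone, ?_, fun z hz => h5 z hz hone, ?_⟩
  · rw [iterLog_two, Real.exp_log h6, Real.exp_log h7]
  · rw [← e5]
    refine h4.trans (le_of_eq ?_)
    rw [e5, Real.sqrt_eq_rpow, Real.rpow_def_of_pos (by linarith), mul_comm]
  · have h9 := paramL_le hone
    have h10 := Int.floor_le (2 * constC * (iterLog 3 x - iterLog 4 x))
    rw [← L0] at h10
    rw [← e5]
    have h11 : 0 ≤ iterLog 4 x := Real.log_nonneg h3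
    have := mul_nonneg constC_pos.le h11
    linarith [Real.sqrt_nonneg (iterLog 3 x)]

end CommonValues


namespace CommonValues

open Finset

/-! ### The factorization of a value at a good integer -/

theorem lev_zero (X : ℝ) : lev X 0 = Real.exp (Real.exp (Real.sqrt X)) := by
  simp [lev]

theorem iterLog_two_succ_le {p : ℕ} (hp : 2 < p) :
    iterLog 2 ((p : ℝ) + 1) ≤ iterLog 2 p + 1 := by
  have h3 : (3 : ℝ) ≤ p := by exact_mod_cast hp
  have h1 : Real.log ((p : ℝ) + 1) ≤ 2 * Real.log p := by
    rw [← Real.log_rpow (by linarith)]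
    refine Real.log_le_log (by linarith) ?_
    rw [Real.rpow_two]
    nlinarith
  have h2 : 0 < Real.log p := Real.log_pos (by linarith)
  have h4 : 0 < Real.log ((p : ℝ) + 1) := Real.log_pos (by linarith)
  have h5 := Real.log_le_log h4 h1
  rw [Real.log_mul two_ne_zero h2.ne'] at h5
  rw [iterLog_two, iterLog_two]
  linarith [Real.log_two_lt_d9]

theorem squarefull_pow {p k : ℕ} (hp : p.Prime) (hk : 2 ≤ k) : Squarefull (p ^ k) := by
  intro q hq h
  rw [(Nat.prime_dvd_prime_iff_eq hq hp).1 (hq.dvd_of_dvd_pow h)]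
  exact pow_dvd_pow p hk

theorem iterLog_paramS (x : ℝ) : iterLog 2 (paramS x) = 36 * Real.log (iterLog 2 x) := by
  rw [iterLog_two, paramS, Real.log_exp, Real.log_pow]
  norm_num

theorem one_le_paramS (x : ℝ) : 1 ≤ paramS x := by
  have : 0 ≤ iterLog 2 x ^ 36 := Even.pow_nonneg (by decide) _
  exact Real.one_le_exp this

namespace LargeParam

variable {x : ℝ}

theorem sqrt_ge (hx : LargeParam x) : 10 ≤ Real.sqrt (iterLog 2 x) := by
  rw [Real.le_sqrt (by norm_num) (by linarith [hx.range.large])]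
  linarith [hx.range.large]

theorem log_eq (hx : LargeParam x) : Real.log x = Real.exp (iterLog 2 x) := by
  conv_lhs => rw [← hx.exp_exp, Real.log_exp]

theorem exp_four_le (hx : LargeParam x) : Real.exp (4 * iterLog 2 x) + 2 ≤ lev (iterLog 2 x) 0 := by
  set X := iterLog 2 x
  have h1 := hx.range.exp_sqrt
  have h2 := hx.range.large
  rw [lev_zero]
  have h3 : Real.exp (4 * X + 1) ≤ Real.exp (Real.exp (Real.sqrt X)) :=
    Real.exp_le_exp.2 (by linarith)
  have h4 : 2 * Real.exp (4 * X) ≤ Real.exp (4 * X + 1) := by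
    rw [Real.exp_add, mul_comm]
    exact mul_le_mul_of_nonneg_left (by linarith [Real.add_one_le_exp (1 : ℝ)]) (Real.exp_pos _).le
  have h5 := Real.add_one_le_exp (4 * X)
  linarith

theorem sq_log_eq (hx : LargeParam x) : Real.log x ^ 2 = Real.exp (2 * iterLog 2 x) := by
  rw [hx.log_eq, ← Real.exp_nat_mul]
  norm_num

theorem paramS_le (hx : LargeParam x) : paramS x ≤ lev (iterLog 2 x) 0 := by
  have h := hx.range.large
  rw [lev_zero, paramS]
  refine Real.exp_le_exp.2 ?_
  refine le_trans (le_of_eq ?_) (Real.exp_le_exp.2 hx.log_le)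
  rw [show (36 : ℝ) * Real.log (iterLog 2 x) = ((36 : ℕ) : ℝ) * Real.log (iterLog 2 x) by norm_num,
    Real.exp_nat_mul, Real.exp_log (by linarith)]

theorem log_nonneg (hx : LargeParam x) : 0 ≤ Real.log (iterLog 2 x) :=
  Real.log_nonneg (by linarith [hx.range.large])

end LargeParam

/-- The value of `f` at the `i`-th prime factor of `n` if it exceeds `w`, and `1` otherwise. -/
noncomputable def sideValue (f : ℕ → ℕ) (w : ℝ) (n i : ℕ) : ℕ :=
  if w < f (primeAt n i) then f (primeAt n i) else 1

namespace IsGood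

variable {f : ℕ → ℕ} {pr : ℕ → Prop} {ε x : ℝ} {n : ℕ}

theorem ne_zero (hn : IsGood f ε x n) : n ≠ 0 := hn.pos.ne'

theorem squarefull_le (hx : LargeParam x) (hn : IsGood f ε x n) {p k : ℕ} (hp : p.Prime)
    (hk : 2 ≤ k) (h : p ^ k ∣ n ∨ p ^ k ∣ f n) :
    ((p ^ k : ℕ) : ℝ) ≤ Real.exp (2 * iterLog 2 x) := by
  rw [← hx.sq_log_eq]
  exact hn.cond1 _ (squarefull_pow hp hk) h

theorem not_sq_dvd_of_gt (hx : LargeParam x) (hn : IsGood f ε x n) {p : ℕ} (hp : p.Prime)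
    (h : lev (iterLog 2 x) 0 < (p : ℝ) + 1) : ¬ (p ^ 2 ∣ n ∨ p ^ 2 ∣ f n) := by
  intro h1
  have h2 := hn.squarefull_le hx hp le_rfl h1
  have h3 := hx.exp_four_le
  have h4 : (p : ℝ) ≤ ((p ^ 2 : ℕ) : ℝ) := by exact_mod_cast Nat.le_self_pow two_ne_zero p
  have h5 : Real.exp (2 * iterLog 2 x) ≤ Real.exp (4 * iterLog 2 x) :=
    Real.exp_le_exp.2 (by linarith [hx.range.large])
  linarith

theorem not_sq_dvd (hf : ValueFunction f pr) (hx : LargeParam x) (hn : IsGood f ε x n) {p : ℕ}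
    (hp : p.Prime) (h : lev (iterLog 2 x) 0 < f p) : ¬ p ^ 2 ∣ n := fun h1 =>
  hn.not_sq_dvd_of_gt hx hp (lt_of_lt_of_le h (by exact_mod_cast hf.prime_le p hp)) (Or.inl h1)

theorem lt_bigOmega (hn : IsGood f ε x n) {i : ℕ} (hi : i ≤ paramL x) :
    i < bigOmega n ∧ 2 < primeAt n i := two_lt_primeAt hn.cond6 hi

theorem xCoord_eq (hn : IsGood f ε x n) {i : ℕ} (hi : i ≤ paramL x) :
    xCoord x n i = iterLog 2 (primeAt n i) / iterLog 2 x :=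
  if_pos (hn.lt_bigOmega hi)

/-- The prime p_L and all later ones satisfy log_2 p ≤ √X - 1 by the simplex bound; the 1 to spare
absorbs the passage from p to f(p) ≤ p + 1. -/
theorem value_le_of_ge (hf : ValueFunction f pr) (hx : LargeParam x) (hn : IsGood f ε x n) {i : ℕ}
    (hi : paramL x ≤ i) (hi' : i < bigOmega n) :
    (f (primeAt n i) : ℝ) ≤ lev (iterLog 2 x) 0 := by
  set X := iterLog 2 x with hX
  have hX0 : 0 < X := by linarith [hx.range.large]
  have h1 := hn.lt_bigOmega (le_refl (paramL x))
  have h2 := hf.mono _ _ (primeAt_of_lt hi').1 (primeAt_of_lt h1.1).1 (primeAt_antitone hi hi')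
  have h3 := h2.trans (hf.prime_le _ (primeAt_of_lt h1.1).1)
  have h4 : (f (primeAt n i) : ℝ) ≤ (primeAt n (paramL x) : ℝ) + 1 := by exact_mod_cast h3
  refine h4.trans ?_
  have h5 := hx.last_le _ hn.cond5
  rw [hn.xCoord_eq le_rfl, mul_div_cancel₀ _ hX0.ne'] at h5
  have h6 := iterLog_two_succ_le h1.2
  rw [lev_zero]
  have h7 : (2 : ℝ) < primeAt n (paramL x) := by exact_mod_cast h1.2
  have h8 : 0 < Real.log ((primeAt n (paramL x) : ℝ) + 1) := Real.log_pos (by linarith)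
  rw [← Real.log_le_iff_le_exp (by linarith), ← Real.log_le_iff_le_exp h8]
  rw [iterLog_two] at h6
  linarith

/-- The divisor d collects the prime powers of the p with f(p) ≤ w. The other primes divide n once,
since squarefull divisors are at most (log x)² < w, and by `value_le_of_ge` they are among p_0, …,
p_{L-1}; hence f(n) splits by multiplicativity. -/
theorem exists_unitary (hf : ValueFunction f pr) (hx : LargeParam x) (hn : IsGood f ε x n) :
    ∃ d, UnitaryDvd d n ∧
      f n = f d * ∏ i : Fin (paramL x), sideValue f (lev (iterLog 2 x) 0) n i ∧
      (∀ p : ℕ, p.Prime → p ∣ d → (f p : ℝ) ≤ lev (iterLog 2 x) 0) ∧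
      (∀ r : ℕ, r.Prime → lev (iterLog 2 x) 0 < r → ¬ r ∣ f d) := by
  classical
  set w := lev (iterLog 2 x) 0 with hw
  set T := n.primeFactors.filter fun p : ℕ => (f p : ℝ) ≤ w with hT
  set B := n.primeFactors.filter fun p : ℕ => ¬ (f p : ℝ) ≤ w with hB
  have hTp : ∀ p ∈ T, p.Prime := fun p hp =>
    Nat.prime_of_mem_primeFactors (Finset.mem_filter.1 hp).1
  have hBp : ∀ p ∈ B, p.Prime := fun p hp =>
    Nat.prime_of_mem_primeFactors (Finset.mem_filter.1 hp).1
  have hfac : (∏ p ∈ T, p ^ n.factorization p) * ∏ p ∈ B, p ^ n.factorization p = n := by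
    rw [hT, hB, Finset.prod_filter_mul_prod_filter_not]
    conv_rhs => rw [← Nat.prod_factorization_pow_eq_self hn.ne_zero]
    rfl
  have hone : ∀ p ∈ B, n.factorization p = 1 := by
    intro p hp
    have h1 := hBp p hp
    have h2 := h1.factorization_pos_of_dvd hn.ne_zero
      (Nat.dvd_of_mem_primeFactors (Finset.mem_filter.1 hp).1)
    have h3 : ¬ 2 ≤ n.factorization p := fun h4 =>
      hn.not_sq_dvd hf hx h1 (not_le.1 (Finset.mem_filter.1 hp).2)
        ((h1.pow_dvd_iff_le_factorization hn.ne_zero).2 h4)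
    omega
  have hcop : Nat.Coprime (∏ p ∈ T, p ^ n.factorization p) (∏ p ∈ B, p ^ n.factorization p) := by
    refine Nat.Coprime.prod_left fun p hp => Nat.Coprime.prod_right fun q hq =>
      Nat.Coprime.pow _ _ ((Nat.coprime_primes (hTp p hp) (hBp q hq)).2 ?_)
    rintro rfl
    exact (Finset.mem_filter.1 hq).2 (Finset.mem_filter.1 hp).2
  have hdpos : 0 < ∏ p ∈ T, p ^ n.factorization p :=
    Finset.prod_pos fun p hp => pow_pos (hTp p hp).pos _
  have hBprod : ∏ p ∈ B, f (p ^ n.factorization p)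
      = ∏ i : Fin (paramL x), sideValue f w n i := by
    have h1 : ∏ i : Fin (paramL x), sideValue f w n i
        = ∏ i ∈ (Finset.univ : Finset (Fin (paramL x))).filter
          (fun i : Fin (paramL x) => w < f (primeAt n (i : ℕ))), f (primeAt n (i : ℕ)) := by
      rw [Finset.prod_filter]
      rfl
    rw [h1]
    symm
    refine Finset.prod_nbij (fun i : Fin (paramL x) => primeAt n (i : ℕ)) ?_ ?_ ?_ ?_
    · intro i hi
      have h2 := primeAt_of_lt (hn.lt_bigOmega i.2.le).1
      rw [hB, Finset.mem_filter, Nat.mem_primeFactors]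
      exact ⟨⟨h2.1, h2.2, hn.ne_zero⟩, not_le.2 (Finset.mem_filter.1 hi).2⟩
    · intro i hi j hj hij
      have hi' := (Finset.mem_filter.1 hi).2
      have hj' := (Finset.mem_filter.1 hj).2
      have hij : primeAt n i = primeAt n j := hij
      rcases lt_trichotomy (i : ℕ) j with h | h | h
      · exact absurd (sq_dvd_of_primeAt_eq h (hn.lt_bigOmega j.2.le).1 hij)
          (hn.not_sq_dvd hf hx (primeAt_of_lt (hn.lt_bigOmega i.2.le).1).1 hi')
      · exact Fin.ext h
      · exact absurd (sq_dvd_of_primeAt_eq h (hn.lt_bigOmega i.2.le).1 hij.symm)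
          (hn.not_sq_dvd hf hx (primeAt_of_lt (hn.lt_bigOmega j.2.le).1).1 hj')
    · intro p hp
      have hp' := Finset.mem_filter.1 hp
      obtain ⟨i, hi, rfl⟩ := exists_primeAt_eq (hBp p hp) hn.ne_zero
        (Nat.dvd_of_mem_primeFactors hp'.1)
      have hiL : i < paramL x := by
        by_contra h
        exact hp'.2 (hn.value_le_of_ge hf hx (not_lt.1 h) hi)
      exact ⟨⟨i, hiL⟩, by simpa using hp'.2, rfl⟩
    · intro i hi
      have h2 := primeAt_of_lt (hn.lt_bigOmega i.2.le).1
      have : primeAt n i ∈ B := by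
        rw [hB, Finset.mem_filter, Nat.mem_primeFactors]
        exact ⟨⟨h2.1, h2.2, hn.ne_zero⟩, not_le.2 (Finset.mem_filter.1 hi).2⟩
      rw [hone _ this, pow_one]
  refine ⟨∏ p ∈ T, p ^ n.factorization p, ⟨Dvd.intro _ hfac, ?_⟩, ?_, ?_, ?_⟩
  · have : n / (∏ p ∈ T, p ^ n.factorization p) = ∏ p ∈ B, p ^ n.factorization p :=
      Nat.div_eq_of_eq_mul_right hdpos hfac.symm
    rw [this]
    exact hcop
  · conv_lhs => rw [← hfac]
    rw [hf.map_mul _ _ hcop, hf.map_prod B hBp, hBprod]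
  · intro p hp h
    obtain ⟨q, hq, hpq⟩ := (Prime.dvd_finsetProd_iff hp.prime _).1 h
    rw [(Nat.prime_dvd_prime_iff_eq hp (hTp q hq)).1 (hp.dvd_of_dvd_pow hpq)]
    exact (Finset.mem_filter.1 hq).2
  · intro r hr hwr h
    rw [hf.map_prod T hTp] at h
    obtain ⟨q, hq, hrq⟩ := (Prime.dvd_finsetProd_iff hr.prime _).1 h
    have hqp := hTp q hq
    have hle : (r : ℝ) ≤ f (q ^ n.factorization q) := by
      exact_mod_cast Nat.le_of_dvd (hf.pos _ (pow_pos hqp.pos _)) hrq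
    rcases Nat.lt_or_ge (n.factorization q) 2 with h2 | h2
    · have h3 : n.factorization q = 1 := by
        have := hqp.factorization_pos_of_dvd hn.ne_zero
          (Nat.dvd_of_mem_primeFactors (Finset.mem_filter.1 hq).1)
        omega
      rw [h3, pow_one] at hle
      exact absurd (hwr.trans_le hle) (not_lt.2 (Finset.mem_filter.1 hq).2)
    · have h3 := hn.squarefull_le hx hqp h2 (Or.inl (Nat.ordProj_dvd n q))
      have h4 : (f (q ^ n.factorization q) : ℝ) ≤ ((q ^ n.factorization q : ℕ) : ℝ) ^ 2 := by
        exact_mod_cast hf.le_sq _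
      have h5 : ((q ^ n.factorization q : ℕ) : ℝ) ^ 2 ≤ Real.exp (4 * iterLog 2 x) := by
        refine (pow_le_pow_left₀ (Nat.cast_nonneg _) h3 2).trans (le_of_eq ?_)
        rw [← Real.exp_nat_mul]
        congr 1
        push_cast
        ring
      have h6 := hx.exp_four_le
      rw [← hw] at h6
      linarith

/-- If d is large, condition (4) applies, and log_2 f(d) ≤ 2√X because d has at most 10X prime
factors, none larger than about w. If d < exp(√X), the trivial bound by log f(d) / log 2 is enough.
-/
theorem bigOmega_value_le (hf : ValueFunction f pr) (hx : LargeParam x) (hn : IsGood f ε x n)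
    {d : ℕ} (hd : UnitaryDvd d n)
    (hp : ∀ p : ℕ, p.Prime → p ∣ d → (f p : ℝ) ≤ lev (iterLog 2 x) 0) :
    (bigOmega (f d) : ℝ) ≤ 20 * Real.sqrt (iterLog 2 x) := by
  have hX := hx.range.large
  have hY := hx.sqrt_ge
  have hE := hx.range.exp_sqrt
  have hlevd := lev_zero (iterLog 2 x)
  set X := iterLog 2 x with hXd
  set Y := Real.sqrt X with hYd
  have hd0 : d ≠ 0 := fun h => hn.ne_zero (by
    have := hd.1
    rw [h] at this
    exact zero_dvd_iff.1 this)
  have hfd := hf.pos d (Nat.pos_of_ne_zero hd0)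
  have hlog2 : Real.log (f d) ≤ 2 * Real.log d := by
    have h1 : (f d : ℝ) ≤ (d : ℝ) ^ 2 := by exact_mod_cast hf.le_sq d
    have := Real.log_le_log (by exact_mod_cast hfd) h1
    rwa [Real.log_pow, Nat.cast_ofNat] at this
  by_cases hbig : Real.exp (X ^ (1 / 2 : ℝ)) ≤ (d : ℝ)
  · refine (hn.cond4 d hd hbig).trans ?_
    have hlogd : Real.log d ≤ bigOmega d * (Real.exp Y + 1) := by
      refine log_le_bigOmega_mul hd0 fun p hpp hpd => ?_
      have h1 : (p : ℝ) ≤ (f p : ℝ) + 1 := by exact_mod_cast hf.le_prime p hpp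
      have h2 := hp p hpp hpd
      have hp0 : (0 : ℝ) < p := by exact_mod_cast hpp.pos
      have h3 : (p : ℝ) ≤ Real.exp (Real.exp Y + 1) := by
        rw [Real.exp_add, ← hlevd]
        have h4 := Real.add_one_le_exp (1 : ℝ)
        have h5 := one_lt_lev X 0
        nlinarith
      rwa [Real.log_le_iff_le_exp hp0]
    have hOm : (bigOmega d : ℝ) ≤ 10 * X := by
      refine le_trans ?_ hn.cond3.2
      exact_mod_cast bigOmega_le_of_dvd hn.ne_zero hd.1
    have h1 : Real.log (f d) ≤ Real.exp (2 * Y) := by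
      have h2 : (bigOmega d : ℝ) * (Real.exp Y + 1) ≤ 10 * X * (Real.exp Y + 1) :=
        mul_le_mul_of_nonneg_right hOm (by positivity)
      have h3 : Real.exp (2 * Y) = Real.exp Y * Real.exp Y := by rw [← Real.exp_add]; ring_nf
      have h4 : 1 ≤ Real.exp Y := Real.one_le_exp (by linarith)
      rw [h3]
      nlinarith
    have hl0 : 0 ≤ Real.log (f d) := Real.log_natCast_nonneg _
    have h2 : iterLog 2 (f d) ≤ 2 * Y := by
      rw [iterLog_two]
      rcases hl0.eq_or_lt with h | h
      · rw [← h, Real.log_zero]; linarith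
      · rwa [Real.log_le_iff_le_exp h]
    linarith
  · have h1 : Real.log d ≤ Y := by
      rw [Real.log_le_iff_le_exp (by exact_mod_cast Nat.pos_of_ne_zero hd0), hYd,
        Real.sqrt_eq_rpow]
      exact (not_le.1 hbig).le
    have h2 := bigOmega_mul_log_two_le hfd.ne'
    have h3 := Real.log_two_gt_d9
    have h4 : (0 : ℝ) ≤ bigOmega (f d) := Nat.cast_nonneg _
    nlinarith

end IsGood

end CommonValues


namespace CommonValues

open Finset

/-! ### Levels of the values at a good integer -/

/-- The error term in the normality condition. -/
noncomputable def normalErr (X : ℝ) : ℝ := Real.sqrt (36 * Real.log X * X)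

/-- The index of the level interval containing `F`. -/
noncomputable def levelIndex (X : ℝ) (F : ℕ) : ℕ := ⌈iterLog 2 F / Real.sqrt X - 1⌉₊

/-- The bound for the number of prime factors of the smooth part of a value. -/
noncomputable def smoothBound (x : ℝ) : ℕ :=
  ⌊20 * Real.sqrt (iterLog 2 x) + paramL x * (72 * Real.log (iterLog 2 x)
    + Real.sqrt (iterLog 2 x) + normalErr (iterLog 2 x))⌋₊

theorem sum_univ_erase_zero (M : ℕ) (g : ℕ → ℝ) :
    ∑ k ∈ (Finset.univ : Finset (Fin (M + 1))).erase 0, g (k : ℕ)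
      = ∑ j ∈ Finset.range M, g (j + 1) := by
  have h1 := Finset.add_sum_erase Finset.univ (fun k : Fin (M + 1) => g k) (Finset.mem_univ 0)
  rw [Fin.sum_univ_eq_sum_range, Finset.sum_range_succ'] at h1
  simp only [Fin.val_zero] at h1
  linarith

theorem levelIndex_mul_lt {X : ℝ} (hX : 0 < X) {F : ℕ} (h : levelIndex X F ≠ 0) :
    levelIndex X F * Real.sqrt X < iterLog 2 F := by
  have hY : 0 < Real.sqrt X := Real.sqrt_pos.2 hX
  have h1 : 0 < iterLog 2 F / Real.sqrt X - 1 := Nat.ceil_pos.1 (Nat.pos_of_ne_zero h)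
  have h2 := Nat.ceil_lt_add_one h1.le
  rw [← levelIndex] at h2
  rw [← lt_div_iff₀ hY]
  linarith

theorem iterLog_le_levelIndex {X : ℝ} (hX : 0 < X) (F : ℕ) :
    iterLog 2 F ≤ ((levelIndex X F : ℝ) + 1) * Real.sqrt X := by
  have hY : 0 < Real.sqrt X := Real.sqrt_pos.2 hX
  have h2 := Nat.le_ceil (iterLog 2 F / Real.sqrt X - 1)
  rw [← levelIndex] at h2
  rw [← div_le_iff₀ hY]
  linarith

theorem le_pow_bigOmega {n : ℕ} (hn : 1 < n) :
    Real.log n ≤ bigOmega n * Real.log (largestPrime n) :=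
  log_le_bigOmega_mul (by omega) fun p hp h => Real.log_le_log (by exact_mod_cast hp.pos)
    (by exact_mod_cast (largestPrime_spec hn).2.2 p hp h)

namespace IsGood

variable {f : ℕ → ℕ} {pr : ℕ → Prop} {ε x : ℝ} {n : ℕ}

theorem dens_le (hf : ValueFunction f pr) (hx : LargeParam x) (hn : IsGood f ε x n) {p : ℕ}
    (hp : p.Prime) (hpn : p ∣ n) (hpx : (f p : ℝ) ≤ x) {T : ℝ} (hT : lev (iterLog 2 x) 0 < T)
    (hTp : T ≤ f p) : (bigOmegaBetween (f p) (lev (iterLog 2 x) 0) T : ℝ)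
      ≤ iterLog 2 T - Real.sqrt (iterLog 2 x) + normalErr (iterLog 2 x) := by
  have h1 := ((hn.cond2 p hp hpn f hf.eq).2 _ T hx.paramS_le hT hTp)
  rw [iterLog_lev, iterLog_paramS] at h1
  have h2 := (abs_lt.1 h1).2
  have hT1 : 1 < T := (one_lt_lev _ _).trans hT
  have h3 : iterLog 2 T ≤ iterLog 2 x := iterLog_two_mono hT1 (hTp.trans hpx)
  have h4 : Real.sqrt (36 * Real.log (iterLog 2 x) * iterLog 2 T) ≤ normalErr (iterLog 2 x) :=
    Real.sqrt_le_sqrt (mul_le_mul_of_nonneg_left h3 (by linarith [hx.log_nonneg]))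
  push_cast at h2
  linarith

theorem smooth_le (hf : ValueFunction f pr) (hx : LargeParam x) (hn : IsGood f ε x n) {p : ℕ}
    (hp : p.Prime) (hpn : p ∣ n) (hpx : (f p : ℝ) ≤ x) (hwp : lev (iterLog 2 x) 0 ≤ f p) :
    (bigOmegaBetween (f p) 1 (lev (iterLog 2 x) 0) : ℝ)
      ≤ 72 * Real.log (iterLog 2 x) + Real.sqrt (iterLog 2 x) + normalErr (iterLog 2 x) := by
  have h0 := hn.cond2 p hp hpn f hf.eq
  have h1 := h0.1
  rw [iterLog_paramS] at h1
  rw [bigOmegaBetween_add (one_le_paramS x) hx.paramS_le]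
  push_cast
  have h9 : 0 ≤ normalErr (iterLog 2 x) := Real.sqrt_nonneg _
  have h10 := Real.sqrt_nonneg (iterLog 2 x)
  -- Normality is available only for U < T, so the degenerate case S = w is separated.
  rcases hx.paramS_le.eq_or_lt with h | h
  · have h2 : bigOmegaBetween (f p) (paramS x) (lev (iterLog 2 x) 0) = 0 := by
      rw [h, bigOmegaBetween]
      refine Finset.sum_eq_zero fun q hq => ?_
      have := (Finset.mem_filter.1 hq).2
      linarith
    rw [h2, Nat.cast_zero]
    linarith
  · have h2 := (abs_lt.1 (h0.2 _ _ le_rfl h hwp)).2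
    rw [iterLog_lev, iterLog_paramS] at h2
    have h3 : iterLog 2 (lev (iterLog 2 x) 0) ≤ iterLog 2 x :=
      iterLog_two_mono (one_lt_lev _ _) (hwp.trans hpx)
    rw [iterLog_lev] at h3
    have h4 : Real.sqrt (36 * Real.log (iterLog 2 x) * (((0 : ℕ) + 1) * Real.sqrt (iterLog 2 x)))
        ≤ normalErr (iterLog 2 x) :=
      Real.sqrt_le_sqrt (mul_le_mul_of_nonneg_left h3 (by linarith [hx.log_nonneg]))
    have h5 := hx.log_nonneg
    push_cast at h2 h4
    linarith

theorem sideValue_cases (hn : IsGood f ε x n) {i : ℕ} (hi : i < paramL x) :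
    sideValue f (lev (iterLog 2 x) 0) n i = 1 ∨
    (lev (iterLog 2 x) 0 < sideValue f (lev (iterLog 2 x) 0) n i ∧ ∃ p : ℕ, p.Prime ∧ p ∣ n ∧
      2 < p ∧ p = primeAt n i ∧ sideValue f (lev (iterLog 2 x) 0) n i = f p) := by
  have h1 := hn.lt_bigOmega hi.le
  have h2 := primeAt_of_lt h1.1
  rw [sideValue]
  split_ifs with h
  · exact Or.inr ⟨h, _, h2.1, h2.2, h1.2, rfl, rfl⟩
  · exact Or.inl rfl

theorem sideValue_pos (hn : IsGood f ε x n) {i : ℕ} (hi : i < paramL x) :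
    0 < sideValue f (lev (iterLog 2 x) 0) n i := by
  rcases hn.sideValue_cases hi with h | ⟨h, -⟩
  · omega
  · have : (0 : ℝ) < sideValue f (lev (iterLog 2 x) 0) n i := (lev_pos _ _).trans h
    exact_mod_cast this

theorem sideValue_antitone (hf : ValueFunction f pr) (hn : IsGood f ε x n) {i j : ℕ} (hij : i ≤ j)
    (hj : j < paramL x) : sideValue f (lev (iterLog 2 x) 0) n j
      ≤ sideValue f (lev (iterLog 2 x) 0) n i := by
  have h1 := hn.lt_bigOmega hj.le
  have h2 := hn.lt_bigOmega (hij.trans hj.le)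
  have h3 := hf.mono _ _ (primeAt_of_lt h1.1).1 (primeAt_of_lt h2.1).1 (primeAt_antitone hij h1.1)
  have h4 : (f (primeAt n j) : ℝ) ≤ f (primeAt n i) := by exact_mod_cast h3
  have h5 := hn.sideValue_pos (hij.trans_lt hj)
  rw [sideValue]
  split_ifs with h
  · rw [sideValue, if_pos (h.trans_le h4)]
    exact h3
  · exact h5

theorem levelIndex_antitone (hf : ValueFunction f pr) (hn : IsGood f ε x n)
    {i j : ℕ} (hij : i ≤ j) (hj : j < paramL x) :
    levelIndex (iterLog 2 x) (sideValue f (lev (iterLog 2 x) 0) n j)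
      ≤ levelIndex (iterLog 2 x) (sideValue f (lev (iterLog 2 x) 0) n i) := by
  have h1 := hn.sideValue_antitone hf hij hj
  rcases hn.sideValue_cases hj with h | ⟨h, -⟩
  · have : levelIndex (iterLog 2 x) (sideValue f (lev (iterLog 2 x) 0) n j) = 0 := by
      rw [h, levelIndex, Nat.ceil_eq_zero]
      simp [iterLog_two]
    omega
  · refine Nat.ceil_mono (sub_le_sub_right (div_le_div_of_nonneg_right ?_ (Real.sqrt_nonneg _)) 1)
    exact iterLog_two_mono ((one_lt_lev _ _).trans h) (by exact_mod_cast h1)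

/-- The unitary decomposition gives divisibility and the covering of rough primes, normality the
density bound, and Ω(f(n)) ≤ 10X the size of the tops. Condition (7) makes the largest prime of row
0 exceed every other row. -/
theorem sideData (hf : ValueFunction f pr) (hx : LargeParam x) (hn : IsGood f ε x n) {M : ℕ}
    (hM : paramL x = M + 1) : SideData (iterLog 2 x) (normalErr (iterLog 2 x)) pr
      (fun i : Fin (M + 1) => levelIndex (iterLog 2 x) (sideValue f (lev (iterLog 2 x) 0) n i))
      (f n) (fun i : Fin (M + 1) => sideValue f (lev (iterLog 2 x) 0) n i) := by
  have hX := hx.range.large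
  have hX0 : 0 < iterLog 2 x := by linarith
  have hY := hx.sqrt_ge
  have hlt : ∀ i : Fin (M + 1), (i : ℕ) < paramL x := fun i => by omega
  obtain ⟨d, hd, hfd, hdp, hdr⟩ := hn.exists_unitary hf hx
  rw [Fin.prod_univ_eq_prod_range, hM, ← Fin.prod_univ_eq_prod_range] at hfd
  have hdvd : ∀ i : Fin (M + 1), sideValue f (lev (iterLog 2 x) 0) n i ∣ f n := fun i =>
    (Finset.dvd_prod_of_mem (fun i : Fin (M + 1) => sideValue f (lev (iterLog 2 x) 0) n i)
      (Finset.mem_univ i)).trans (hfd ▸ Dvd.intro_left _ rfl)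
  have hfn := hf.pos n hn.pos
  have hle : ∀ i : Fin (M + 1), (sideValue f (lev (iterLog 2 x) 0) n i : ℝ) ≤ x := fun i =>
    le_trans (by exact_mod_cast Nat.le_of_dvd hfn (hdvd i)) hn.value_le
  have hl1 : levelIndex (iterLog 2 x) 1 = 0 := by
    rw [levelIndex, Nat.ceil_eq_zero]
    simp [iterLog_two]
  have hbig : ∀ i : Fin (M + 1),
      levelIndex (iterLog 2 x) (sideValue f (lev (iterLog 2 x) 0) n i) ≠ 0 →
      (lev (iterLog 2 x) 0 < sideValue f (lev (iterLog 2 x) 0) n i ∧ ∃ p : ℕ, p.Prime ∧ p ∣ n ∧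
      2 < p ∧ p = primeAt n i ∧ sideValue f (lev (iterLog 2 x) 0) n i = f p) := by
    intro i hi
    rcases hn.sideValue_cases (hlt i) with h | h
    · rw [h] at hi
      exact absurd hl1 hi
    · exact h
  have htop : x ^ (1 / iterLog 2 x) = Real.exp (Real.exp (iterLog 2 x) / iterLog 2 x) := by
    conv_lhs => rw [← hx.exp_exp, ← Real.exp_mul]
    rw [hx.exp_exp, mul_one_div]
  have hwtop : lev (iterLog 2 x) 0 < Real.exp (Real.exp (iterLog 2 x) / iterLog 2 x) := by
    rw [lev_zero, Real.exp_lt_exp, lt_div_iff₀ hX0]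
    have h1 := hx.range.exp_sqrt
    have h2 : Real.exp (2 * Real.sqrt (iterLog 2 x)) ≤ Real.exp (iterLog 2 x) := by
      refine Real.exp_le_exp.2 ?_
      nlinarith [Real.mul_self_sqrt hX0.le]
    rw [two_mul, Real.exp_add] at h2
    nlinarith [Real.exp_pos (Real.sqrt (iterLog 2 x))]
  refine ⟨fun i => hn.sideValue_pos (hlt i), ?_, ?_, ?_, ?_, ?_, ?_, ?_, ?_, ?_, ?_⟩
  · rw [hfd]
    exact Dvd.intro_left _ rfl
  · intro r hr hwr h
    rw [hfd] at h
    rcases hr.dvd_mul.1 h with h | h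
    · exact absurd h (hdr r hr hwr)
    · obtain ⟨i, -, hi⟩ := (Prime.dvd_finsetProd_iff hr.prime _).1 h
      exact ⟨i, hi⟩
  · intro i hi
    have h1 := levelIndex_mul_lt hX0 hi
    obtain ⟨h, -⟩ := hbig i hi
    have h4 := (one_lt_lev _ _).trans h
    have h5 := Real.log_pos h4
    rw [lev, Nat.cast_sub (Nat.one_le_iff_ne_zero.2 hi), Nat.cast_one, sub_add_cancel,
      ← Real.lt_log_iff_exp_lt (by linarith), ← Real.lt_log_iff_exp_lt h5]
    exact h1
  · intro i
    rcases hn.sideValue_cases (hlt i) with h | ⟨h, -⟩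
    · show (sideValue f (lev (iterLog 2 x) 0) n i : ℝ) ≤ _
      rw [h, Nat.cast_one]
      exact (one_lt_lev _ _).le
    · have h1 := iterLog_le_levelIndex hX0 (sideValue f (lev (iterLog 2 x) 0) n i)
      have h4 := (one_lt_lev _ _).trans h
      have h5 := Real.log_pos h4
      exact (Real.log_le_iff_le_exp (by linarith)).1 ((Real.log_le_iff_le_exp h5).1 h1)
  · intro i j hij
    exact hn.levelIndex_antitone hf hij (hlt j)
  · intro i hi
    obtain ⟨-, p, hp, -, -, -, he⟩ := hbig i hi
    show pr (sideValue f (lev (iterLog 2 x) 0) n i)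
    rw [he]
    exact hf.prime p hp
  · intro i T hT hTF
    have hTF : T ≤ sideValue f (lev (iterLog 2 x) 0) n i := hTF
    have hlei := hle i
    show (bigOmegaBetween (sideValue f (lev (iterLog 2 x) 0) n i) _ T : ℝ) ≤ _
    rcases hn.sideValue_cases (hlt i) with h | ⟨-, p, hp, hpn, -, -, he⟩
    · rw [h, Nat.cast_one] at hTF
      linarith [one_lt_lev (iterLog 2 x) 0]
    · rw [he] at hTF hlei ⊢
      exact hn.dens_le hf hx hp hpn hlei hT hTF
  · intro i hi
    obtain ⟨h, -⟩ := hbig i (by omega)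
    have h4 := (one_lt_lev _ _).trans h
    have h5 : 1 < sideValue f (lev (iterLog 2 x) 0) n i := by exact_mod_cast h4
    refine (le_pow_bigOmega h5).trans (mul_le_mul_of_nonneg_right ?_ (Real.log_natCast_nonneg _))
    refine le_trans ?_ hn.cond3.1
    exact_mod_cast bigOmega_le_of_dvd hfn.ne' (hdvd i)
  · have h1 := hn.cond7.1
    rw [htop] at h1
    have h2 := primeAt_of_lt (hn.lt_bigOmega (Nat.zero_le _)).1
    have h3 : largestPrime (f (primeAt n 0)) ≤ f (primeAt n 0) := by
      have h4 := hf.pos _ h2.1.pos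
      rcases Nat.lt_or_ge 1 (f (primeAt n 0)) with h5 | h5
      · exact Nat.le_of_dvd h4 (largestPrime_spec h5).2.1
      · have : f (primeAt n 0) = 1 := by omega
        rw [this]
        simp [largestPrime]
    have h4 : (largestPrime (f (primeAt n 0)) : ℝ) ≤ f (primeAt n 0) := by exact_mod_cast h3
    show _ ≤ (largestPrime (sideValue f (lev (iterLog 2 x) 0) n ((0 : Fin (M + 1)) : ℕ)) : ℝ)
    rw [Fin.val_zero, sideValue, if_pos (by linarith)]
    exact h1
  · intro i hi
    show (sideValue f (lev (iterLog 2 x) 0) n i : ℝ) < _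
    rcases hn.sideValue_cases (hlt i) with h | ⟨-, p, hp, hpn, -, he, he'⟩
    · rw [h, Nat.cast_one]
      exact (one_lt_lev _ _).trans hwtop
    · have hi1 : 1 ≤ (i : ℕ) := Nat.one_le_iff_ne_zero.2 fun h0 => hi (Fin.ext h0)
      have h1 := primeAt_antitone hi1 (hn.lt_bigOmega (hlt i).le).1
      rw [← he] at h1
      have h2 : (f p : ℝ) ≤ (primeAt n 1 : ℝ) + 1 := by
        exact_mod_cast (hf.prime_le p hp).trans (Nat.succ_le_succ h1)
      have h3 := hn.cond7.2
      rw [he']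
      have e : x ^ (1 / (100 * iterLog 2 x))
          = Real.exp (Real.exp (iterLog 2 x) / iterLog 2 x / 100) := by
        rw [show 1 / (100 * iterLog 2 x) = 1 / iterLog 2 x * (1 / 100) by field_simp,
          Real.rpow_mul (by rw [← hx.exp_exp]; exact (Real.exp_pos _).le), htop, ← Real.exp_mul]
        congr 1
        ring
      rw [e] at h3
      set q := Real.exp (iterLog 2 x) / iterLog 2 x with hq
      have hq1 : 2 ≤ q := by
        rw [hq, le_div_iff₀ hX0, ← add_halves (iterLog 2 x), Real.exp_add]
        nlinarith [Real.add_one_le_exp (iterLog 2 x / 2), sq_nonneg (iterLog 2 x / 2 - 1)]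
      have h5 : 1 ≤ Real.exp (q / 100) := Real.one_le_exp (by positivity)
      have h6 : Real.exp (q / 100) * Real.exp (99 / 100 * q) = Real.exp q := by
        rw [← Real.exp_add]; congr 1; ring
      have h7 := Real.add_one_le_exp (99 / 100 * q)
      have h8 : Real.exp (q / 100) * 2 ≤ Real.exp (q / 100) * Real.exp (99 / 100 * q) :=
        mul_le_mul_of_nonneg_left (by linarith) (by linarith)
      linarith

theorem valueData (hf : ValueFunction f pr) (hx : LargeParam x) (hn : IsGood f ε x n) :
    ValueData (iterLog 2 x) (smoothBound x) (f n) := by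
  have hfn := hf.pos n hn.pos
  refine ⟨hfn.ne', by rw [hx.exp_exp]; exact hn.value_le, fun r hr hwr h =>
    hn.not_sq_dvd_of_gt hx hr (by linarith) (Or.inr h), ?_⟩
  obtain ⟨d, hd, hfd, hdp, hdr⟩ := hn.exists_unitary hf hx
  have hd0 : 0 < d := Nat.pos_of_dvd_of_pos hd.1 hn.pos
  have hpos : ∀ i ∈ (Finset.univ : Finset (Fin (paramL x))),
      sideValue f (lev (iterLog 2 x) 0) n i ≠ 0 := fun i _ => (hn.sideValue_pos i.2).ne'
  rw [length_primeFactorsList_smoothPart, smoothBound]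
  refine Nat.le_floor ?_
  have h1 : bigOmegaBetween (f n) 1 (lev (iterLog 2 x) 0)
      = bigOmegaBetween (f d) 1 (lev (iterLog 2 x) 0) + ∑ i : Fin (paramL x),
        bigOmegaBetween (sideValue f (lev (iterLog 2 x) 0) n i) 1 (lev (iterLog 2 x) 0) := by
    rw [hfd, bigOmegaBetween_mul (hf.pos d hd0).ne' (Finset.prod_ne_zero_iff.2 hpos),
      bigOmegaBetween_prod _ _ hpos]
  rw [h1, Nat.cast_add, Nat.cast_sum]
  refine add_le_add ?_ ?_
  · refine le_trans ?_ (hn.bigOmega_value_le hf hx hd hdp)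
    exact_mod_cast bigOmegaBetween_le_bigOmega _ _ _
  · refine (Finset.sum_le_card_nsmul _ _ (72 * Real.log (iterLog 2 x)
      + Real.sqrt (iterLog 2 x) + normalErr (iterLog 2 x)) fun i _ => ?_).trans (le_of_eq ?_)
    · rcases hn.sideValue_cases i.2 with h | ⟨h, p, hp, hpn, -, -, he⟩
      · rw [h, bigOmegaBetween_one, Nat.cast_zero]
        have := hx.log_nonneg
        have : 0 ≤ normalErr (iterLog 2 x) := Real.sqrt_nonneg _
        positivity
      · have h2 : (sideValue f (lev (iterLog 2 x) 0) n i : ℝ) ≤ x := by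
          refine le_trans ?_ hn.value_le
          refine Nat.cast_le.2 (Nat.le_of_dvd hfn ?_)
          rw [hfd]
          exact (Finset.dvd_prod_of_mem
            (fun i : Fin (paramL x) => sideValue f (lev (iterLog 2 x) 0) n i)
            (Finset.mem_univ i)).trans (Dvd.intro_left _ rfl)
        rw [he] at h h2 ⊢
        exact hn.smooth_le hf hx hp hpn h2 h.le
    · rw [Finset.card_univ, Fintype.card_fin, nsmul_eq_mul]

theorem levelIndex_le (hf : ValueFunction f pr) (hx : LargeParam x) (hn : IsGood f ε x n) {M : ℕ}
    (hM : paramL x = M + 1) (i : Fin (M + 1)) :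
    levelIndex (iterLog 2 x) (sideValue f (lev (iterLog 2 x) 0) n i) * Real.sqrt (iterLog 2 x)
      ≤ iterLog 2 x := by
  have hX0 : 0 < iterLog 2 x := by linarith [hx.range.large]
  have hF := hn.sideData hf hx hM
  by_cases h : levelIndex (iterLog 2 x) (sideValue f (lev (iterLog 2 x) 0) n i) = 0
  · rw [h, Nat.cast_zero, zero_mul]
    exact hX0.le
  · refine (levelIndex_mul_lt hX0 h).le.trans ?_
    have h1 : (sideValue f (lev (iterLog 2 x) 0) n i : ℝ) ≤ x :=
      le_trans (by exact_mod_cast Nat.le_of_dvd (hf.pos n hn.pos) (hF.dvd i)) hn.value_le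
    exact iterLog_two_mono (by exact_mod_cast hF.one_lt h) h1

/-- Condition (8) carried over to levels. For a positive level, ℓ_i √X is below log_2 f(p_i) ≤ log_2
p_i + 1, and the 1 costs a_i ≤ M in each of the M terms. Row 0 is left out, as (8) does not involve
p_0. -/
theorem sum_levelIndex_le (hf : ValueFunction f pr) (hx : LargeParam x) (hn : IsGood f ε x n)
    {M : ℕ} (hM : paramL x = M + 1) :
    Real.sqrt (iterLog 2 x) * ∑ i ∈ (Finset.univ : Finset (Fin (M + 1))).erase 0,
      (levelIndex (iterLog 2 x) (sideValue f (lev (iterLog 2 x) 0) n i) : ℝ) * coeffA i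
      ≤ iterLog 2 x * (1 - omega ε x) + ((M : ℝ) + 1) ^ 2 := by
  have hX0 : 0 < iterLog 2 x := by linarith [hx.range.large]
  rw [sum_univ_erase_zero M (fun i =>
    (levelIndex (iterLog 2 x) (sideValue f (lev (iterLog 2 x) 0) n i) : ℝ) * coeffA i),
    Finset.mul_sum]
  have hcoord : ∀ i, i ≤ paramL x → iterLog 2 x * xCoord x n i = iterLog 2 (primeAt n i) := by
    intro i hi
    rw [hn.xCoord_eq hi, mul_div_cancel₀ _ hX0.ne']
  have hnn : ∀ i, 1 ≤ i → i ≤ paramL x → 0 ≤ xCoord x n i := fun i h1 h2 => hn.cond5.nonneg h1 h2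
  have h1 : ∀ j ∈ Finset.range M, Real.sqrt (iterLog 2 x) *
      ((levelIndex (iterLog 2 x) (sideValue f (lev (iterLog 2 x) 0) n (j + 1)) : ℝ)
        * coeffA (j + 1)) ≤ iterLog 2 x * (coeffA (j + 1) * xCoord x n (j + 1)) + (M + 1) := by
    intro j hj
    rw [Finset.mem_range] at hj
    have ha := coeffA_succ_nonneg j
    have ha' : coeffA (j + 1) ≤ M := (coeffA_succ_bounds j).2.trans (by exact_mod_cast hj)
    have hc := hcoord (j + 1) (by omega)
    have hz := mul_nonneg hX0.le (hnn (j + 1) (by omega) (by omega))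
    have key : levelIndex (iterLog 2 x) (sideValue f (lev (iterLog 2 x) 0) n (j + 1))
        * Real.sqrt (iterLog 2 x) ≤ iterLog 2 x * xCoord x n (j + 1) + 1 := by
      by_cases h : levelIndex (iterLog 2 x) (sideValue f (lev (iterLog 2 x) 0) n (j + 1)) = 0
      · rw [h, Nat.cast_zero, zero_mul]
        linarith
      · refine (levelIndex_mul_lt hX0 h).le.trans ?_
        rw [hc]
        rcases hn.sideValue_cases (i := j + 1) (by omega) with h2 | ⟨h2, p, hp, -, hp2, he, he'⟩
        · exact absurd (by rw [h2, levelIndex, Nat.ceil_eq_zero]; simp [iterLog_two]) h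
        · rw [← he, he']
          refine (iterLog_two_mono ?_ ?_).trans (iterLog_two_succ_le hp2)
          · rw [← he']
            exact (one_lt_lev _ _).trans h2
          · exact_mod_cast hf.prime_le p hp
    have := mul_le_mul_of_nonneg_left key ha
    nlinarith
  refine (Finset.sum_le_sum h1).trans ?_
  rw [Finset.sum_add_distrib, ← Finset.mul_sum, Finset.sum_const, Finset.card_range, nsmul_eq_mul]
  refine add_le_add (mul_le_mul_of_nonneg_left ?_ hX0.le) ?_
  · refine le_trans ?_ hn.cond8
    rw [sum_Icc_one_eq_sum_range, hM, Finset.sum_range_succ]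
    have := mul_nonneg (coeffA_succ_nonneg M) (hnn (M + 1) (by omega) (by omega))
    linarith
  · have : (0 : ℝ) ≤ M := Nat.cast_nonneg M
    nlinarith

end IsGood

end CommonValues


namespace CommonValues

open Finset

/-! ### Summation over the level vectors -/

/-- The heart of the optimization. The sum of the levels of the rows i ≥ 1 enters with coefficient
-1 from the tops, 1/2 from Rankin's factor and 1/2 from the sum over bulk primes, and cancels. There
remains half of ℓ_0 Y + Y ∑ a_i ℓ_i ≤ X + X(1 - ω). -/
theorem level_exponent_le {Y X η ω : ℝ} {M : ℕ} {ℓ : Fin (M + 1) → ℕ} (h0 : ℓ 0 * Y ≤ X)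
    (hs : Y * ∑ i ∈ Finset.univ.erase 0, (ℓ i : ℝ) * coeffA i
      ≤ X * (1 - ω) + ((M : ℝ) + 1) ^ 2) :
    -(∑ i ∈ Finset.univ.erase 0, ((ℓ i : ℝ) - 1) * Y) +
      (Y * ∑ k : Fin (M + 1), (ℓ k : ℝ) * (coeffA k + 1) + ((M : ℝ) + 1) ^ 2 * η) / 2 +
      (∑ i, ((ℓ i : ℝ) * Y + 9)) / 2
      ≤ X - X * ω / 2 + M * Y + ((M : ℝ) + 1) ^ 2 / 2 + ((M : ℝ) + 1) ^ 2 * η / 2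
        + 9 * ((M : ℝ) + 1) / 2 := by
  have hc : (((Finset.univ : Finset (Fin (M + 1))).erase 0).card : ℝ) = M := by
    rw [Finset.card_erase_of_mem (Finset.mem_univ _), Finset.card_univ, Fintype.card_fin]
    simp
  have e1 : ∑ i ∈ Finset.univ.erase 0, ((ℓ i : ℝ) - 1) * Y
      = (∑ i ∈ Finset.univ.erase 0, (ℓ i : ℝ)) * Y - M * Y := by
    rw [← Finset.sum_mul, Finset.sum_sub_distrib, Finset.sum_const, nsmul_eq_mul, hc]
    ring
  have e2 : ∑ k : Fin (M + 1), (ℓ k : ℝ) * (coeffA k + 1)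
      = ∑ i ∈ Finset.univ.erase 0, (ℓ i : ℝ) * coeffA i
        + ∑ i ∈ Finset.univ.erase 0, (ℓ i : ℝ) := by
    rw [← Finset.add_sum_erase _ _ (Finset.mem_univ (0 : Fin (M + 1))), ← Finset.sum_add_distrib]
    -- With 0 · log 0 = 0 this makes a_0 + 1 vanish, so row 0 drops out of the normality bound.
    have : coeffA ((0 : Fin (M + 1)) : ℕ) = -1 := by simp [coeffA]
    rw [this]
    simp only [neg_add_cancel, mul_zero, zero_add]
    exact Finset.sum_congr rfl fun i _ => by ring
  have e3 : ∑ i, ((ℓ i : ℝ) * Y + 9)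
      = ℓ 0 * Y + (∑ i ∈ Finset.univ.erase 0, (ℓ i : ℝ)) * Y + 9 * ((M : ℝ) + 1) := by
    rw [← Finset.add_sum_erase _ _ (Finset.mem_univ (0 : Fin (M + 1))), Finset.sum_add_distrib,
      Finset.sum_mul, Finset.sum_const, nsmul_eq_mul, hc]
    ring
  rw [e1, e2, e3]
  nlinarith

/-- A quantity dominating both `L` and `log X`. -/
noncomputable def logBound (X : ℝ) : ℝ := max (2 * constC) 1 * Real.log X

theorem LargeParam.logBound_spec {x : ℝ} (hx : LargeParam x) :
    1 ≤ logBound (iterLog 2 x) ∧ Real.log (iterLog 2 x) ≤ logBound (iterLog 2 x) ∧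
    (paramL x : ℝ) ≤ logBound (iterLog 2 x) := by
  have h1 : 1 ≤ Real.log (iterLog 2 x) := by
    rw [Real.le_log_iff_exp_le (by linarith [hx.range.large])]
    linarith [hx.range.large, Real.exp_one_lt_d9]
  have h2 := le_max_right (2 * constC) 1
  have h3 := le_max_left (2 * constC) 1
  have h4 : Real.log (iterLog 2 x) ≤ logBound (iterLog 2 x) := by
    rw [logBound]
    nlinarith
  refine ⟨h1.trans h4, h4, hx.le_log.trans ?_⟩
  exact mul_le_mul_of_nonneg_right h3 (by linarith)

theorem LargeParam.normalErr_le {x : ℝ} (hx : LargeParam x) :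
    normalErr (iterLog 2 x) ≤ 6 * logBound (iterLog 2 x) * Real.sqrt (iterLog 2 x) := by
  obtain ⟨h1, h2, -⟩ := hx.logBound_spec
  have hX := hx.range.large
  have h3 : 36 * Real.log (iterLog 2 x) ≤ (6 * logBound (iterLog 2 x)) ^ 2 := by nlinarith
  rw [normalErr, Real.sqrt_mul (by linarith [hx.log_nonneg])]
  refine mul_le_mul_of_nonneg_right ?_ (Real.sqrt_nonneg _)
  rw [Real.sqrt_le_left (by linarith)]
  exact h3

theorem LargeParam.smoothBound_le {x : ℝ} (hx : LargeParam x) :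
    (smoothBound x : ℝ) ≤ 99 * logBound (iterLog 2 x) ^ 2 * Real.sqrt (iterLog 2 x) := by
  obtain ⟨h1, h2, h3⟩ := hx.logBound_spec
  have h4 := hx.normalErr_le
  have h5 : 0 ≤ normalErr (iterLog 2 x) := Real.sqrt_nonneg _
  have h6 := hx.sqrt_ge
  have h7 := hx.log_nonneg
  set W := logBound (iterLog 2 x)
  set Y := Real.sqrt (iterLog 2 x)
  have h8 : 72 * Real.log (iterLog 2 x) + Y + normalErr (iterLog 2 x) ≤ 79 * W * Y := by
    nlinarith
  rw [smoothBound]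
  refine (Nat.floor_le (by positivity)).trans ?_
  have h9 : (paramL x : ℝ) * (72 * Real.log (iterLog 2 x) + Y + normalErr (iterLog 2 x))
      ≤ W * (79 * W * Y) := mul_le_mul h3 h8 (by positivity) (by linarith)
  have h10 : Y ≤ W ^ 2 * Y := le_mul_of_one_le_left (by linarith) (one_le_pow₀ h1)
  nlinarith

theorem mul_exp_bound {b k m g t b' k' m' g' t' e u s y z : ℝ} (hb : 0 ≤ b) (hk : 0 ≤ k)
    (hm : 0 ≤ m) (hg : 0 ≤ g) (ht : 0 ≤ t) (h1 : b ≤ Real.exp b') (h2 : k ≤ Real.exp k')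
    (h3 : m ≤ Real.exp m') (h4 : g ≤ Real.exp g') (h5 : t ≤ Real.exp t') :
    (b * b) * (Real.exp e * (k * Real.exp u) * (Real.exp s * (m * g)) * Real.exp y *
      (t * Real.exp z)) ≤ Real.exp e * Real.exp (2 * b' + k' + u + s + m' + g' + y + t' + z) := by
  calc _ ≤ (Real.exp b' * Real.exp b') * (Real.exp e * (Real.exp k' * Real.exp u) *
        (Real.exp s * (Real.exp m' * Real.exp g')) * Real.exp y * (Real.exp t' * Real.exp z)) := by
        gcongr
    _ = _ := by
      simp only [← Real.exp_add]
      congr 1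
      ring

/-- The final bound for the number of common values, before simplification. -/
theorem common_bound {X Y W ω η : ℝ} {M Om B : ℕ} {ℓ ℓ' : Fin (M + 1) → ℕ} (hX : 101 ≤ X)
    (hY : 1 ≤ Y) (hYX : Y + 1 ≤ X) (hW : 1 ≤ W) (hlog : Real.log X ≤ W) (hM : (M : ℝ) + 1 ≤ W)
    (hη : η ≤ 6 * W * Y) (hOm : (Om : ℝ) ≤ 99 * W ^ 2 * Y) (hB0 : 0 < B) (hB : (B : ℝ) ≤ Y + 1)
    (h0 : ℓ 0 * Y ≤ X) (h0' : ℓ' 0 * Y ≤ X)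
    (hs : Y * ∑ i ∈ Finset.univ.erase 0, (ℓ i : ℝ) * coeffA i
      ≤ X * (1 - ω) + ((M : ℝ) + 1) ^ 2)
    (hs' : Y * ∑ i ∈ Finset.univ.erase 0, (ℓ' i : ℝ) * coeffA i
      ≤ X * (1 - ω) + ((M : ℝ) + 1) ^ 2) :
    ((B : ℝ) ^ (M + 1) * (B : ℝ) ^ (M + 1)) *
    (Real.exp (Real.exp X) * (X ^ 16 * Real.exp (-(3 * X))) *
      (Real.exp (-(∑ i ∈ Finset.univ.erase 0, ((ℓ i : ℝ) - 1) * Y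
        + ∑ i ∈ Finset.univ.erase 0, ((ℓ' i : ℝ) - 1) * Y)) *
        ((2 * M + 3) * (4 * ((M : ℝ) + 1) ^ 2 * X ^ 17) ^ (2 * (M + 1)))) *
      Real.exp (((Y * ∑ k : Fin (M + 1), (ℓ k : ℝ) * (coeffA k + 1)
        + ((M : ℝ) + 1) ^ 2 * η) + (Y * ∑ k : Fin (M + 1), (ℓ' k : ℝ) * (coeffA k + 1)
        + ((M : ℝ) + 1) ^ 2 * η)) / 2 +
      (∑ i, ((ℓ i : ℝ) * Y + 9) + ∑ i, ((ℓ' i : ℝ) * Y + 9)) / 2) *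
      (2 ^ (2 * (M + 1) * Om) * Real.exp (Y + 7)))
    ≤ Real.exp (Real.exp X) * Real.exp (-X - X * ω + 300 * W ^ 3 * Y) := by
  have hX0 : 0 < X := by linarith
  -- Each side gives X - Xω/2, so that with the exp(-3X) of the largest prime the main exponent is
  -- -X - Xω. All other factors are exponentials of multiples of W³Y at most.
  have h1 := level_exponent_le (η := η) h0 hs
  have h2 := level_exponent_le (η := η) h0' hs'
  have hXe : X ≤ Real.exp W := by
    rw [← Real.log_le_iff_le_exp hX0]; exact hlog
  have hM0 : (0 : ℝ) ≤ M := Nat.cast_nonneg M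
  have hBe : (B : ℝ) ^ (M + 1) ≤ Real.exp (W * W) := by
    have : (B : ℝ) ≤ Real.exp W := by linarith
    refine (pow_le_pow_left₀ (Nat.cast_nonneg _) this _).trans ?_
    rw [← Real.exp_nat_mul]
    refine Real.exp_le_exp.2 ?_
    push_cast
    exact mul_le_mul_of_nonneg_right hM (by linarith)
  have hX16 : X ^ 16 ≤ Real.exp (16 * W) := by
    refine (pow_le_pow_left₀ hX0.le hXe 16).trans (le_of_eq ?_)
    rw [← Real.exp_nat_mul]
    norm_num
  have hMe : 2 * (M : ℝ) + 3 ≤ Real.exp (2 * W) := by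
    linarith [Real.add_one_le_exp (2 * W)]
  have hbig : (4 * ((M : ℝ) + 1) ^ 2 * X ^ 17) ^ (2 * (M + 1)) ≤ Real.exp (42 * W ^ 2) := by
    have h3 : 4 * ((M : ℝ) + 1) ^ 2 * X ^ 17 ≤ Real.exp (21 * W) := by
      have h4 : 4 * ((M : ℝ) + 1) ^ 2 ≤ Real.exp (4 * W) := by
        have h5 : 2 * ((M : ℝ) + 1) ≤ Real.exp (2 * W) := by
          linarith [Real.add_one_le_exp (2 * W)]
        have h6 := pow_le_pow_left₀ (by positivity) h5 2
        rw [← Real.exp_nat_mul] at h6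
        refine le_trans (le_of_eq (by ring)) (h6.trans (le_of_eq ?_))
        congr 1
        push_cast
        ring
      have h5 : X ^ 17 ≤ Real.exp (17 * W) := by
        refine (pow_le_pow_left₀ hX0.le hXe 17).trans (le_of_eq ?_)
        rw [← Real.exp_nat_mul]
        norm_num
      refine (mul_le_mul h4 h5 (by positivity) (Real.exp_pos _).le).trans (le_of_eq ?_)
      rw [← Real.exp_add]
      congr 1
      ring
    refine (pow_le_pow_left₀ (by positivity) h3 _).trans ?_
    rw [← Real.exp_nat_mul]
    refine Real.exp_le_exp.2 ?_
    push_cast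
    nlinarith
  have h2Om : (2 : ℝ) ^ (2 * (M + 1) * Om) ≤ Real.exp (198 * W ^ 3 * Y) := by
    have h3 : (2 : ℝ) ≤ Real.exp 1 := by linarith [Real.add_one_le_exp (1 : ℝ)]
    refine (pow_le_pow_left₀ (by norm_num) h3 _).trans ?_
    rw [← Real.exp_nat_mul, mul_one]
    refine Real.exp_le_exp.2 ?_
    push_cast
    have := mul_le_mul hM hOm (Nat.cast_nonneg _) (by linarith)
    nlinarith
  refine (mul_exp_bound (by positivity) (by positivity) (by positivity) (by positivity)
    (by positivity) hBe hX16 hMe hbig h2Om).trans ?_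
  refine mul_le_mul_of_nonneg_left (Real.exp_le_exp.2 ?_) (Real.exp_pos _).le
  have hWY : W ≤ W ^ 3 * Y := by
    have : W ≤ W ^ 3 := le_self_pow₀ hW (by norm_num)
    nlinarith
  have hW2 : W ^ 2 ≤ W ^ 3 * Y := by
    have : W ^ 2 ≤ W ^ 3 := pow_le_pow_right₀ hW (by norm_num)
    nlinarith [pow_pos (show 0 < W by linarith) 3]
  have hWY' : W * Y ≤ W ^ 3 * Y :=
    mul_le_mul_of_nonneg_right (le_self_pow₀ hW (by norm_num)) (by linarith)
  have hYW : Y ≤ W ^ 3 * Y := le_mul_of_one_le_left (by linarith) (one_le_pow₀ hW)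
  have hm2 : ((M : ℝ) + 1) ^ 2 ≤ W ^ 2 := pow_le_pow_left₀ (by positivity) hM 2
  have hm2η : ((M : ℝ) + 1) ^ 2 * η ≤ 6 * (W ^ 3 * Y) := by
    have h3 : ((M : ℝ) + 1) ^ 2 * η ≤ ((M : ℝ) + 1) ^ 2 * (6 * W * Y) :=
      mul_le_mul_of_nonneg_left hη (by positivity)
    have h4 : ((M : ℝ) + 1) ^ 2 * (6 * W * Y) ≤ W ^ 2 * (6 * W * Y) :=
      mul_le_mul_of_nonneg_right hm2 (by positivity)
    linarith
  have hMY : (M : ℝ) * Y ≤ W * Y := mul_le_mul_of_nonneg_right (by linarith) (by linarith)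
  linarith

theorem ncard_le_of_biUnion {α β : Type*} (s : Set α) (t : Finset β) (V : β → Finset α) {b : ℝ}
    (hs : ∀ v ∈ s, ∃ i ∈ t, v ∈ V i) (hV : ∀ i ∈ t, ((V i).card : ℝ) ≤ b) :
    (s.ncard : ℝ) ≤ t.card * b := by
  classical
  have h1 : s ⊆ (t.biUnion V : Finset α) := fun v hv => by
    obtain ⟨i, hi, h⟩ := hs v hv
    exact Finset.mem_coe.2 (Finset.mem_biUnion.2 ⟨i, hi, h⟩)
  have h2 := Set.ncard_le_ncard h1 (Finset.finite_toSet _)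
  rw [Set.ncard_coe_finset] at h2
  have h3 : (s.ncard : ℝ) ≤ ((t.biUnion V).card : ℝ) := by exact_mod_cast h2
  have h4 : ((t.biUnion V).card : ℝ) ≤ ∑ i ∈ t, ((V i).card : ℝ) := by
    exact_mod_cast Finset.card_biUnion_le
  rw [← nsmul_eq_mul]
  exact (h3.trans h4).trans (Finset.sum_le_card_nsmul _ _ _ hV)

/-- All levels are at most √X, so there are at most (⌊√X⌋ + 1)^(2L) pairs of level vectors. The
values are covered by the sets belonging to admissible pairs, and `common_bound` already contains
the number of pairs. -/
theorem commonCount_le {ε x : ℝ} (hx : LargeParam x) :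
    (commonCount ε x : ℝ) ≤ Real.exp (Real.exp (iterLog 2 x)) * Real.exp (-iterLog 2 x
      - iterLog 2 x * omega ε x
      + 300 * logBound (iterLog 2 x) ^ 3 * Real.sqrt (iterLog 2 x)) := by
  classical
  obtain ⟨M, hM⟩ : ∃ M, paramL x = M + 1 := ⟨paramL x - 1, by have := hx.one_le; omega⟩
  obtain ⟨hW1, hW2, hW3⟩ := hx.logBound_spec
  have hη := hx.normalErr_le
  have hOm := hx.smoothBound_le
  have hY := hx.sqrt_ge
  have hXl := hx.range.large
  have hη0 : 0 ≤ normalErr (iterLog 2 x) := Real.sqrt_nonneg _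
  have hYX : Real.sqrt (iterLog 2 x) + 1 ≤ iterLog 2 x := by
    nlinarith [Real.mul_self_sqrt (show 0 ≤ iterLog 2 x by linarith)]
  rw [hM] at hW3
  push_cast at hW3
  set X := iterLog 2 x with hXd
  set Y := Real.sqrt X with hYd
  set B := ⌊Y⌋₊ + 1 with hBd
  have hB : (B : ℝ) ≤ Y + 1 := by
    rw [hBd]
    push_cast
    linarith [Nat.floor_le (show 0 ≤ Y by linarith)]
  set good : (Fin (M + 1) → ℕ) → Prop := fun ℓ => ℓ 0 * Y ≤ X ∧
    Y * ∑ i ∈ Finset.univ.erase 0, (ℓ i : ℝ) * coeffA i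
      ≤ X * (1 - omega ε x) + ((M : ℝ) + 1) ^ 2 with hgood
  set Λ := Fintype.piFinset (fun _ : Fin (M + 1) => Finset.range B) with hΛ
  set V : ((Fin (M + 1) → ℕ) × (Fin (M + 1) → ℕ)) → Finset ℕ := fun q =>
    (Finset.range (⌊x⌋₊ + 1)).filter fun v => (good q.1 ∧ good q.2) ∧
      (ValueData X (smoothBound x) v ∧
      (∃ F, SideData X (normalErr X) (fun n => (n + 1).Prime) q.1 v F) ∧
      ∃ G, SideData X (normalErr X) (fun n => (n - 1).Prime) q.2 v G) with hVd
  have hcard : ((Λ ×ˢ Λ).card : ℝ) = (B : ℝ) ^ (M + 1) * (B : ℝ) ^ (M + 1) := by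
    rw [Finset.card_product, hΛ, Fintype.card_piFinset]
    simp
  have hmem : ∀ (f : ℕ → ℕ) (pr : ℕ → Prop), ValueFunction f pr → ∀ n, IsGood f ε x n →
      (fun i : Fin (M + 1) => levelIndex X (sideValue f (lev X 0) n i)) ∈ Λ ∧
      good (fun i : Fin (M + 1) => levelIndex X (sideValue f (lev X 0) n i)) := by
    intro f pr hf n hn
    refine ⟨Fintype.mem_piFinset.2 fun i => ?_, hn.levelIndex_le hf hx hM 0,
      hn.sum_levelIndex_le hf hx hM⟩
    have h1 := hn.levelIndex_le hf hx hM i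
    rw [Finset.mem_range, hBd, Nat.lt_succ_iff]
    refine Nat.le_floor ?_
    have h2 : Y * Y = X := Real.mul_self_sqrt (by linarith)
    refine le_of_mul_le_mul_right (h1.trans (le_of_eq ?_)) (show 0 < Y by linarith)
    rw [h2]
  set bound := Real.exp (Real.exp X) * Real.exp (-X - X * omega ε x
    + 300 * logBound X ^ 3 * Y) with hbound
  have hBpos : (0 : ℝ) < (B : ℝ) ^ (M + 1) * (B : ℝ) ^ (M + 1) := by positivity
  have key := ncard_le_of_biUnion
    {v : ℕ | ∃ a ∈ setA phi ε x, ∃ a' ∈ setA sigma ε x, phi a = sigma a' ∧ v = phi a}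
    (Λ ×ˢ Λ) V (b := bound / ((B : ℝ) ^ (M + 1) * (B : ℝ) ^ (M + 1))) ?_ ?_
  · rw [hcard, mul_div_cancel₀ _ hBpos.ne'] at key
    exact key
  · rintro v ⟨a, ha, a', ha', heq, rfl⟩
    have ha : IsGood phi ε x a := ha
    have ha' : IsGood sigma ε x a' := ha'
    have h1 := hmem _ _ valueFunction_phi a ha
    have h2 := hmem _ _ valueFunction_sigma a' ha'
    refine ⟨(_, _), Finset.mem_product.2 ⟨h1.1, h2.1⟩, Finset.mem_filter.2 ⟨?_, ⟨h1.2, h2.2⟩,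
      ha.valueData valueFunction_phi hx, ⟨_, ha.sideData valueFunction_phi hx hM⟩, ?_⟩⟩
    · rw [Finset.mem_range, Nat.lt_succ_iff]
      exact Nat.le_floor ha.value_le
    · rw [heq]
      exact ⟨_, ha'.sideData valueFunction_sigma hx hM⟩
  · rintro ⟨ℓ, ℓ'⟩ -
    rw [le_div_iff₀ hBpos, mul_comm]
    by_cases hg : good ℓ ∧ good ℓ'
    · refine le_trans ?_ (common_bound (ℓ := ℓ) (ℓ' := ℓ') hXl (by linarith) hYX hW1 hW2 hW3 hη hOm
        (Nat.succ_pos _) hB hg.1.1 hg.2.1 hg.1.2 hg.2.2)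
      refine mul_le_mul_of_nonneg_left ?_ hBpos.le
      exact card_values_le hx.range hη0 _ fun v hv => (Finset.mem_filter.1 hv).2.2
    · have : V (ℓ, ℓ') = ∅ := Finset.filter_eq_empty_iff.2 fun v _ h => hg h.1
      rw [this, Finset.card_empty, Nat.cast_zero, mul_zero]
      positivity

end CommonValues


namespace CommonValues

open Finset

/-! ### Conclusion -/

theorem primeCounting_le_valueCount_phi {x : ℝ} (hx : 0 ≤ x) :
    Nat.primeCounting ⌊x⌋₊ ≤ valueCount phi x := by
  have h1 : ((⌊x⌋₊ + 1).primesBelow.image fun p => p - 1 : Finset ℕ).card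
      = Nat.primeCounting ⌊x⌋₊ := by
    rw [Finset.card_image_of_injOn, Nat.primesBelow_card_eq_primeCounting']
    · rfl
    · intro p hp q hq h
      have hp1 := (Nat.prime_of_mem_primesBelow hp).one_le
      have hq1 := (Nat.prime_of_mem_primesBelow hq).one_le
      have h : p - 1 = q - 1 := h
      omega
  rw [← h1, ← Set.ncard_coe_finset]
  refine Set.ncard_le_ncard ?_ ((Set.finite_Iic ⌊x⌋₊).subset fun v hv => Nat.le_floor hv.2.2)
  intro v hv
  obtain ⟨p, hp, rfl⟩ := Finset.mem_image.1 (Finset.mem_coe.1 hv)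
  have hpp := Nat.prime_of_mem_primesBelow hp
  have hlt := Nat.lt_of_mem_primesBelow hp
  have h2 := hpp.two_le
  refine ⟨⟨p, hpp.pos, Nat.totient_prime hpp⟩, by omega, ?_⟩
  exact (Nat.le_floor_iff hx).1 (by omega)

theorem eventually_le_valueCount_phi :
    ∀ᶠ x : ℝ in atTop, x / Real.log x / 2 ≤ valueCount phi x := by
  have h1 := Real.isLittleO_log_id_atTop.bound (c := 1 / 20) (by norm_num)
  have h2 := (tendsto_atTop_add_const_right atTop (2 : ℝ) tendsto_id).eventually h1
  filter_upwards [h2, eventually_ge_atTop 10] with x h3 hx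
  simp only [id, Real.norm_eq_abs] at h3
  rw [abs_of_nonneg (show (0 : ℝ) ≤ x + 2 by linarith)] at h3
  have h4 := (le_abs_self _).trans h3
  have h5 := Chebyshev.pi_ge' (x := x) (by linarith)
  have h6 : (Nat.primeCounting ⌊x⌋₊ : ℝ) ≤ valueCount phi x := by
    exact_mod_cast primeCounting_le_valueCount_phi (x := x) (by linarith)
  refine le_trans ?_ (h5.trans h6)
  rw [div_right_comm]
  refine div_le_div_of_nonneg_right ?_ (Real.log_nonneg (by linarith))
  nlinarith [Real.log_two_gt_d9]

/-- Here Xω = √X · X^(ε/2), and (log X)³ = o(X^(ε/2)); the error term is made at most 3/4 of Xω,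
which leaves the factor 1/4. -/
theorem eventually_commonCount_le {ε : ℝ} (hε : 0 < ε) : ∀ᶠ x : ℝ in atTop,
    (commonCount ε x : ℝ) ≤ x / Real.log x *
      Real.exp (-(1 / 4) * Real.log (Real.log x) ^ (1 / 2 + ε / 2)) := by
  set c := max (2 * constC) 1 with hc
  have hc0 : 0 < c := lt_of_lt_of_le one_pos (le_max_right _ _)
  have h1 := (isLittleO_log_rpow_rpow_atTop 3 (half_pos hε)).bound
    (c := 3 / 4 / (300 * c ^ 3)) (by positivity)
  filter_upwards [eventually_largeParam, tendsto_iterLog_two.eventually h1] with x hx h2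
  have hX := hx.range.large
  have hX0 : 0 < iterLog 2 x := by linarith
  have h3 := commonCount_le (ε := ε) hx
  refine h3.trans ?_
  have hl := hx.log_nonneg
  rw [Real.norm_of_nonneg (Real.rpow_nonneg hl _), Real.norm_of_nonneg (Real.rpow_nonneg hX0.le _),
    show (3 : ℝ) = ((3 : ℕ) : ℝ) by norm_num, Real.rpow_natCast] at h2
  have h4 : iterLog 2 x * omega ε x = iterLog 2 x ^ (1 / 2 + ε / 2) := by
    rw [omega, ← Real.rpow_one_add' hX0.le (by linarith)]
    congr 1
    ring
  have h5 : iterLog 2 x ^ (1 / 2 + ε / 2)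
      = Real.sqrt (iterLog 2 x) * iterLog 2 x ^ (ε / 2) := by
    rw [Real.sqrt_eq_rpow, Real.rpow_add hX0]
  have h6 : 300 * logBound (iterLog 2 x) ^ 3 * Real.sqrt (iterLog 2 x)
      ≤ 3 / 4 * iterLog 2 x ^ (1 / 2 + ε / 2) := by
    rw [h5, logBound, ← hc, mul_pow]
    have h7 := mul_le_mul_of_nonneg_left h2 (show 0 ≤ 300 * c ^ 3 by positivity)
    rw [← mul_assoc, mul_div_cancel₀ _ (by positivity)] at h7
    push_cast at h7
    nlinarith [Real.sqrt_nonneg (iterLog 2 x)]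
  have h8 : x / Real.log x = Real.exp (Real.exp (iterLog 2 x)) * Real.exp (-iterLog 2 x) := by
    rw [hx.log_eq, hx.exp_exp, Real.exp_neg, div_eq_mul_inv]
  rw [h8, mul_assoc (Real.exp (Real.exp (iterLog 2 x))) (Real.exp (-iterLog 2 x)),
    ← Real.exp_add (-iterLog 2 x)]
  refine mul_le_mul_of_nonneg_left (Real.exp_le_exp.2 ?_) (Real.exp_pos _).le
  rw [← iterLog_two]
  linarith

theorem eventually_rpow_mul_exp_lt {ε A : ℝ} (hε : 0 < ε) :
    ∀ᶠ X : ℝ in atTop, X ^ A * Real.exp (-(1 / 4) * X ^ (1 / 2 + ε / 2)) < 1 / 2 := by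
  have h1 := (isLittleO_rpow_exp_pos_mul_atTop (2 * A) (b := 1 / 4) (by norm_num)).bound
    (c := 1 / 4) (by norm_num)
  have h2 := (tendsto_rpow_atTop (y := 1 / 2) (by norm_num)).eventually h1
  filter_upwards [h2, eventually_ge_atTop 1] with X h3 hX
  have hX0 : 0 ≤ X := by linarith
  rw [Real.norm_of_nonneg (Real.rpow_nonneg (Real.rpow_nonneg hX0 _) _),
    Real.norm_of_nonneg (Real.exp_pos _).le, ← Real.rpow_mul hX0] at h3
  rw [show 1 / 2 * (2 * A) = A by ring] at h3
  have h4 : X ^ (1 / 2 : ℝ) ≤ X ^ (1 / 2 + ε / 2) :=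
    Real.rpow_le_rpow_of_exponent_le hX (by linarith)
  have h5 : Real.exp (-(1 / 4) * X ^ (1 / 2 + ε / 2)) ≤ Real.exp (-(1 / 4 * X ^ (1 / 2 : ℝ))) :=
    Real.exp_le_exp.2 (by linarith)
  have h6 := mul_le_mul h3 h5 (Real.exp_pos _).le (by positivity)
  rw [mul_assoc, ← Real.exp_add, add_neg_cancel, Real.exp_zero] at h6
  linarith

/-- The totients p - 1 alone give V_φ(x) ≥ x / (2 log x) by Chebyshev, and the exponential saving
beats any power of log_2 x. -/
theorem eventually_commonCount_lt {ε A : ℝ} (hε : 0 < ε) : ∀ᶠ x : ℝ in atTop,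
    (commonCount ε x : ℝ) < ((valueCount phi x : ℝ) + (valueCount sigma x : ℝ)) /
      Real.log (Real.log x) ^ A := by
  filter_upwards [eventually_commonCount_le hε, eventually_le_valueCount_phi,
    tendsto_iterLog_two.eventually (eventually_rpow_mul_exp_lt (A := A) hε),
    tendsto_iterLog_two.eventually_gt_atTop 0, Real.tendsto_log_atTop.eventually_gt_atTop 0,
    eventually_gt_atTop 0] with x h1 h2 h3 hX hlog hx
  rw [iterLog_two] at h3 hX
  have h4 : 0 < Real.log (Real.log x) ^ A := Real.rpow_pos_of_pos hX _
  rw [lt_div_iff₀ h4]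
  have h5 : 0 < x / Real.log x := div_pos hx hlog
  have h6 := mul_le_mul_of_nonneg_right h1 h4.le
  have h7 := mul_lt_mul_of_pos_left h3 h5
  have h8 : (0 : ℝ) ≤ valueCount sigma x := Nat.cast_nonneg _
  linarith

end CommonValues

theorem mainTheorem3 :
    (∀ ε : ℝ, 0 < ε → ∀ A : ℝ, 0 < A → ∀ᶠ x : ℝ in atTop,
      (CommonValues.commonCount ε x : ℝ) <
        ((CommonValues.valueCount CommonValues.phi x : ℝ) +
          (CommonValues.valueCount CommonValues.sigma x : ℝ)) /
          Real.log (Real.log x) ^ A) ∧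
    (∃ K : ℝ, 0 < K ∧ ∀ ε : ℝ, 0 < ε → ∀ᶠ x : ℝ in atTop,
      (CommonValues.commonCount ε x : ℝ) ≤
        K * (x / Real.log x *
          Real.exp (-(1 / 4) * Real.log (Real.log x) ^ (1 / 2 + ε / 2)))) :=
  ⟨fun _ hε _ _ => CommonValues.eventually_commonCount_lt hε, 1, one_pos, fun _ hε => by
    simpa only [one_mul] using CommonValues.eventually_commonCount_le hε⟩
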